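/- **Setting.** Let $\{\xi_t\}_{t\ge 0}$ be a process on a probability space $(\Omega,\mathcal F,P)$ with values in a measurable space $(S,\mathcal A)$, such that every $\xi_t$ has the law $\pi$. For $f\in L^2(\pi)$ (complex valued) and $t\ge 0$ let $T_tf(x)=E[f(\xi_t)\mid \xi_0=x]$. Suppose that $\xi$ is progressively measurable with respect to a filtration $\{\mathcal F_t\}_{t\ge0}$ and satisfies the Markov property $E[f(\xi_t)\mid\mathcal F_u]=T_{t-u}f(\xi_u)$ for all $f\in L^2(\pi)$ and $0\le u<t$, that the contraction semigroup $(T_t)$ is strongly continuous on $L^2(\pi)$, and that its infinitesimal generator $L$ is a normal (possibly unbounded) operator. Let $g\in L^2(\pi)$ be real with $\int g\,d\pi=0$, and let $\nu(B)=\langle g,E(B)g\rangle$ be the spectral measure of $L$ at $g$, where $E$ is the resolution of the identity of $L$; it is a finite measure carried by $\{\Re z\le 0\}$, and $\mathrm{cov}(g(\xi_0),g(\xi_t))=\int e^{zt}\,\nu(dz)$. Put $$S_T=\int_0^T g(\xi_s)\,ds,\qquad \varsigma^2=-2\int_{\{\Re z\le 0\}}\Re(1/z)\,\nu(dz)\in[0,\infty],\qquad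 U_x=\{a+ib:\ 0\le -a\le |b|\le x\}\quad (x>0).$$ **Theorem.** 1. For every real $K>0$ the following are equivalent: (i) $\mathrm{var}(S_T)/T$ converges, as $T\to\infty$, to a finite limit, which equals $\varsigma^2+K$; (ii) $\varsigma^2<\infty$ and $\nu(U_x)/x\to K/\pi$ as $x\to0^+$. Moreover, if $\mathrm{var}(S_T)/T$ converges to any finite limit as $T\to\infty$, then $\varsigma^2<\infty$. 2. Suppose that $\varsigma^2<\infty$ and $\mathrm{var}(S_T)/T\to\infty$ as $T\to\infty$. Let $1\le\alpha<2$, let $h:(0,\infty)\to(0,\infty)$ be measurable and slowly varying at infinity, that is, $h(st)/h(t)\to1$ as $t\to\infty$ for every $s>0$, and let $$C(\alpha)=\frac{\Gamma(1+\alpha)\sin(\alpha\pi/2)}{\pi(2-\alpha)}.$$ Then $\mathrm{var}(S_T)\sim T^{\alpha}h(T)$ as $T\to\infty$ if and only if $\nu(U_x)\sim C(\alpha)\,x^{2-\alpha}h(1/x)$ as $x\to0^+$. Here $a\sim b$ means that $a/b\to1$. -/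

import Mathlib

open MeasureTheory ProbabilityTheory Filter Topology
open scoped NNReal ENNReal InnerProductSpace CompactlySupported

noncomputable section

namespace NormalMarkov

/-! ### Unbounded operators: generator, normality, resolvent, spectral measure -/

section Operators

variable {H : Type*} [NormedAddCommGroup H] [InnerProductSpace ℂ H]

/-- The graph of the infinitesimal generator of `(T t)`: the pairs `(f, h)` such that
`(T t f - f) / t → h` in norm as `t → 0+`. -/
def generatorGraph (T : ℝ≥0 → H →L[ℂ] H) : Submodule ℂ (H × H) where
  carrier := {p | Tendsto (fun t : ℝ≥0 => ((t : ℝ) : ℂ)⁻¹ • (T t p.1 - p.1)) (𝓝[>] 0) (𝓝 p.2)}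
  zero_mem' := by simp
  add_mem' := by
    intro a b ha hb
    have h := Tendsto.add ha hb
    refine h.congr fun t => ?_
    simp only [Prod.fst_add, map_add, ← smul_add]
    congr 1
    abel
  smul_mem' := by
    intro c a ha
    have h := Tendsto.const_smul ha c
    refine h.congr fun t => ?_
    simp only [Prod.smul_fst, map_smul, ← smul_sub]
    rw [smul_comm]

/-- The infinitesimal generator `L` of `(T t)`, as a (possibly unbounded) operator:
`L f = lim_{t → 0+} (T t f - f) / t` with domain the set of `f` for which the limit exists. -/
def generator (T : ℝ≥0 → H →L[ℂ] H) : H →ₗ.[ℂ] H := (generatorGraph T).toLinearPMap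

/-- The graph of the generator is what it should be. -/
theorem mem_graph_generator (T : ℝ≥0 → H →L[ℂ] H) (f h : H) :
    (f, h) ∈ (generator T).graph ↔
      Tendsto (fun t : ℝ≥0 => ((t : ℝ) : ℂ)⁻¹ • (T t f - f)) (𝓝[>] 0) (𝓝 h) := by
  have hne : (𝓝[>] (0 : ℝ≥0)).NeBot := inferInstance
  rw [generator, Submodule.toLinearPMap_graph_eq]
  · rfl
  · rintro ⟨x, y⟩ hx hx0
    simp only at hx0
    subst hx0
    have h1 : Tendsto (fun t : ℝ≥0 => ((t : ℝ) : ℂ)⁻¹ • (T t 0 - 0)) (𝓝[>] 0) (𝓝 y) := hx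
    simp only [map_zero, sub_zero, smul_zero] at h1
    exact tendsto_nhds_unique h1 tendsto_const_nhds

variable [CompleteSpace H]

/-- A (possibly unbounded) operator `A` is normal if it is closed, densely defined and
`A† A = A A†`, an equality of unbounded operators (that is, of their graphs). -/
def IsNormalOperator (A : H →ₗ.[ℂ] H) : Prop :=
  A.IsClosed ∧ Dense (A.domain : Set H) ∧
    ∀ x y : H, (∃ u, (x, u) ∈ A.graph ∧ (u, y) ∈ A.adjoint.graph) ↔
      (∃ u, (x, u) ∈ A.adjoint.graph ∧ (u, y) ∈ A.graph)

/-- `R = (c - A)⁻¹`: the bounded operator `R` is a two-sided inverse of `c - A`. -/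
def IsResolvent (A : H →ₗ.[ℂ] H) (c : ℂ) (R : H →L[ℂ] H) : Prop :=
  ∀ f h : H, R f = h ↔ ∃ x : A.domain, (x : H) = h ∧ c • (x : H) - A x = f

open Classical in
/-- The resolvent `(c - A)⁻¹` (and `0` by convention if `c` is not in the resolvent set). -/
def resolventOp (A : H →ₗ.[ℂ] H) (c : ℂ) : H →L[ℂ] H :=
  if h : ∃ R, IsResolvent A c R then h.choose else 0

open scoped ComplexOrder in
/-- The positive linear functional `f ↦ ⟨g, f(N) g⟩` given by the continuous functional calculus
of the bounded normal operator `N`. -/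
def spectralFunctional (N : H →L[ℂ] H) (g : H) : C_c(ℂ, ℝ) →ₚ[ℝ] ℝ :=
  PositiveLinearMap.mk₀
    { toFun := fun f => (⟪g, cfc (fun z : ℂ => ((f z : ℝ) : ℂ)) N g⟫_ℂ).re
      map_add' := by
        intro f₁ f₂
        have h1 : Continuous (fun z : ℂ => ((f₁ z : ℝ) : ℂ)) := by fun_prop
        have h2 : Continuous (fun z : ℂ => ((f₂ z : ℝ) : ℂ)) := by fun_prop
        simp only [CompactlySupportedContinuousMap.coe_add, Pi.add_apply, Complex.ofReal_add]
        rw [cfc_add N (fun z : ℂ => ((f₁ z : ℝ) : ℂ)) (fun z : ℂ => ((f₂ z : ℝ) : ℂ))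
          h1.continuousOn h2.continuousOn]
        simp
      map_smul' := by
        intro c f
        have h1 : Continuous (fun z : ℂ => ((f z : ℝ) : ℂ)) := by fun_prop
        simp only [CompactlySupportedContinuousMap.coe_smul, Pi.smul_apply, smul_eq_mul,
          Complex.ofReal_mul, RingHom.id_apply]
        rw [cfc_const_mul _ _ _ h1.continuousOn]
        simp }
    (by
      intro f hf
      have h1 : (0 : H →L[ℂ] H) ≤ cfc (fun z : ℂ => ((f z : ℝ) : ℂ)) N := by
        refine cfc_nonneg fun z _ => ?_
        have : 0 ≤ f z := hf z
        exact_mod_cast this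
      have h2 := (ContinuousLinearMap.nonneg_iff_isPositive _).1 h1
      exact (Complex.le_def.1 (h2.inner_nonneg_right g)).1)

/-- The spectral measure `B ↦ ⟨g, E(B) g⟩` of the bounded normal operator `N` (with resolution of
the identity `E`) at the vector `g`: the measure on `ℂ` with `∫ f = ⟨g, f(N) g⟩`. -/
def boundedSpectralMeasure (N : H →L[ℂ] H) (g : H) : Measure ℂ :=
  RealRMK.rieszMeasure (spectralFunctional N g)

/-- The spectral measure `B ↦ ⟨g, E(B) g⟩` at the vector `g` of a normal operator `A` whose
resolvent set contains `1` (for example the normal generator of a contraction semigroup), where `E`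
is the resolution of the identity of `A`. As `A = 1 - N⁻¹` for the bounded normal operator
`N = (1 - A)⁻¹`, it is the image of the spectral measure of `N` under `w ↦ 1 - w⁻¹`.
(`N` is injective, so that its spectral measures have no atom at `w = 0`.) -/
def spectralMeasure (A : H →ₗ.[ℂ] H) (g : H) : Measure ℂ :=
  (boundedSpectralMeasure (resolventOp A 1) g).map (fun w => 1 - w⁻¹)

end Operators

/-! ### Stationary Markov processes -/

section Markov

variable {Ω S : Type*} [mΩ : MeasurableSpace Ω] [mS : MeasurableSpace S]

/-- The transition operator `(T_t f)(x) = E[f(ξ_t) | ξ_0 = x]` on complex `L²(π)`, where all `ξ_t`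
have law `π`: since `f ↦ f ∘ ξ_0` embeds `L²(π)` isometrically onto the space of square integrable
`σ(ξ_0)`-measurable functions, `E[ · | ξ_0 = x]` is the adjoint of this embedding. -/
def transitionOp (P : Measure Ω) (π : Measure S) (ξ : ℝ≥0 → Ω → S)
    (hπ : ∀ t, MeasurePreserving (ξ t) P π) (t : ℝ≥0) : Lp ℂ 2 π →L[ℂ] Lp ℂ 2 π :=
  ContinuousLinearMap.adjoint
      (Lp.compMeasurePreservingₗᵢ ℂ (ξ 0) (hπ 0) : Lp ℂ 2 π →ₗᵢ[ℂ] Lp ℂ 2 P).toContinuousLinearMap ∘L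
    (Lp.compMeasurePreservingₗᵢ ℂ (ξ t) (hπ t) : Lp ℂ 2 π →ₗᵢ[ℂ] Lp ℂ 2 P).toContinuousLinearMap

/-- `(T_t f)(ξ_0) = E[f(ξ_t) | σ(ξ_0)]` almost surely. -/
theorem transitionOp_comp_ae_eq_condExp (P : Measure Ω) [IsProbabilityMeasure P] (π : Measure S)
    (ξ : ℝ≥0 → Ω → S) (hπ : ∀ t, MeasurePreserving (ξ t) P π) (t : ℝ≥0) (f : Lp ℂ 2 π) :
    (fun ω => transitionOp P π ξ hπ t f (ξ 0 ω)) =ᵐ[P]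
      P[fun ω => f (ξ t ω) | mS.comap (ξ 0)] := by
  have hπ' : IsProbabilityMeasure π := by
    rw [← (hπ 0).map_eq]
    exact Measure.isProbabilityMeasure_map (hπ 0).measurable.aemeasurable
  have hm : mS.comap (ξ 0) ≤ mΩ := (hπ 0).measurable.comap_le
  set q : Lp ℂ 2 π := transitionOp P π ξ hπ t f with hq
  set F : Lp ℂ 2 P := Lp.compMeasurePreserving (ξ t) (hπ t) f with hF
  have hFae : F =ᵐ[P] fun ω => f (ξ t ω) := Lp.coeFn_compMeasurePreserving f (hπ t)
  have hfint : Integrable (fun ω => f (ξ t ω)) P :=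
    ((Lp.memLp F).integrable one_le_two).congr hFae
  have hqint : Integrable (fun ω => q (ξ 0 ω)) P :=
    (hπ 0).integrable_comp_of_integrable ((Lp.memLp q).integrable one_le_two)
  refine ae_eq_condExp_of_forall_setIntegral_eq hm hfint
    (fun s _ _ => hqint.integrableOn) ?_ ?_
  · rintro s ⟨B, hB, rfl⟩ _
    have h1 : ∫ ω in ξ 0 ⁻¹' B, q (ξ 0 ω) ∂P = ∫ x in B, q x ∂π := by
      have h0 : AEStronglyMeasurable q (P.map (ξ 0)) := by
        rw [(hπ 0).map_eq]
        exact Lp.aestronglyMeasurable q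
      have h := setIntegral_map hB h0 (hπ 0).measurable.aemeasurable
      rw [(hπ 0).map_eq] at h
      exact h.symm
    have h2 : ∫ x in B, q x ∂π
        = ⟪indicatorConstLp 2 hB (measure_ne_top π B) (1 : ℂ), q⟫_ℂ :=
      (L2.inner_indicatorConstLp_one hB (measure_ne_top π B) q).symm
    have h3 : ⟪indicatorConstLp 2 hB (measure_ne_top π B) (1 : ℂ), q⟫_ℂ
        = ⟪Lp.compMeasurePreserving (ξ 0) (hπ 0)
            (indicatorConstLp 2 hB (measure_ne_top π B) (1 : ℂ)), F⟫_ℂ := by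
      rw [hq, transitionOp, ContinuousLinearMap.comp_apply,
        ContinuousLinearMap.adjoint_inner_right]
      rfl
    rw [h1, h2, h3, Lp.indicatorConstLp_compMeasurePreserving hB,
      L2.inner_indicatorConstLp_one]
    exact integral_congr_ae (ae_restrict_of_ae hFae)
  · exact ((Lp.stronglyMeasurable q).comp_measurable
      (comap_measurable (ξ 0))).aestronglyMeasurable

/-- The process `ξ` has the (homogeneous) Markov property with respect to the filtration `ℱ`:
`E[f(ξ_t) | ℱ_u] = (T_{t-u} f)(ξ_u)` for `f ∈ L²(π)` and `0 ≤ u < t`. -/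
def HasMarkovProperty (P : Measure Ω) (π : Measure S) (ℱ : Filtration ℝ≥0 mΩ) (ξ : ℝ≥0 → Ω → S)
    (hπ : ∀ t, MeasurePreserving (ξ t) P π) : Prop :=
  ∀ (f : Lp ℂ 2 π) (u t : ℝ≥0), u < t →
    P[fun ω => f (ξ t ω) | ℱ u] =ᵐ[P] fun ω => transitionOp P π ξ hπ (t - u) f (ξ u ω)

/-- A real function `g ∈ L²(π)` as an element of complex `L²(π)`. -/
def toComplexLp (π : Measure S) (g : S → ℝ) (hg : MemLp g 2 π) : Lp ℂ 2 π :=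
  (hg.ofReal (K := ℂ)).toLp _

/-- The transition spectral measure `ν = ν_g` of the process and `g`: the spectral measure of the
generator `L` of `(T_t)` at the vector `g`. -/
def transitionSpectralMeasure (P : Measure Ω) (π : Measure S) (ξ : ℝ≥0 → Ω → S)
    (hπ : ∀ t, MeasurePreserving (ξ t) P π) (g : S → ℝ) (hg : MemLp g 2 π) : Measure ℂ :=
  spectralMeasure (generator (transitionOp P π ξ hπ)) (toComplexLp π g hg)

/-- `S_T = ∫_0^T g(ξ_s) ds`. -/
def additiveFunctional (ξ : ℝ≥0 → Ω → S) (g : S → ℝ) (T : ℝ) (ω : Ω) : ℝ :=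
  ∫ s in (0 : ℝ)..T, g (ξ s.toNNReal ω)

end Markov

/-! ### The quantities in the statement -/

/-- `U_x = {a + ib : 0 ≤ -a ≤ |b| ≤ x}`. -/
def U (x : ℝ) : Set ℂ := {z | 0 ≤ -z.re ∧ -z.re ≤ |z.im| ∧ |z.im| ≤ x}

/-- `ς² = -2 ∫_{Re z ≤ 0} Re(1/z) ν(dz) ∈ [0, ∞]`; the integrand `-2 Re(1/z)` is nonnegative on the
closed left half-plane (at `z = 0` it is given the value `0`). -/
def varsigmaSq (ν : Measure ℂ) : ℝ≥0∞ :=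
  ∫⁻ z in {z : ℂ | z.re ≤ 0}, ENNReal.ofReal (-2 * (1 / z).re) ∂ν

/-- `C(α) = Γ(1 + α) sin(απ/2) / (π (2 - α))`. -/
def C (α : ℝ) : ℝ :=
  Real.Gamma (1 + α) * Real.sin (α * Real.pi / 2) / (Real.pi * (2 - α))

/-- `h : (0, ∞) → (0, ∞)` is measurable and slowly varying at infinity (the values of `h` outside
`(0, ∞)` are irrelevant). -/
def IsSlowlyVarying (h : ℝ → ℝ) : Prop :=
  Measurable (fun t : Set.Ioi (0 : ℝ) => h t) ∧ (∀ t, 0 < t → 0 < h t) ∧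
    ∀ s, 0 < s → Tendsto (fun t => h (s * t) / h t) atTop (𝓝 1)

end NormalMarkov

end

/-! Write y(t) = ∫_0^t e^{sz} ds (`orbit z t`). By the Markov property and the spectral theorem, ⟨g,
T_t g⟩ = ∫ e^{tz} ν(dz), so var(S_T) is the ν-integral of ∫∫_{[0,T]²} Re e^{|s-t|z} ds dt = 2 Re
∫_0^T y. Since y' = zy + 1, an energy identity (`two_mul_re_integral_orbit`) rewrites this kernel as
|y(T)|² + 2(-Re z) ∫_0^T |y|², a sum of two nonnegative terms.

The second, dissipative term divided by T converges to -2 Re(1/z) and is dominated by a multiple of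
it. Fatou's lemma then gives ς² < ∞ as soon as var(S_T)/T converges
(`varsigmaSq_lt_top_of_tendsto`). When ς² < ∞, dominated convergence makes this term contribute
exactly ς². In the boundary term |y(T)|², z may be replaced by i Im z inside the sector -Re z ≤ |Im
z|, and the term may be dropped outside it. The error is again dominated by T times a multiple of
-Re(1/z), and is o(T) pointwise. Hence var(S_T)/T - W(T)/T → ς² (`tendsto_variance_sub`), where W(T)
integrates the Fejér kernel 2(1 - cos bT)/b² against the law G of |Im z| on the sector, and G([0,
x]) = ν(U_x).

What is left is a Tauberian theorem on the half line (`tendsto_fejerKernel_iff`): W(T) ~ T^α h(T) if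
and only if G([0, x]) ~ C(α) x^{2-α} h(1/x). Part 1 is the case α = 1 with h constant; in part 2 the
bounded difference is negligible against var(S_T)/T → ∞. The Abelian direction uses a Potter bound
to control the tail of the kernel. For the converse, the Fejér kernel is averaged in time against
the second derivative of e^{-t²/2}, which produces the kernel e^{-b²/2}
(`integral_fejerKernel_mul_gauss`); a Baire category argument (`exists_integral_fejerKernel_le`)
justifies the limit under the average. Powers of the Gaussian are dilated Gaussians, so Karamata's
polynomial approximation applies (`tendsto_distribution_of_gauss`). The constant is then read off
from the Abelian direction.

On the operator side, ν is defined through the bounded operator N = (1 - L)⁻¹. This N is the Laplace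
transform of the semigroup and is normal (`IsNormalOperator.isStarNormal`), with spectrum in the
disc |w|² ≤ Re w. There w² e^{t(1 - 1/w)} is continuous, and its functional calculus is identified
with T_t N² by uniqueness for the Cauchy problem. Cutoffs near w = 0 remove the factor w²
(`inner_apply_eq_integral`). -/

namespace NormalMarkov

/-! ### Contraction semigroups and the resolvent of the generator -/

section Semigroup

variable {H : Type*} [NormedAddCommGroup H] [InnerProductSpace ℂ H]

/-- Strongly continuous contraction semigroups. -/
structure IsContractionSemigroup (T : ℝ≥0 → H →L[ℂ] H) : Prop where
  zero : T 0 = 1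
  add : ∀ s t, T (s + t) = T s * T t
  norm_apply_le : ∀ t f, ‖T t f‖ ≤ ‖f‖
  continuous : ∀ f, Continuous fun t => T t f

/-- Graphs are submodules, so this form lets elements of the domain be added and subtracted without
carrying membership proofs. -/
theorem isResolvent_one_iff {A : H →ₗ.[ℂ] H} {R : H →L[ℂ] H} :
    IsResolvent A 1 R ↔
      (∀ f, (R f, R f - f) ∈ A.graph) ∧ ∀ x y, (x, y) ∈ A.graph → R (x - y) = x := by
  constructor
  · intro h
    refine ⟨fun f => ?_, fun x y hxy => ?_⟩
    · obtain ⟨x, hx, hf⟩ := (h f (R f)).1 rfl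
      rw [LinearPMap.mem_graph_iff]
      refine ⟨x, hx, ?_⟩
      rw [← hx, one_smul] at *
      rw [← hf]
      simp
    · rw [LinearPMap.mem_graph_iff] at hxy
      obtain ⟨z, hz, hy⟩ := hxy
      simp only at hz hy
      rw [h]
      exact ⟨z, hz, by rw [hy, hz, one_smul]⟩
  · rintro ⟨h1, h2⟩ f h
    constructor
    · rintro rfl
      obtain ⟨x, hx, hf⟩ := (LinearPMap.mem_graph_iff _).1 (h1 f)
      simp only at hx hf
      exact ⟨x, hx, by rw [hf, hx]; simp⟩
    · rintro ⟨x, rfl, rfl⟩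
      rw [one_smul]
      exact h2 _ _ (A.mem_graph x)

theorem IsResolvent.unique {A : H →ₗ.[ℂ] H} {c : ℂ} {R R' : H →L[ℂ] H}
    (h : IsResolvent A c R) (h' : IsResolvent A c R') : R = R' := by
  ext f
  rw [h f, ← h' f]

theorem resolventOp_eq {A : H →ₗ.[ℂ] H} {c : ℂ} {R : H →L[ℂ] H} (h : IsResolvent A c R) :
    resolventOp A c = R := by
  have hex : ∃ R, IsResolvent A c R := ⟨R, h⟩
  rw [resolventOp, dif_pos hex]
  exact hex.choose_spec.unique h

namespace IsContractionSemigroup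

variable {T : ℝ≥0 → H →L[ℂ] H} (hT : IsContractionSemigroup T)
include hT

theorem continuous_toNNReal (f : H) : Continuous fun s : ℝ => T s.toNNReal f :=
  (hT.continuous f).comp continuous_real_toNNReal

theorem integrableOn_exp_smul (f : H) :
    IntegrableOn (fun s : ℝ => Real.exp (-s) • T s.toNNReal f) (Set.Ioi 0) := by
  have h1 : IntegrableOn (fun s : ℝ => Real.exp (-s) * ‖f‖) (Set.Ioi 0) :=
    (integrableOn_exp_neg_Ioi 0).mul_const _
  refine Integrable.mono' h1 ?_ ?_
  · have h2 := hT.continuous_toNNReal f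
    exact ((Real.continuous_exp.comp continuous_neg).smul h2).aestronglyMeasurable
  · refine Eventually.of_forall fun s => ?_
    rw [norm_smul, Real.norm_eq_abs, Real.abs_exp]
    gcongr
    exact hT.norm_apply_le _ _

/-- Contractivity gives Re⟨x, T_t x⟩ ≤ ‖x‖²; divide by t and let t → 0. This dissipativity is what
later confines the spectrum of the resolvent to a disc. -/
theorem graph_re_inner_nonpos {x y : H} (h : (x, y) ∈ (generator T).graph) :
    (⟪x, y⟫_ℂ).re ≤ 0 := by
  rw [mem_graph_generator] at h
  have h1 : Tendsto (fun t : ℝ≥0 => (⟪x, ((t : ℝ) : ℂ)⁻¹ • (T t x - x)⟫_ℂ).re) (𝓝[>] 0)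
      (𝓝 (⟪x, y⟫_ℂ).re) :=
    (Complex.continuous_re.tendsto _).comp (tendsto_const_nhds.inner h)
  refine le_of_tendsto h1 (Eventually.of_forall fun t => ?_)
  have h2 : (⟪x, T t x⟫_ℂ).re ≤ ‖x‖ * ‖x‖ :=
    (Complex.re_le_norm _).trans ((norm_inner_le_norm _ _).trans
      (mul_le_mul_of_nonneg_left (hT.norm_apply_le t x) (norm_nonneg _)))
  have h3 : (⟪x, x⟫_ℂ).re = ‖x‖ * ‖x‖ := by
    rw [← sq]; exact inner_self_eq_norm_sq (𝕜 := ℂ) x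
  rw [inner_smul_right, inner_sub_right, ← Complex.ofReal_inv, Complex.re_ofReal_mul,
    Complex.sub_re, h3]
  exact mul_nonpos_of_nonneg_of_nonpos (by positivity) (by linarith)

theorem norm_integral_exp_smul_le (f : H) :
    ‖∫ s in Set.Ioi (0 : ℝ), Real.exp (-s) • T s.toNNReal f‖ ≤ 1 * ‖f‖ := by
  have h1 : IntegrableOn (fun s : ℝ => Real.exp (-s) * ‖f‖) (Set.Ioi 0) :=
    (integrableOn_exp_neg_Ioi 0).mul_const _
  refine (norm_integral_le_of_norm_le h1 ?_).trans ?_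
  · refine Eventually.of_forall fun s => ?_
    rw [norm_smul, Real.norm_eq_abs, Real.abs_exp]
    gcongr
    exact hT.norm_apply_le _ _
  · rw [integral_mul_const, integral_exp_neg_Ioi_zero]

/-- The Laplace transform `∫_0^∞ e^{-s} T_s ds` of the semigroup. -/
noncomputable def laplaceOp : H →L[ℂ] H :=
  LinearMap.mkContinuous
    { toFun := fun f => ∫ s in Set.Ioi (0 : ℝ), Real.exp (-s) • T s.toNNReal f
      map_add' := fun f g => by
        rw [← integral_add (hT.integrableOn_exp_smul f) (hT.integrableOn_exp_smul g)]
        simp [smul_add]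
      map_smul' := fun c f => by
        rw [RingHom.id_apply, ← integral_smul]
        simp [smul_comm c] } 1 hT.norm_integral_exp_smul_le

theorem laplaceOp_apply (f : H) :
    hT.laplaceOp f = ∫ s in Set.Ioi (0 : ℝ), Real.exp (-s) • T s.toNNReal f := rfl

variable [CompleteSpace H]

theorem apply_laplaceOp_comm (t : ℝ≥0) (f : H) :
    T t (hT.laplaceOp f) = hT.laplaceOp (T t f) := by
  rw [laplaceOp_apply, laplaceOp_apply, ← ContinuousLinearMap.integral_comp_comm _
    (hT.integrableOn_exp_smul f)]
  refine integral_congr_ae (Eventually.of_forall fun s => ?_)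
  simp only [ContinuousLinearMap.map_smul_of_tower]
  have h : T t * T s.toNNReal = T s.toNNReal * T t := by rw [← hT.add, add_comm, hT.add]
  exact congrArg (fun A : H →L[ℂ] H => Real.exp (-s) • A f) h

/-- Shifting the variable in the Laplace integral isolates the dependence on t in a differentiable
expression, whose derivative at 0 is R f - f. -/
theorem apply_laplaceOp (t : ℝ≥0) (f : H) :
    T t (hT.laplaceOp f) = Real.exp t •
      (hT.laplaceOp f - ∫ s in (0 : ℝ)..t, Real.exp (-s) • T s.toNNReal f) := by
  have hI := hT.integrableOn_exp_smul f
  have h1 : hT.laplaceOp f - ∫ s in (0 : ℝ)..t, Real.exp (-s) • T s.toNNReal f =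
      ∫ s in Set.Ioi (t : ℝ), Real.exp (-s) • T s.toNNReal f := by
    rw [laplaceOp_apply, sub_eq_iff_eq_add, add_comm]
    exact (intervalIntegral.integral_interval_add_Ioi hI (hI.mono_set
      (Set.Ioi_subset_Ioi t.2))).symm
  rw [h1, hT.apply_laplaceOp_comm, laplaceOp_apply, ← integral_smul]
  have h2 := (measurePreserving_add_right volume (t : ℝ)).setIntegral_preimage_emb
    (measurableEmbedding_addRight (t : ℝ))
    (fun s : ℝ => Real.exp t • Real.exp (-s) • T s.toNNReal f) (Set.Ioi (t : ℝ))
  rw [Set.preimage_add_const_Ioi, sub_self] at h2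
  rw [← h2]
  refine setIntegral_congr_fun measurableSet_Ioi fun s hs => ?_
  have hs' : (0 : ℝ) < s := hs
  have h3 : (s + (t : ℝ)).toNNReal = s.toNNReal + t := by
    rw [Real.toNNReal_add hs'.le t.coe_nonneg, Real.toNNReal_coe]
  rw [smul_smul, ← Real.exp_add, h3, hT.add, neg_add, add_comm (t : ℝ), neg_add_cancel_right]
  rfl

theorem laplaceOp_mem_graph (f : H) :
    (hT.laplaceOp f, hT.laplaceOp f - f) ∈ (generator T).graph := by
  rw [mem_graph_generator]
  set R := hT.laplaceOp f with hR
  have hc : Continuous fun s : ℝ => Real.exp (-s) • T s.toNNReal f := by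
    exact (Real.continuous_exp.comp continuous_neg).smul (hT.continuous_toNNReal f)
  have h1 : HasDerivAt (fun t : ℝ => ∫ s in (0 : ℝ)..t, Real.exp (-s) • T s.toNNReal f)
      (Real.exp (-0) • T (0 : ℝ).toNNReal f) 0 :=
    intervalIntegral.integral_hasDerivAt_right (hc.intervalIntegrable _ _)
      (hc.stronglyMeasurableAtFilter _ _) hc.continuousAt
  have h2 : HasDerivAt (fun t : ℝ => Real.exp t •
      (R - ∫ s in (0 : ℝ)..t, Real.exp (-s) • T s.toNNReal f)) (R - f) 0 := by
    have := (Real.hasDerivAt_exp 0).smul (h1.const_sub R)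
    refine this.congr_deriv ?_
    simp [hT.zero]
    abel
  have h3 := h2.tendsto_slope_zero_right
  have h4 : Tendsto (fun t : ℝ≥0 => (t : ℝ)) (𝓝[>] 0) (𝓝[>] 0) := by
    refine tendsto_nhdsWithin_of_tendsto_nhds_of_eventually_within _ ?_ ?_
    · exact (NNReal.continuous_coe.tendsto' 0 0 rfl).mono_left nhdsWithin_le_nhds
    · filter_upwards [self_mem_nhdsWithin] with t ht
      exact NNReal.coe_pos.2 ht
  refine (h3.comp h4).congr fun t => ?_
  simp only [Function.comp, zero_add, intervalIntegral.integral_same, sub_zero, Real.exp_zero,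
    one_smul]
  rw [hR, hT.apply_laplaceOp, ← Complex.ofReal_inv, Complex.coe_smul]

/-- The left inverse property comes from commutation: the difference quotients of T at R x are the
images under R of those at x, so they tend both to R x - x and to R y. -/
theorem isResolvent_laplaceOp : IsResolvent (generator T) 1 hT.laplaceOp := by
  refine isResolvent_one_iff.2 ⟨hT.laplaceOp_mem_graph, fun x y hxy => ?_⟩
  rw [mem_graph_generator] at hxy
  have h1 := (hT.laplaceOp.continuous.tendsto _).comp hxy
  have h2 := (mem_graph_generator _ _ _).1 (hT.laplaceOp_mem_graph x)
  have h3 := tendsto_nhds_unique h1 (h2.congr fun t => by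
    simp only [Function.comp, map_smul, map_sub, hT.apply_laplaceOp_comm])
  rw [map_sub, h3]
  abel

end IsContractionSemigroup

end Semigroup

/-! ### The resolvent of a normal operator is normal -/

section NormalResolvent

variable {H : Type*} [NormedAddCommGroup H] [InnerProductSpace ℂ H] [CompleteSpace H]

theorem mem_graph_adjoint_iff {A : H →ₗ.[ℂ] H} (hd : Dense (A.domain : Set H)) (x y : H) :
    (x, y) ∈ A.adjoint.graph ↔ ∀ a b, (a, b) ∈ A.graph → ⟪b, x⟫_ℂ = ⟪a, y⟫_ℂ := by
  rw [LinearPMap.adjoint_graph_eq_graph_adjoint hd, Submodule.mem_adjoint_iff]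
  simp only [sub_eq_zero]

/-- Transposition exchanges the two halves of `isResolvent_one_iff`: each half for the adjoint
follows from the other half for A. -/
theorem IsResolvent.adjoint {A : H →ₗ.[ℂ] H} (hd : Dense (A.domain : Set H)) {R : H →L[ℂ] H}
    (hR : IsResolvent A 1 R) : IsResolvent A.adjoint 1 R.adjoint := by
  rw [isResolvent_one_iff] at hR ⊢
  obtain ⟨h1, h2⟩ := hR
  constructor
  · intro f
    rw [mem_graph_adjoint_iff hd]
    intro a b hab
    have h3 := h2 a b hab
    have h4 : ⟪a - b, R.adjoint f⟫_ℂ = ⟪a, f⟫_ℂ := by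
      rw [ContinuousLinearMap.adjoint_inner_right, h3]
    rw [inner_sub_left] at h4
    rw [inner_sub_right, ← h4]
    ring
  · intro x y hxy
    rw [mem_graph_adjoint_iff hd] at hxy
    refine ext_inner_left ℂ fun v => ?_
    have h3 := hxy _ _ (h1 v)
    rw [ContinuousLinearMap.adjoint_inner_right, inner_sub_right, ← h3, inner_sub_left]
    ring

/-- `x = (1 + A† A)⁻¹ f`, as a relation. -/
def IsGramSolution (A : H →ₗ.[ℂ] H) (x f : H) : Prop :=
  ∃ u, (x, u) ∈ A.graph ∧ (u, f - x) ∈ A.adjoint.graph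

theorem IsGramSolution.eq_zero {A : H →ₗ.[ℂ] H} (hd : Dense (A.domain : Set H)) {x : H}
    (h : IsGramSolution A x 0) : x = 0 := by
  obtain ⟨u, hu, hv⟩ := h
  rw [mem_graph_adjoint_iff hd] at hv
  have h1 := hv _ _ hu
  rw [zero_sub, inner_neg_right] at h1
  have h2 := congrArg Complex.re h1
  have h3 : (⟪u, u⟫_ℂ).re = ‖u‖ ^ 2 := inner_self_eq_norm_sq (𝕜 := ℂ) u
  have h4 : (⟪x, x⟫_ℂ).re = ‖x‖ ^ 2 := inner_self_eq_norm_sq (𝕜 := ℂ) x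
  rw [Complex.neg_re, h3, h4] at h2
  have : ‖x‖ ^ 2 = 0 := by nlinarith [sq_nonneg ‖x‖, sq_nonneg ‖u‖]
  simpa using this

theorem IsGramSolution.sub {A : H →ₗ.[ℂ] H} {x x' f f' : H}
    (h : IsGramSolution A x f) (h' : IsGramSolution A x' f') :
    IsGramSolution A (x - x') (f - f') := by
  obtain ⟨u, hu, hv⟩ := h
  obtain ⟨u', hu', hv'⟩ := h'
  refine ⟨u - u', A.graph.sub_mem hu hu', ?_⟩
  have h1 := A.adjoint.graph.sub_mem hv hv'
  rw [Prod.mk_sub_mk] at h1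
  rwa [show f - f' - (x - x') = f - x - (f' - x') by abel]

theorem IsGramSolution.left_unique {A : H →ₗ.[ℂ] H} (hd : Dense (A.domain : Set H)) {x x' f : H}
    (h : IsGramSolution A x f) (h' : IsGramSolution A x' f) : x = x' := by
  have := h.sub h'
  rw [sub_self] at this
  exact sub_eq_zero.1 (this.eq_zero hd)

theorem IsGramSolution.right_unique {A : H →ₗ.[ℂ] H} {x f f' : H}
    (h : IsGramSolution A x f) (h' : IsGramSolution A x f') : f = f' := by
  obtain ⟨u, hu, hv⟩ := h
  obtain ⟨u', hu', hv'⟩ := h'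
  obtain rfl : u = u' := A.mem_graph_snd_inj hu hu' rfl
  have := A.adjoint.mem_graph_snd_inj hv hv' rfl
  simpa using this

/-- Von Neumann's argument: split (f, 0) along the closed graph of A and its orthogonal complement
in the Hilbert sum. If p and q are the two components, orthogonality of q to the graph says exactly
that A† maps the second coordinate of p to f minus the first one. -/
theorem exists_isGramSolution {A : H →ₗ.[ℂ] H} (hA : A.IsClosed) (hd : Dense (A.domain : Set H))
    (f : H) : ∃ x, IsGramSolution A x f := by
  let e := WithLp.prodContinuousLinearEquiv 2 ℂ H H
  let K : Submodule ℂ (WithLp 2 (H × H)) := A.graph.comap (e : WithLp 2 (H × H) →ₗ[ℂ] H × H)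
  have hK : IsClosed (K : Set (WithLp 2 (H × H))) := hA.preimage e.continuous
  have : CompleteSpace K := hK.completeSpace_coe
  obtain ⟨p, hp, q, hq, hpq⟩ := K.exists_add_mem_mem_orthogonal (WithLp.toLp 2 (f, (0 : H)))
  have hfst : p.fst + q.fst = f := by
    have := congrArg WithLp.fst hpq
    simpa using this.symm
  have hsnd : p.snd + q.snd = 0 := by
    have := congrArg WithLp.snd hpq
    simpa using this.symm
  refine ⟨p.fst, p.snd, hp, ?_⟩
  rw [mem_graph_adjoint_iff hd]
  intro a b hab
  have h1 := (Submodule.mem_orthogonal _ _).1 hq (WithLp.toLp 2 (a, b)) hab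
  rw [WithLp.prod_inner_apply] at h1
  simp only at h1
  rw [show f - p.fst = q.fst by rw [← hfst]; abel,
    show p.snd = - q.snd from eq_neg_of_add_eq_zero_left hsnd, inner_neg_right]
  exact (eq_neg_of_add_eq_zero_right h1) ▸ (by simp)

/-- This is the only point where A†A = AA† enters. -/
theorem isGramSolution_iff_adjoint {A : H →ₗ.[ℂ] H} (hN : IsNormalOperator A) {x f : H} :
    IsGramSolution A x f ↔ ∃ u, (x, u) ∈ A.adjoint.graph ∧ (u, f - x) ∈ A.graph :=
  hN.2.2 x (f - x)

/-- That is, R commutes with (1 + A†A)⁻¹. By uniqueness of solutions it suffices to solve for R f by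
some v and to check that v - A v solves for f, which uses both forms of the Gram relation. -/
theorem IsGramSolution.resolvent {A : H →ₗ.[ℂ] H} (hN : IsNormalOperator A) {R : H →L[ℂ] H}
    (hR : IsResolvent A 1 R) {x f : H} (h : IsGramSolution A x f) :
    IsGramSolution A (R x) (R f) := by
  rw [isResolvent_one_iff] at hR
  obtain ⟨h1, h2⟩ := hR
  obtain ⟨v, hv⟩ := exists_isGramSolution hN.1 hN.2.1 (R f)
  -- `v` solves for `R f`; `A v` solves for `A R f = R f - f`, so `v - A v` solves for `f`
  obtain ⟨u, hu, hw⟩ := hv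
  obtain ⟨u', hu', hw'⟩ := (isGramSolution_iff_adjoint hN).1 ⟨u, hu, hw⟩
  have h3 : (R f - v, R f - f - u) ∈ A.graph := A.graph.sub_mem (h1 f) hu
  have h4 : IsGramSolution A u (R f - f) :=
    (isGramSolution_iff_adjoint hN).2 ⟨R f - v, hw, h3⟩
  have h5 : IsGramSolution A (v - u) f := by
    have := IsGramSolution.sub ⟨u, hu, hw⟩ h4
    rwa [sub_sub_cancel] at this
  have h6 := h.left_unique hN.2.1 h5
  have h7 : R x = v := by rw [h6]; exact h2 _ _ hu
  rw [h7]
  exact ⟨u, hu, hw⟩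

theorem IsGramSolution.resolvent_adjoint {A : H →ₗ.[ℂ] H} (hN : IsNormalOperator A)
    {R : H →L[ℂ] H} (hR : IsResolvent A.adjoint 1 R) {x f : H} (h : IsGramSolution A x f) :
    IsGramSolution A (R x) (R f) := by
  rw [isResolvent_one_iff] at hR
  obtain ⟨h1, h2⟩ := hR
  obtain ⟨v, hv⟩ := exists_isGramSolution hN.1 hN.2.1 (R f)
  obtain ⟨u, hu, hw⟩ := (isGramSolution_iff_adjoint hN).1 hv
  have h3 : (R f - v, R f - f - u) ∈ A.adjoint.graph := A.adjoint.graph.sub_mem (h1 f) hu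
  have h4 : IsGramSolution A u (R f - f) := ⟨R f - v, hw, h3⟩
  have h5 : IsGramSolution A (v - u) f := by
    have := IsGramSolution.sub hv h4
    rwa [sub_sub_cancel] at this
  have h6 := h.left_unique hN.2.1 h5
  have h7 : R x = v := by rw [h6]; exact h2 _ _ hu
  rwa [h7]

/-- If x lies in the domain of A†A, then so does p = R R† x, where A and A† may be interchanged;
thus x = (1 - A†)(1 - A)p = (1 - A)(1 - A†)p and p = R† R x. For a general y take x = (1 + A†A)⁻¹ y:
both products of R and R† commute with this operator, and uniqueness of the right-hand side carries
the identity from x to y. -/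
theorem IsNormalOperator.isStarNormal {A : H →ₗ.[ℂ] H} (hN : IsNormalOperator A) {R : H →L[ℂ] H}
    (hR : IsResolvent A 1 R) : IsStarNormal R := by
  have hR' := hR.adjoint hN.2.1
  -- on the domain of `A† A`
  have key : ∀ x f, IsGramSolution A x f → R (R.adjoint x) = R.adjoint (R x) := by
    intro x f h
    set p := R (R.adjoint x) with hp
    have hp1 : IsGramSolution A p (R (R.adjoint f)) :=
      (h.resolvent_adjoint hN hR').resolvent hN hR
    rw [isResolvent_one_iff] at hR hR'
    obtain ⟨u, hu, hw⟩ := hp1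
    obtain ⟨u', hu', hw'⟩ := (isGramSolution_iff_adjoint hN).1 ⟨u, hu, hw⟩
    set k := R (R.adjoint f) - p with hk
    have e1 : u = p - R.adjoint x := A.mem_graph_snd_inj hu (hR.1 _) rfl
    -- With u = A p, u' = A† p and k = A†A p = AA† p, this is x = (1 - A)(1 - A†)p.
    have e2 : x = p - u' - (u - k) := by
      have h3 : (R.adjoint x, u' - k) ∈ A.adjoint.graph := by
        have := A.adjoint.graph.sub_mem hu' hw
        rwa [Prod.mk_sub_mk, e1, sub_sub_cancel] at this
      have h4 := A.adjoint.mem_graph_snd_inj h3 (hR'.1 x) rfl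
      have h5 : x = R.adjoint x - (u' - k) := by rw [h4]; abel
      rw [e1]
      refine h5.trans ?_
      abel
    have h6 : R x = p - u' := by
      have := hR.2 _ _ (A.graph.sub_mem hu hw')
      rwa [← e2] at this
    rw [h6]
    exact (hR'.2 _ _ hu').symm
  rw [isStarNormal_iff, commute_iff_eq]
  ext y
  obtain ⟨x, hx⟩ := exists_isGramSolution hN.1 hN.2.1 y
  have h1 := (hx.resolvent hN hR).resolvent_adjoint hN hR'
  have h2 := (hx.resolvent_adjoint hN hR').resolvent hN hR
  rw [key x y hx] at h2
  exact h1.right_unique h2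

end NormalResolvent

/-! ### The spectral measure of a bounded normal operator -/

section BoundedSpectralMeasure

variable {H : Type*} [NormedAddCommGroup H] [InnerProductSpace ℂ H] [CompleteSpace H]
  (N : H →L[ℂ] H) (g : H)

theorem spectralFunctional_apply (f : C_c(ℂ, ℝ)) :
    spectralFunctional N g f = (⟪g, cfc (fun z : ℂ => ((f z : ℝ) : ℂ)) N g⟫_ℂ).re := rfl

instance : (boundedSpectralMeasure N g).Regular := by
  unfold boundedSpectralMeasure; infer_instance

/-- A test function supported off the spectrum has zero functional calculus, so every compact set in
the complement is null; inner regularity on open sets does the rest. -/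
theorem boundedSpectralMeasure_compl_spectrum :
    boundedSpectralMeasure N g (spectrum ℂ N)ᶜ = 0 := by
  have hcl : IsClosed (spectrum ℂ N) := spectrum.isClosed N
  rw [hcl.isOpen_compl.measure_eq_iSup_isCompact]
  simp only [ENNReal.iSup_eq_zero]
  intro K hKU hK
  obtain ⟨f, hf1, hf2, hf3, hf4⟩ :=
    exists_continuousMap_one_of_isCompact_subset_isOpen hK hcl.isOpen_compl hKU
  have h0 : spectralFunctional N g ⟨f, hf2⟩ = 0 := by
    rw [spectralFunctional_apply]
    have : cfc (fun z : ℂ => ((f z : ℝ) : ℂ)) N = cfc (fun _ => (0 : ℂ)) N := by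
      refine cfc_congr fun z hz => ?_
      have : f z = 0 := image_eq_zero_of_notMem_tsupport fun h => hf3 h hz
      simp [this]
    erw [this]
    simp
  have h1 := RealRMK.rieszMeasure_le_of_eq_one (spectralFunctional N g) (f := ⟨f, hf2⟩)
    (fun x => (hf4 x).1) hK (fun x hx => hf1 hx)
  rw [h0, ENNReal.ofReal_zero] at h1
  exact le_antisymm h1 zero_le

instance : IsFiniteMeasure (boundedSpectralMeasure N g) := by
  constructor
  rw [← Set.union_compl_self (spectrum ℂ N)]
  refine (measure_union_le _ _).trans_lt ?_
  rw [boundedSpectralMeasure_compl_spectrum, add_zero]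
  exact (spectrum.isCompact N).measure_lt_top

theorem ae_mem_spectrum : ∀ᵐ w ∂(boundedSpectralMeasure N g), w ∈ spectrum ℂ N :=
  boundedSpectralMeasure_compl_spectrum N g

variable {N}

theorem integrable_boundedSpectralMeasure {f : ℂ → ℂ} (hf : ContinuousOn f (spectrum ℂ N)) :
    Integrable f (boundedSpectralMeasure N g) := by
  have h := hf.integrableOn_compact (μ := boundedSpectralMeasure N g) (spectrum.isCompact N)
  rwa [IntegrableOn, Measure.restrict_eq_self_of_ae_mem (ae_mem_spectrum N g)] at h

theorem integral_boundedSpectralMeasure_ofReal {f : ℂ → ℝ} (hf : ContinuousOn f (spectrum ℂ N)) :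
    ((∫ w, f w ∂(boundedSpectralMeasure N g) : ℝ) : ℂ) =
      ⟪g, cfc (fun w => (f w : ℂ)) N g⟫_ℂ := by
  have hK := spectrum.isCompact (𝕜 := ℂ) N
  -- The Riesz measure is only known on compactly supported functions, so f is extended from the
  -- compact spectrum by Tietze and multiplied by a bump equal to 1 there.
  obtain ⟨F, -, hF⟩ := ContinuousMap.exists_restrict_eq_forall_mem_of_closed
    ⟨_, hf.domRestrict⟩ (t := Set.univ) (fun _ => Set.mem_univ _) ⟨0, trivial⟩ hK.isClosed
  obtain ⟨ψ, hψ1, hψ2, hψ3, hψ4⟩ :=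
    exists_continuousMap_one_of_isCompact_subset_isOpen hK isOpen_univ (Set.subset_univ _)
  let φ : C_c(ℂ, ℝ) := ⟨F * ψ, HasCompactSupport.mul_left hψ2⟩
  have hφ : Set.EqOn φ f (spectrum ℂ N) := fun w hw => by
    have h1 : F w = f w := congrArg (fun u => u ⟨w, hw⟩) hF
    have h2 : ψ w = 1 := hψ1 hw
    change F w * ψ w = f w
    rw [h1, h2, mul_one]
  have h1 : ∫ w, f w ∂(boundedSpectralMeasure N g) = ∫ w, φ w ∂(boundedSpectralMeasure N g) := by
    refine integral_congr_ae ?_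
    filter_upwards [ae_mem_spectrum N g] with w hw using (hφ hw).symm
  have h2 : cfc (fun w => ((φ w : ℝ) : ℂ)) N = cfc (fun w => (f w : ℂ)) N :=
    cfc_congr fun w hw => by simp only [hφ hw]
  rw [h1, boundedSpectralMeasure, RealRMK.integral_rieszMeasure, spectralFunctional_apply, h2]
  -- For real f the operator f(N) is self-adjoint, so the real part taken in `spectralFunctional`
  -- loses nothing.
  have h3 : ⟪g, cfc (fun w => (f w : ℂ)) N g⟫_ℂ =
      starRingEnd ℂ ⟪g, cfc (fun w => (f w : ℂ)) N g⟫_ℂ := by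
    rw [inner_conj_symm]
    rw [← ContinuousLinearMap.adjoint_inner_left]
    rw [← ContinuousLinearMap.star_eq_adjoint, ← cfc_star]
    simp
  exact (Complex.conj_eq_iff_real.1 h3.symm).elim fun r hr => by rw [hr, Complex.ofReal_re]

theorem integral_boundedSpectralMeasure {f : ℂ → ℂ} (hf : ContinuousOn f (spectrum ℂ N)) :
    ∫ w, f w ∂(boundedSpectralMeasure N g) = ⟪g, cfc f N g⟫_ℂ := by
  have h1 : ContinuousOn (fun w => (f w).re) (spectrum ℂ N) :=
    Complex.continuous_re.comp_continuousOn hf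
  have h2 : ContinuousOn (fun w => (f w).im) (spectrum ℂ N) :=
    Complex.continuous_im.comp_continuousOn hf
  rw [← integral_re_add_im (integrable_boundedSpectralMeasure g hf)]
  simp only [RCLike.re_to_complex, RCLike.im_to_complex, RCLike.I_to_complex]
  rw [RCLike.ofReal_eq_complex_ofReal, integral_boundedSpectralMeasure_ofReal g h1,
    integral_boundedSpectralMeasure_ofReal g h2]
  have h3 : ContinuousOn (fun w => ((f w).re : ℂ)) (spectrum ℂ N) :=
    Complex.continuous_ofReal.comp_continuousOn h1
  have h4 : ContinuousOn (fun w => ((f w).im : ℂ)) (spectrum ℂ N) :=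
    Complex.continuous_ofReal.comp_continuousOn h2
  have h5 : cfc f N = cfc (fun w => ((f w).re : ℂ)) N +
      Complex.I • cfc (fun w => ((f w).im : ℂ)) N := by
    have h6 : ContinuousOn (fun w => Complex.I • ((f w).im : ℂ)) (spectrum ℂ N) :=
      h4.const_smul Complex.I
    rw [← cfc_smul _ _ _ h4, ← cfc_add N (fun w => ((f w).re : ℂ))
      (fun w => Complex.I • ((f w).im : ℂ)) h3 h6]
    refine cfc_congr fun w _ => ?_
    simp only [smul_eq_mul]
    rw [mul_comm, Complex.re_add_im]
  rw [h5]
  simp [mul_comm]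

end BoundedSpectralMeasure

/-! ### Spectral representation of a contraction semigroup with normal generator -/

theorem norm_exp_sub_one_le_two {z : ℂ} (hz : z.re ≤ 0) : ‖Complex.exp z - 1‖ ≤ 2 := by
  have h1 : ‖Complex.exp z‖ ≤ 1 := by rw [Complex.norm_exp]; exact Real.exp_le_one_iff.2 hz
  have h2 := norm_sub_le (Complex.exp z) 1
  rw [norm_one] at h2
  linarith

theorem norm_exp_sub_one_sub_id_le {z : ℂ} (hz : z.re ≤ 0) :
    ‖Complex.exp z - 1 - z‖ ≤ 3 * ‖z‖ ^ 2 := by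
  rcases le_total ‖z‖ 1 with h | h
  · have := Complex.norm_exp_sub_one_sub_id_le h
    nlinarith [sq_nonneg ‖z‖]
  · have h1 := norm_exp_sub_one_le_two hz
    have h2 := norm_sub_le (Complex.exp z - 1) z
    nlinarith

/-- The half plane `Re z ≤ 0` in the variable `w = (1 - z)⁻¹`. -/
theorem re_one_sub_inv_nonpos {w : ℂ} (hw0 : w ≠ 0) (hw : ‖w‖ ^ 2 ≤ w.re) :
    (1 - w⁻¹).re ≤ 0 := by
  have h1 : 0 < ‖w‖ ^ 2 := by positivity
  rw [Complex.sub_re, Complex.one_re, Complex.inv_re, Complex.normSq_eq_norm_sq, sub_nonpos,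
    le_div_iff₀ h1, one_mul]
  exact hw

/-- Away from w = 0 the sharp bound is 1. The convention 0⁻¹ = 0 gives the value e^t at w = 0, hence
this weaker bound valid on the whole disc. -/
theorem norm_exp_mul_one_sub_inv_le {t : ℝ} (ht : 0 ≤ t) {w : ℂ} (hw : ‖w‖ ^ 2 ≤ w.re) :
    ‖Complex.exp (t * (1 - w⁻¹))‖ ≤ Real.exp t := by
  rw [Complex.norm_exp, Complex.re_ofReal_mul]
  refine Real.exp_le_exp.2 ?_
  by_cases h : w = 0
  · simp [h]
  · nlinarith [re_one_sub_inv_nonpos h hw]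

theorem norm_exp_mul_le_one {t : ℝ} (ht : 0 ≤ t) {w : ℂ} (hw0 : w ≠ 0) (hw : ‖w‖ ^ 2 ≤ w.re) :
    ‖Complex.exp (t * (1 - w⁻¹))‖ ≤ 1 := by
  rw [Complex.norm_exp, Complex.re_ofReal_mul]
  exact Real.exp_le_one_iff.2
    (mul_nonpos_of_nonneg_of_nonpos ht (re_one_sub_inv_nonpos hw0 hw))

/-- The disc `‖w‖² ≤ Re w`, the image of `Re z ≤ 0` under `z ↦ (1 - z)⁻¹`. -/
def resolventDisc : Set ℂ := {w | ‖w‖ ^ 2 ≤ w.re}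

theorem norm_le_one_of_mem_resolventDisc {w : ℂ} (hw : w ∈ resolventDisc) : ‖w‖ ≤ 1 := by
  have h1 : ‖w‖ ^ 2 ≤ w.re := hw
  nlinarith [Complex.re_le_norm w, norm_nonneg w]

/-- The exponential is singular at 0 but bounded on the disc, so a single factor w restores
continuity. -/
theorem continuousOn_mul_exp {t : ℝ} (ht : 0 ≤ t) :
    ContinuousOn (fun w : ℂ => w * Complex.exp (t * (1 - w⁻¹))) resolventDisc := by
  intro w hw
  by_cases h : w = 0
  · subst h
    have h1 : Tendsto (fun w : ℂ => ‖w‖ * Real.exp t) (𝓝[resolventDisc] 0) (𝓝 0) := by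
      have : Continuous fun w : ℂ => ‖w‖ * Real.exp t := by fun_prop
      exact (this.tendsto' 0 0 (by simp)).mono_left nhdsWithin_le_nhds
    rw [ContinuousWithinAt, zero_mul]
    refine squeeze_zero_norm' ?_ h1
    filter_upwards [self_mem_nhdsWithin] with w hw
    rw [norm_mul]
    gcongr
    exact norm_exp_mul_one_sub_inv_le ht hw
  · have : ContinuousAt (fun w : ℂ => w * Complex.exp (t * (1 - w⁻¹))) w := by
      fun_prop (disch := assumption)
    exact this.continuousWithinAt

theorem continuousOn_sq_mul_exp {t : ℝ} (ht : 0 ≤ t) :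
    ContinuousOn (fun w : ℂ => w * (w * Complex.exp (t * (1 - w⁻¹)))) resolventDisc :=
  continuousOn_id.mul (continuousOn_mul_exp ht)

section

variable {H : Type*} [NormedAddCommGroup H] [InnerProductSpace ℂ H] [CompleteSpace H]
  {T : ℝ≥0 → H →L[ℂ] H}

namespace IsContractionSemigroup

variable (hT : IsContractionSemigroup T)
include hT

/-- Dissipativity at the pair (N f, N f - f) reads ‖N f‖² ≤ Re⟨N f, f⟩, that is N + N* - 2 N*N ≥ 0;
the functional calculus turns this into w + w̄ - 2|w|² ≥ 0 on the spectrum. -/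
theorem spectrum_laplaceOp_subset [IsStarNormal hT.laplaceOp] :
    spectrum ℂ hT.laplaceOp ⊆ resolventDisc := by
  set N := hT.laplaceOp with hN
  have hstar : cfc (fun w : ℂ => star w) N = star N := cfc_star_id N
  have hid : cfc (fun w : ℂ => w) N = N := cfc_id' ℂ N
  open scoped ComplexOrder in
  have h1 : 0 ≤ cfc (fun w : ℂ => w + star w - 2 * (star w * w)) N := by
    have h2 : cfc (fun w : ℂ => w + star w - 2 * (star w * w)) N =
        N + star N - (2 : ℂ) • (star N * N) := by
      rw [cfc_sub (fun w : ℂ => w + star w) (fun w : ℂ => 2 * (star w * w)) N,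
        cfc_add N (fun w : ℂ => w) (fun w : ℂ => star w), hid, hstar,
        cfc_const_mul (2 : ℂ) (fun w : ℂ => star w * w) N,
        cfc_mul (fun w : ℂ => star w) (fun w : ℂ => w) N, hid, hstar]
    rw [h2, ContinuousLinearMap.nonneg_iff_isPositive, ContinuousLinearMap.isPositive_iff_complex]
    intro f
    have h3 := hT.graph_re_inner_nonpos (hT.laplaceOp_mem_graph f)
    rw [← hN, inner_sub_right, Complex.sub_re] at h3
    have h4 : ⟪(N + star N - (2 : ℂ) • (star N * N)) f, f⟫_ℂ =
        (((⟪N f, f⟫_ℂ).re * 2 - 2 * (⟪N f, N f⟫_ℂ).re : ℝ) : ℂ) := by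
      have h5 : ⟪star N f, f⟫_ℂ = starRingEnd ℂ ⟪N f, f⟫_ℂ := by
        rw [ContinuousLinearMap.star_eq_adjoint, ContinuousLinearMap.adjoint_inner_left,
          inner_conj_symm]
      have h6 : ⟪star N (N f), f⟫_ℂ = ((⟪N f, N f⟫_ℂ).re : ℂ) := by
        rw [ContinuousLinearMap.star_eq_adjoint, ContinuousLinearMap.adjoint_inner_left]
        exact (inner_self_ofReal_re (𝕜 := ℂ) (N f)).symm
      have h7 : (N + star N - (2 : ℂ) • (star N * N)) f =
        N f + star N f - (2 : ℂ) • (star N (N f)) := rfl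
      rw [h7, inner_sub_left, inner_add_left, inner_smul_left, h5, h6, Complex.add_conj, map_ofNat]
      push_cast
      ring
    rw [h4]
    simp only [RCLike.re_to_complex, Complex.ofReal_re]
    exact ⟨trivial, by linarith⟩
  open scoped ComplexOrder in
  rw [cfc_nonneg_iff _ _] at h1
  intro w hw
  have h2 := (Complex.le_def.1 (h1 w hw)).1
  have h3 : star w * w = ((‖w‖ ^ 2 : ℝ) : ℂ) := by
    rw [Complex.star_def, ← Complex.normSq_eq_conj_mul_self, Complex.normSq_eq_norm_sq]
  rw [h3] at h2
  simp only [Complex.zero_re, Complex.sub_re, Complex.add_re, Complex.star_def, Complex.conj_re,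
    Complex.mul_re, Complex.ofReal_re, Complex.ofReal_im, Complex.re_ofNat, Complex.im_ofNat] at h2
  change ‖w‖ ^ 2 ≤ w.re
  linarith

/-- `e^{tL} L⁻²`-type orbits: the functional calculus of `w² e^{t (1 - 1/w)}` solves the Cauchy
problem of the generator. -/
theorem apply_sq_laplaceOp [IsStarNormal hT.laplaceOp] (t : ℝ≥0) (f : H) :
    T t (hT.laplaceOp (hT.laplaceOp f)) =
      cfc (fun w : ℂ => w * (w * Complex.exp ((t : ℝ) * (1 - w⁻¹)))) hT.laplaceOp f := by
  set N := hT.laplaceOp with hN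
  have hD := hT.spectrum_laplaceOp_subset
  let S : ℝ → H →L[ℂ] H := fun s => cfc (fun w : ℂ => w * (w * Complex.exp (s * (1 - w⁻¹)))) N
  let Q : ℝ → H →L[ℂ] H := fun s => cfc (fun w : ℂ => w * Complex.exp (s * (1 - w⁻¹))) N
  have hq : ∀ s : ℝ, 0 ≤ s → ContinuousOn (fun w : ℂ => w * Complex.exp (s * (1 - w⁻¹)))
      (spectrum ℂ N) :=
    fun s hs => (continuousOn_mul_exp hs).mono hD
  have hs : ∀ s : ℝ, 0 ≤ s → ContinuousOn (fun w : ℂ => w * (w * Complex.exp (s * (1 - w⁻¹))))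
      (spectrum ℂ N) :=
    fun s hs => (continuousOn_sq_mul_exp hs).mono hD
  have hSQ : ∀ s : ℝ, 0 ≤ s → S s = N * Q s := fun s h0 => by
    simp only [S, Q]
    rw [cfc_mul (fun w : ℂ => w) _ N continuousOn_id (hq s h0), cfc_id' ℂ N]
  have hgraph : ∀ s : ℝ, 0 ≤ s → (S s f, S s f - Q s f) ∈ (generator T).graph := fun s h0 => by
    rw [hSQ s h0]
    exact hT.laplaceOp_mem_graph (Q s f)
  -- Here S has velocity S - Q. The factor w² absorbs the quadratic Taylor remainder, since |w||1 -
  -- 1/w| = |w - 1| ≤ 2 on the disc; this gives 12 = 3 · 2².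
  have hdiff : ∀ s h : ℝ, 0 ≤ s → 0 ≤ h →
      ‖S (s + h) f - S s f - h • (S s f - Q s f)‖ ≤ 12 * h ^ 2 * ‖f‖ := by
    intro s h h0 hh
    have e1 : S (s + h) - S s - (h : ℂ) • (S s - Q s) = cfc (fun w : ℂ =>
        w * (w * Complex.exp ((s + h : ℝ) * (1 - w⁻¹))) - w * (w * Complex.exp (s * (1 - w⁻¹))) -
        h * (w * (w * Complex.exp (s * (1 - w⁻¹))) - w * Complex.exp (s * (1 - w⁻¹)))) N := by
      set p : ℂ → ℂ := fun w => w * (w * Complex.exp ((s + h : ℝ) * (1 - w⁻¹)))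
      set q : ℂ → ℂ := fun w => w * (w * Complex.exp (s * (1 - w⁻¹)))
      set r : ℂ → ℂ := fun w => w * Complex.exp (s * (1 - w⁻¹))
      have c1 : ContinuousOn p (spectrum ℂ N) := hs (s + h) (add_nonneg h0 hh)
      have c2 : ContinuousOn q (spectrum ℂ N) := hs s h0
      have c3 : ContinuousOn r (spectrum ℂ N) := hq s h0
      have c4 : ContinuousOn (fun w => p w - q w) (spectrum ℂ N) := c1.sub c2
      have c5 : ContinuousOn (fun w => q w - r w) (spectrum ℂ N) := c2.sub c3
      have c6 : ContinuousOn (fun w => h * (q w - r w)) (spectrum ℂ N) :=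
        continuousOn_const.mul c5
      rw [cfc_sub (fun w => p w - q w) (fun w => h * (q w - r w)) N c4 c6, cfc_sub p q N c1 c2,
        cfc_const_mul (h : ℂ) (fun w => q w - r w) N c5, cfc_sub q r N c2 c3]
    have e2 : ‖S (s + h) - S s - (h : ℂ) • (S s - Q s)‖ ≤ 12 * h ^ 2 := by
      rw [e1]
      refine norm_cfc_le (by positivity) fun w hw => ?_
      by_cases hw0 : w = 0
      · simp [hw0, sq_nonneg]
      have hwD : ‖w‖ ^ 2 ≤ w.re := hD hw
      have e3 : w * (w * Complex.exp ((s + h : ℝ) * (1 - w⁻¹))) -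
          w * (w * Complex.exp (s * (1 - w⁻¹))) -
          h * (w * (w * Complex.exp (s * (1 - w⁻¹))) - w * Complex.exp (s * (1 - w⁻¹))) =
          Complex.exp (s * (1 - w⁻¹)) * (w ^ 2 * (Complex.exp (h * (1 - w⁻¹)) - 1
            - h * (1 - w⁻¹))) := by
        rw [Complex.ofReal_add, add_mul, Complex.exp_add]
        field_simp
      have e4 : (h * (1 - w⁻¹)).re ≤ 0 := by
        rw [Complex.re_ofReal_mul]
        exact mul_nonpos_of_nonneg_of_nonpos hh (re_one_sub_inv_nonpos hw0 hwD)
      have e5 := norm_exp_sub_one_sub_id_le e4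
      have e6 : ‖w‖ * ‖1 - w⁻¹‖ ≤ 2 := by
        rw [← norm_mul, mul_sub, mul_one, mul_inv_cancel₀ hw0]
        have := norm_sub_le w 1
        rw [norm_one] at this
        linarith [norm_le_one_of_mem_resolventDisc hwD]
      rw [e3, norm_mul, norm_mul, norm_pow]
      have e7 := norm_exp_mul_le_one h0 hw0 hwD
      rw [norm_mul, Complex.norm_of_nonneg hh] at e5
      calc _ ≤ 1 * (‖w‖ ^ 2 * (3 * (h * ‖1 - w⁻¹‖) ^ 2)) := by gcongr
        _ = 3 * h ^ 2 * (‖w‖ * ‖1 - w⁻¹‖) ^ 2 := by ring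
        _ ≤ 3 * h ^ 2 * 2 ^ 2 := by gcongr
        _ = _ := by ring
    have e8 := ContinuousLinearMap.le_of_opNorm_le _ e2 f
    rwa [sub_apply, sub_apply, smul_apply, sub_apply, Complex.coe_smul] at e8
  have hbound : ∀ s : ℝ, 0 ≤ s → ‖S s f - Q s f‖ ≤ 2 * ‖f‖ := by
    intro s h0
    have e1 : ‖S s‖ ≤ 1 := by
      refine norm_cfc_le zero_le_one fun w hw => ?_
      by_cases hw0 : w = 0
      · simp [hw0]
      rw [norm_mul, norm_mul]
      exact mul_le_one₀ (norm_le_one_of_mem_resolventDisc (hD hw)) (by positivity)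
        (mul_le_one₀ (norm_le_one_of_mem_resolventDisc (hD hw)) (norm_nonneg _)
          (norm_exp_mul_le_one h0 hw0 (hD hw)))
    have e2 : ‖Q s‖ ≤ 1 := by
      refine norm_cfc_le zero_le_one fun w hw => ?_
      by_cases hw0 : w = 0
      · simp [hw0]
      rw [norm_mul]
      exact mul_le_one₀ (norm_le_one_of_mem_resolventDisc (hD hw)) (norm_nonneg _)
        (norm_exp_mul_le_one h0 hw0 (hD hw))
    have e3 := (S s).le_of_opNorm_le e1 f
    have e4 := (Q s).le_of_opNorm_le e2 f
    have e5 := norm_sub_le (S s f) (Q s f)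
    linarith
  have hlip : ∀ x y : ℝ, 0 ≤ x → 0 ≤ y →
      ‖S x f - S y f‖ ≤ 2 * ‖f‖ * |x - y| + 12 * ‖f‖ * |x - y| ^ 2 := by
    have main : ∀ s h : ℝ, 0 ≤ s → 0 ≤ h →
        ‖S (s + h) f - S s f‖ ≤ 2 * ‖f‖ * h + 12 * ‖f‖ * h ^ 2 := by
      intro s h h0 hh
      have e1 := hdiff s h h0 hh
      have e2 := norm_add_le (S (s + h) f - S s f - h • (S s f - Q s f)) (h • (S s f - Q s f))
      rw [sub_add_cancel, norm_smul, Real.norm_of_nonneg hh] at e2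
      nlinarith [hbound s h0]
    intro x y hx hy
    rcases le_total y x with h | h
    · have := main y (x - y) hy (sub_nonneg.2 h)
      rwa [add_sub_cancel, ← abs_of_nonneg (sub_nonneg.2 h)] at this
    · have := main x (y - x) hx (sub_nonneg.2 h)
      rwa [add_sub_cancel, ← abs_of_nonneg (sub_nonneg.2 h), norm_sub_rev, abs_sub_comm] at this
  -- F interpolates between T_t N² f at s = 0 and S t f at s = t, so it is enough that F be
  -- constant. Continuity and a vanishing right derivative suffice, which is why only forward
  -- differences are estimated.
  let F : ℝ → H := fun s => T (t - s).toNNReal (S s f)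
  have hderiv : ∀ s ∈ Set.Ico (0 : ℝ) t, HasDerivWithinAt F 0 (Set.Ici s) s := by
    intro s hst
    rw [← hasDerivWithinAt_Ioi_iff_Ici, hasDerivWithinAt_iff_tendsto_slope' (Set.self_notMem_Ioi)]
    have e1 := (mem_graph_generator _ _ _).1 (hgraph s hst.1)
    have e2 : Tendsto (fun x : ℝ => (x - s).toNNReal) (𝓝[>] s) (𝓝[>] 0) := by
      refine tendsto_nhdsWithin_of_tendsto_nhds_of_eventually_within _ ?_ ?_
      · have : Continuous fun x : ℝ => (x - s).toNNReal := by fun_prop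
        exact (this.tendsto' s 0 (by simp)).mono_left nhdsWithin_le_nhds
      · filter_upwards [self_mem_nhdsWithin] with x hx
        exact Real.toNNReal_pos.2 (sub_pos.2 hx)
    have e3 := tendsto_iff_norm_sub_tendsto_zero.1 (e1.comp e2)
    have e4 : Tendsto (fun x : ℝ => 12 * (x - s) * ‖f‖) (𝓝[>] s) (𝓝 0) := by
      have : Continuous fun x : ℝ => 12 * (x - s) * ‖f‖ := by fun_prop
      exact (this.tendsto' s 0 (by simp)).mono_left nhdsWithin_le_nhds
    have e5 := e4.add e3
    rw [add_zero] at e5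
    refine squeeze_zero_norm' ?_ e5
    filter_upwards [Ioo_mem_nhdsGT hst.2] with x hx
    have hh : 0 < x - s := sub_pos.2 hx.1
    have e6 : F x - F s = T (t - x).toNNReal (S x f - T (x - s).toNNReal (S s f)) := by
      simp only [F, map_sub]
      rw [show (t - s : ℝ) = (t - x) + (x - s) by ring,
        Real.toNNReal_add (sub_nonneg.2 hx.2.le) hh.le, hT.add]
      rfl
    -- Both S x f and T (x - s) S s f leave S s f with the same velocity; contractivity removes the
    -- outer operator.
    have e7 : ‖F x - F s‖ ≤ ‖S x f - S s f - (x - s) • (S s f - Q s f)‖ +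
        ‖T (x - s).toNNReal (S s f) - S s f - (x - s) • (S s f - Q s f)‖ := by
      rw [e6]
      refine (hT.norm_apply_le _ _).trans ?_
      refine le_trans (le_of_eq ?_) (norm_sub_le _ _)
      congr 1
      abel
    have e8 := hdiff s (x - s) hst.1 hh.le
    rw [add_sub_cancel] at e8
    rw [slope, vsub_eq_sub, norm_smul, norm_inv, Real.norm_of_nonneg hh.le]
    have e9 : ‖T (x - s).toNNReal (S s f) - S s f - (x - s) • (S s f - Q s f)‖ =
        (x - s) * ‖(((x - s).toNNReal : ℝ) : ℂ)⁻¹ • (T (x - s).toNNReal (S s f) - S s f) -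
          (S s f - Q s f)‖ := by
      generalize S s f - Q s f = v
      rw [Real.coe_toNNReal _ hh.le]
      nth_rw 3 [← Real.norm_of_nonneg hh.le]
      rw [← norm_smul, smul_sub, ← Complex.ofReal_inv, Complex.coe_smul, smul_smul,
        mul_inv_cancel₀ hh.ne', one_smul]
    rw [inv_mul_le_iff₀ hh]
    refine e7.trans ?_
    rw [e9]
    simp only [Function.comp]
    nlinarith [e8]
  have hcontS : ∀ y ∈ Set.Icc (0 : ℝ) t,
      Tendsto (fun x => ‖S x f - S y f‖) (𝓝[Set.Icc (0 : ℝ) t] y) (𝓝 0) := by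
    intro y hy
    have : Continuous fun x : ℝ => 2 * ‖f‖ * |x - y| + 12 * ‖f‖ * |x - y| ^ 2 := by fun_prop
    refine squeeze_zero' (Eventually.of_forall fun x => norm_nonneg _) ?_
      ((this.tendsto' y 0 (by simp)).mono_left nhdsWithin_le_nhds)
    filter_upwards [self_mem_nhdsWithin] with x hx using hlip x y hx.1 hy.1
  have hcont : ContinuousOn F (Set.Icc 0 t) := by
    intro y hy
    refine tendsto_iff_norm_sub_tendsto_zero.2 ?_
    have e1 : Continuous fun x : ℝ => T (t - x).toNNReal (S y f) :=
      (hT.continuous_toNNReal _).comp (continuous_const.sub continuous_id)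
    have e2 := tendsto_iff_norm_sub_tendsto_zero.1
      ((e1.tendsto y).mono_left (nhdsWithin_le_nhds (s := Set.Icc (0 : ℝ) t)))
    have e3 := (hcontS y hy).add e2
    rw [add_zero] at e3
    refine squeeze_zero (fun x => norm_nonneg _) (fun x => ?_) e3
    have e4 := norm_add_le (T (t - x).toNNReal (S x f - S y f))
      (T (t - x).toNNReal (S y f) - T (t - y).toNNReal (S y f))
    rw [map_sub, sub_add_sub_cancel, ← map_sub] at e4
    exact e4.trans (by gcongr; exact hT.norm_apply_le _ _)
  have hconst := constant_of_has_deriv_right_zero hcont hderiv t (Set.right_mem_Icc.2 t.2)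
  have h0 : S 0 f = N (N f) := by
    have : S 0 = N * N := by
      simp only [S]
      rw [show (fun w : ℂ => w * (w * Complex.exp (((0 : ℝ) : ℂ) * (1 - w⁻¹)))) =
          fun w => w * w by ext; simp,
        cfc_mul (fun w : ℂ => w) (fun w => w) N, cfc_id' ℂ N]
    rw [this]; rfl
  simp only [F, sub_self, sub_zero, Real.toNNReal_zero, hT.zero, Real.toNNReal_coe, h0] at hconst
  exact hconst.symm

end IsContractionSemigroup

end

/-! ### Cutoffs at w = 0 and the spectral formula for ⟨g, T_t g⟩ -/

section

variable {H : Type*} [NormedAddCommGroup H] [InnerProductSpace ℂ H] [CompleteSpace H]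
  {T : ℝ≥0 → H →L[ℂ] H}

/-- A cutoff near `0`, tending to `1` off `0` as `δ → 0`, of the form `w² r(w)`. -/
noncomputable def cutoffFactor (δ : ℝ) (w : ℂ) : ℂ :=
  (star w) ^ 2 * (((‖w‖ ^ 4 + δ ^ 4)⁻¹ : ℝ) : ℂ)

theorem continuous_cutoffFactor {δ : ℝ} (hδ : 0 < δ) : Continuous (cutoffFactor δ) := by
  unfold cutoffFactor
  have : Continuous fun w : ℂ => (‖w‖ ^ 4 + δ ^ 4)⁻¹ :=
    Continuous.inv₀ (by fun_prop) fun w => by positivity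
  fun_prop

theorem mul_mul_cutoffFactor (δ : ℝ) (w : ℂ) :
    w * (w * cutoffFactor δ w) = ((‖w‖ ^ 4 * (‖w‖ ^ 4 + δ ^ 4)⁻¹ : ℝ) : ℂ) := by
  have h3 : star w * w = ((‖w‖ ^ 2 : ℝ) : ℂ) := by
    rw [Complex.star_def, ← Complex.normSq_eq_conj_mul_self, Complex.normSq_eq_norm_sq]
  have : w * (w * cutoffFactor δ w) = (star w * w) ^ 2 * (((‖w‖ ^ 4 + δ ^ 4)⁻¹ : ℝ) : ℂ) := by
    unfold cutoffFactor; ring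
  rw [this, h3]
  push_cast
  ring

/-- The complementary cutoff `1 - w² r(w)`. -/
noncomputable def cocutoff (δ : ℝ) (w : ℂ) : ℝ := δ ^ 4 * (‖w‖ ^ 4 + δ ^ 4)⁻¹

theorem continuous_cocutoff {δ : ℝ} (hδ : 0 < δ) : Continuous (cocutoff δ) := by
  unfold cocutoff
  have : Continuous fun w : ℂ => (‖w‖ ^ 4 + δ ^ 4)⁻¹ :=
    Continuous.inv₀ (by fun_prop) fun w => by positivity
  fun_prop

theorem mul_mul_cutoffFactor_eq {δ : ℝ} (hδ : 0 < δ) (w : ℂ) :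
    w * (w * cutoffFactor δ w) = 1 - cocutoff δ w := by
  rw [mul_mul_cutoffFactor, cocutoff, ← Complex.ofReal_one, ← Complex.ofReal_sub]
  congr 1
  have : ‖w‖ ^ 4 + δ ^ 4 ≠ 0 := by positivity
  field_simp
  ring

theorem cocutoff_nonneg {δ : ℝ} (hδ : 0 < δ) (w : ℂ) : 0 ≤ cocutoff δ w := by
  unfold cocutoff; positivity

theorem cocutoff_le_one {δ : ℝ} (hδ : 0 < δ) (w : ℂ) : cocutoff δ w ≤ 1 := by
  unfold cocutoff
  rw [← div_eq_mul_inv, div_le_one (by positivity)]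
  linarith [show 0 ≤ ‖w‖ ^ 4 by positivity]

theorem cocutoff_mul_norm_le {δ : ℝ} (hδ : 0 < δ) (w : ℂ) : cocutoff δ w * ‖w‖ ≤ δ := by
  rcases le_total ‖w‖ δ with h | h
  · nlinarith [cocutoff_le_one hδ w, norm_nonneg w, cocutoff_nonneg hδ w]
  · unfold cocutoff
    rw [← div_eq_mul_inv, div_mul_eq_mul_div, div_le_iff₀ (by positivity)]
    have h1 : δ ^ 3 ≤ ‖w‖ ^ 3 := by gcongr
    have h2 : 0 ≤ δ * ‖w‖ := by positivity
    have h3 : 0 ≤ δ * δ ^ 4 := by positivity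
    nlinarith [mul_le_mul_of_nonneg_left h1 h2]

theorem tendsto_cocutoff {w : ℂ} (hw : w ≠ 0) {δ : ℕ → ℝ} (hδ : Tendsto δ atTop (𝓝 0)) :
    Tendsto (fun n => cocutoff (δ n) w) atTop (𝓝 0) := by
  have h0 : ‖w‖ ^ 4 + (0 : ℝ) ^ 4 ≠ 0 := by simpa using hw
  have := (hδ.pow 4).mul (((hδ.pow 4).const_add (‖w‖ ^ 4)).inv₀ h0)
  simpa [cocutoff] using this

namespace IsContractionSemigroup

variable (hT : IsContractionSemigroup T)
include hT

/-- These operators are contractions, and they are O(δ) on each vector in the range of N. That range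
contains the domain of the generator, which is dense. -/
theorem tendsto_cfc_cocutoff [IsStarNormal hT.laplaceOp]
    (hd : Dense ((generator T).domain : Set H)) {δ : ℕ → ℝ} (hδ0 : ∀ n, 0 < δ n)
    (hδ : Tendsto δ atTop (𝓝 0)) (g : H) :
    Tendsto (fun n => cfc (fun w => (cocutoff (δ n) w : ℂ)) hT.laplaceOp g) atTop (𝓝 0) := by
  set N := hT.laplaceOp with hN
  set E : ℕ → H →L[ℂ] H := fun n => cfc (fun w => (cocutoff (δ n) w : ℂ)) N
  have hc : ∀ n, ContinuousOn (fun w => (cocutoff (δ n) w : ℂ)) (spectrum ℂ N) := fun n =>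
    (Complex.continuous_ofReal.comp (continuous_cocutoff (hδ0 n))).continuousOn
  have hE1 : ∀ n, ‖E n‖ ≤ 1 := fun n => by
    refine norm_cfc_le zero_le_one fun w _ => ?_
    rw [Complex.norm_of_nonneg (cocutoff_nonneg (hδ0 n) w)]
    exact cocutoff_le_one (hδ0 n) w
  have hE2 : ∀ n, ‖E n * N‖ ≤ δ n := fun n => by
    have : E n * N = cfc (fun w => (cocutoff (δ n) w : ℂ) * w) N := by
      rw [cfc_mul _ (fun w : ℂ => w) N (hc n) continuousOn_id, cfc_id' ℂ N]
    rw [this]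
    refine norm_cfc_le (hδ0 n).le fun w _ => ?_
    rw [norm_mul, Complex.norm_of_nonneg (cocutoff_nonneg (hδ0 n) w)]
    exact cocutoff_mul_norm_le (hδ0 n) w
  rw [Metric.tendsto_atTop]
  intro ε hε
  obtain ⟨x, hx, hxg⟩ := hd.exists_dist_lt g (half_pos hε)
  obtain ⟨y, hy⟩ : ∃ y, N y = x := by
    have h1 := isResolvent_one_iff.1 hT.isResolvent_laplaceOp
    exact ⟨_, h1.2 _ _ ((generator T).mem_graph ⟨x, hx⟩)⟩
  have h2 : Tendsto (fun n => δ n * ‖y‖) atTop (𝓝 0) := by simpa using hδ.mul_const ‖y‖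
  obtain ⟨n₀, hn₀⟩ := Metric.tendsto_atTop.1 h2 (ε / 2) (half_pos hε)
  refine ⟨n₀, fun n hn => ?_⟩
  have h3 := hn₀ n hn
  rw [Real.dist_eq, sub_zero, abs_of_nonneg (mul_nonneg (hδ0 n).le (norm_nonneg _))] at h3
  rw [dist_zero_right]
  have h4 : E n g = E n (g - x) + (E n * N) y := by
    rw [map_sub, mul_apply_eq_comp, hy, sub_add_cancel]
  change ‖E n g‖ < ε
  rw [h4]
  rw [dist_eq_norm] at hxg
  calc _ ≤ ‖E n (g - x)‖ + ‖(E n * N) y‖ := norm_add_le _ _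
    _ ≤ 1 * ‖g - x‖ + δ n * ‖y‖ := add_le_add ((E n).le_of_opNorm_le (hE1 n) _)
        ((E n * N).le_of_opNorm_le (hE2 n) _)
    _ < ε := by linarith

/-- The function `cocutoff` equals 1 at w = 0, so the atom is at most the quadratic form of the
cocutoff at g, which tends to 0. -/
theorem boundedSpectralMeasure_singleton_zero [IsStarNormal hT.laplaceOp]
    (hd : Dense ((generator T).domain : Set H)) (g : H) :
    boundedSpectralMeasure hT.laplaceOp g {0} = 0 := by
  set N := hT.laplaceOp with hN
  set μ := boundedSpectralMeasure N g
  have hδ : Tendsto (fun n : ℕ => 1 / ((n : ℝ) + 1)) atTop (𝓝 0) :=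
    tendsto_one_div_add_atTop_nhds_zero_nat
  have hδ0 : ∀ n : ℕ, 0 < 1 / ((n : ℝ) + 1) := fun n => by positivity
  have h1 := (tendsto_const_nhds (x := g)).inner (𝕜 := ℂ) (hT.tendsto_cfc_cocutoff hd hδ0 hδ g)
  rw [inner_zero_right] at h1
  have h2 : ∀ n : ℕ, μ.real {0} ≤
      ‖⟪g, cfc (fun w => (cocutoff (1 / ((n : ℝ) + 1)) w : ℂ)) N g⟫_ℂ‖ := by
    intro n
    rw [← integral_boundedSpectralMeasure_ofReal g (continuous_cocutoff (hδ0 n)).continuousOn,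
      Complex.norm_real]
    refine le_trans ?_ (le_abs_self _)
    rw [← integral_indicator_one (measurableSet_singleton (0 : ℂ))]
    have hint : Integrable (fun w => cocutoff (1 / ((n : ℝ) + 1)) w) μ := by
      refine Integrable.of_bound (continuous_cocutoff (hδ0 n)).aestronglyMeasurable 1
        (Eventually.of_forall fun w => ?_)
      rw [Real.norm_of_nonneg (cocutoff_nonneg (hδ0 n) w)]
      exact cocutoff_le_one (hδ0 n) w
    refine integral_mono ((integrable_const 1).indicator (measurableSet_singleton _)) hint
        fun w => ?_
    by_cases hw : w = 0
    · subst hw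
      have := (hδ0 n).ne'
      simp only [Set.mem_singleton_iff, Set.indicator_of_mem, Pi.one_apply, cocutoff, norm_zero]
      rw [zero_pow (by norm_num), zero_add, mul_inv_cancel₀ (pow_ne_zero 4 this)]
    · rw [Set.indicator_of_notMem (by simpa using hw)]
      exact cocutoff_nonneg (hδ0 n) w
  have h3 : μ.real {0} ≤ 0 := ge_of_tendsto (by simpa using h1.norm) (Eventually.of_forall h2)
  rw [measureReal_def] at h3
  exact (ENNReal.toReal_eq_zero_iff _).1 (le_antisymm h3 ENNReal.toReal_nonneg) |>.resolve_right
    (measure_ne_top _ _)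

theorem spectralMeasure_eq (g : H) : spectralMeasure (generator T) g =
    (boundedSpectralMeasure hT.laplaceOp g).map (fun w => 1 - w⁻¹) := by
  rw [spectralMeasure, resolventOp_eq hT.isResolvent_laplaceOp]

theorem isFiniteMeasure_spectralMeasure (g : H) :
    IsFiniteMeasure (spectralMeasure (generator T) g) := by
  rw [hT.spectralMeasure_eq]
  infer_instance

variable (hN : IsNormalOperator (generator T))
include hN

theorem ae_re_nonpos (g : H) : ∀ᵐ z ∂(spectralMeasure (generator T) g), z.re ≤ 0 := by
  have := hN.isStarNormal hT.isResolvent_laplaceOp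
  rw [hT.spectralMeasure_eq, ae_map_iff (by fun_prop)
    (measurableSet_le Complex.measurable_re measurable_const)]
  filter_upwards [ae_mem_spectrum hT.laplaceOp g,
    compl_mem_ae_iff.2 (hT.boundedSpectralMeasure_singleton_zero hN.2.1 g)] with w hw hw0
  exact re_one_sub_inv_nonpos hw0 (hT.spectrum_laplaceOp_subset hw)

/-- The formula for T_t N² is applied to N² r(N) g, where w² r(w) = 1 - `cocutoff`; this vector
tends to g. On the measure side, e^t dominates and the cocutoff tends to 0 off w = 0, which is a
null set. -/
theorem inner_apply_eq_integral (t : ℝ≥0) (g : H) :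
    ⟪g, T t g⟫_ℂ = ∫ z, Complex.exp ((t : ℝ) * z) ∂(spectralMeasure (generator T) g) := by
  have := hN.isStarNormal hT.isResolvent_laplaceOp
  rw [hT.spectralMeasure_eq, integral_map (by fun_prop) (by fun_prop)]
  have hD := hT.spectrum_laplaceOp_subset
  set N := hT.laplaceOp with hNdef
  set μ := boundedSpectralMeasure N g
  let δ : ℕ → ℝ := fun n => 1 / ((n : ℝ) + 1)
  have hδ : Tendsto δ atTop (𝓝 0) := tendsto_one_div_add_atTop_nhds_zero_nat
  have hδ0 : ∀ n : ℕ, 0 < δ n := fun n => by positivity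
  let e : ℂ → ℂ := fun w => Complex.exp ((t : ℝ) * (1 - w⁻¹))
  let q : ℂ → ℂ := fun w => w * (w * e w)
  have hq : ContinuousOn q (spectrum ℂ N) := (continuousOn_sq_mul_exp t.2).mono hD
  have hr : ∀ n, ContinuousOn (cutoffFactor (δ n)) (spectrum ℂ N) := fun n =>
    (continuous_cutoffFactor (hδ0 n)).continuousOn
  have h1 : Tendsto (fun n => ⟪g, T t (g - cfc (fun w => (cocutoff (δ n) w : ℂ)) N g)⟫_ℂ) atTop
      (𝓝 ⟪g, T t g⟫_ℂ) := by
    have h2 := (hT.tendsto_cfc_cocutoff hN.2.1 hδ0 hδ g).const_sub g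
    rw [sub_zero] at h2
    exact tendsto_const_nhds.inner (((T t).continuous.tendsto _).comp h2)
  have h3 : ∀ n, T t (g - cfc (fun w => (cocutoff (δ n) w : ℂ)) N g) =
      cfc (fun w => q w * cutoffFactor (δ n) w) N g := by
    intro n
    have e1 : g - cfc (fun w => (cocutoff (δ n) w : ℂ)) N g =
        N (N (cfc (cutoffFactor (δ n)) N g)) := by
      have hc : ContinuousOn (fun w => (cocutoff (δ n) w : ℂ)) (spectrum ℂ N) :=
        (Complex.continuous_ofReal.comp (continuous_cocutoff (hδ0 n))).continuousOn
      have e2 : (1 : H →L[ℂ] H) - cfc (fun w => (cocutoff (δ n) w : ℂ)) N =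
          N * (N * cfc (cutoffFactor (δ n)) N) := by
        have e3 : cfc (fun w : ℂ => w) N = N := cfc_id' ℂ N
        have e4 : cfc (fun w => w * (w * cutoffFactor (δ n) w)) N =
            N * (N * cfc (cutoffFactor (δ n)) N) := by
          rw [cfc_mul (fun w : ℂ => w) (fun w => w * cutoffFactor (δ n) w) N continuousOn_id
              (continuousOn_id.mul (hr n)),
            cfc_mul (fun w : ℂ => w) _ N continuousOn_id (hr n), e3]
        rw [← e4, ← cfc_const_one ℂ N, ← cfc_sub _ _ N continuousOn_const hc]
        exact cfc_congr fun w _ => (mul_mul_cutoffFactor_eq (hδ0 n) w).symm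
      exact congrArg (fun A : H →L[ℂ] H => A g) e2
    rw [e1, hT.apply_sq_laplaceOp, cfc_mul _ _ N hq (hr n)]
    rfl
  have h1' := h1.congr fun n => (congrArg (fun v => ⟪g, v⟫_ℂ) (h3 n)).trans
    (integral_boundedSpectralMeasure (f := fun w => q w * cutoffFactor (δ n) w) g
      (hq.mul (hr n))).symm
  refine tendsto_nhds_unique h1' ?_
  have h4 : ∀ n w, q w * cutoffFactor (δ n) w = e w * (1 - cocutoff (δ n) w) := fun n w => by
    rw [← mul_mul_cutoffFactor_eq (hδ0 n)]
    ring
  refine tendsto_integral_of_dominated_convergence (fun _ => Real.exp t * 1) ?_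
      (integrable_const _) ?_ ?_
  · intro n
    exact (integrable_boundedSpectralMeasure g (hq.mul (hr n))).aestronglyMeasurable
  · intro n
    filter_upwards [ae_mem_spectrum N g] with w hw
    rw [h4, norm_mul]
    gcongr
    · exact norm_exp_mul_one_sub_inv_le t.2 (hD hw)
    · rw [← Complex.ofReal_one, ← Complex.ofReal_sub, Complex.norm_of_nonneg]
      · linarith [cocutoff_nonneg (hδ0 n) w]
      · linarith [cocutoff_le_one (hδ0 n) w]
  · filter_upwards [compl_mem_ae_iff.2 (hT.boundedSpectralMeasure_singleton_zero hN.2.1 g)]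
    with w hw0
    simp_rw [h4]
    have h5 := (Complex.continuous_ofReal.tendsto _).comp (tendsto_cocutoff hw0 hδ)
    have h6 := (h5.const_sub 1).const_mul (e w)
    simpa using h6

end IsContractionSemigroup

end

/-! ### Stationary Markov processes: the semigroup and the variance of additive functionals -/

section Markov

variable {Ω S : Type*} [mΩ : MeasurableSpace Ω] [mS : MeasurableSpace S]
  {P : Measure Ω} {π : Measure S} {ℱ : Filtration ℝ≥0 mΩ} {ξ : ℝ≥0 → Ω → S}
  {hπ : ∀ t, MeasurePreserving (ξ t) P π}

/-- The isometric embedding `f ↦ f ∘ ξ_t`. -/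
noncomputable abbrev pullback (hπ : ∀ t, MeasurePreserving (ξ t) P π) (t : ℝ≥0) :
    Lp ℂ 2 π →ₗᵢ[ℂ] Lp ℂ 2 P :=
  Lp.compMeasurePreservingₗᵢ ℂ (ξ t) (hπ t)

theorem coeFn_pullback (t : ℝ≥0) (f : Lp ℂ 2 π) : pullback hπ t f =ᵐ[P] fun ω => f (ξ t ω) :=
  Lp.coeFn_compMeasurePreserving f (hπ t)

theorem inner_transitionOp (t : ℝ≥0) (h f : Lp ℂ 2 π) :
    ⟪h, transitionOp P π ξ hπ t f⟫_ℂ = ⟪pullback hπ 0 h, pullback hπ t f⟫_ℂ := by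
  rw [transitionOp, ContinuousLinearMap.comp_apply, ContinuousLinearMap.adjoint_inner_right]
  rfl

theorem transitionOp_zero : transitionOp P π ξ hπ 0 = 1 := by
  ext1 f
  refine ext_inner_left ℂ fun h => ?_
  rw [inner_transitionOp, LinearIsometry.inner_map_map]
  rfl

theorem norm_transitionOp_apply_le (t : ℝ≥0) (f : Lp ℂ 2 π) :
    ‖transitionOp P π ξ hπ t f‖ ≤ ‖f‖ := by
  have h1 : ‖transitionOp P π ξ hπ t f‖ ^ 2 ≤ ‖transitionOp P π ξ hπ t f‖ * ‖f‖ := by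
    have h2 := inner_transitionOp (hπ := hπ) t (transitionOp P π ξ hπ t f) f
    rw [inner_self_eq_norm_sq_to_K] at h2
    have h3 := norm_inner_le_norm (𝕜 := ℂ) (pullback hπ 0 (transitionOp P π ξ hπ t f))
      (pullback hπ t f)
    rw [← h2, LinearIsometry.norm_map, LinearIsometry.norm_map, norm_pow] at h3
    simpa using h3
  by_contra! h
  nlinarith [norm_nonneg f]

variable [IsProbabilityMeasure P]

/-- The left factor is measurable with respect to ℱ u because r ≤ u, so the inner product sees only
the conditional expectation of the right factor, and the Markov property identifies it. -/
theorem inner_pullback_of_lt (hprog : IsProgressive ℱ ξ) (hMarkov : HasMarkovProperty P π ℱ ξ hπ)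
    {r u t : ℝ≥0} (hru : r ≤ u) (hut : u < t) (h f : Lp ℂ 2 π) :
    ⟪pullback hπ r h, pullback hπ t f⟫_ℂ =
      ⟪pullback hπ r h, pullback hπ u (transitionOp P π ξ hπ (t - u) f)⟫_ℂ := by
  have hm : ℱ u ≤ mΩ := ℱ.le u
  have h1 : AEStronglyMeasurable[ℱ u] (pullback hπ r h) P := by
    refine AEStronglyMeasurable.congr ?_ (coeFn_pullback r h).symm
    have h2 : Measurable[ℱ u] (ξ r) := (hprog.adapted r).mono (ℱ.mono hru) le_rfl
    exact ((Lp.stronglyMeasurable h).comp_measurable h2).aestronglyMeasurable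
  have h3 : (condExpL2 ℂ ℂ hm (pullback hπ t f) : Lp ℂ 2 P) =
      pullback hπ u (transitionOp P π ξ hπ (t - u) f) := by
    refine Lp.ext ?_
    have h4 := MemLp.condExpL2_ae_eq_condExp (𝕜 := ℂ) hm (Lp.memLp (pullback hπ t f))
    rw [Lp.toLp_coeFn] at h4
    have h5 : P[pullback hπ t f | ℱ u] =ᵐ[P] P[fun ω => f (ξ t ω) | ℱ u] :=
      condExp_congr_ae (coeFn_pullback t f)
    exact h4.trans (h5.trans ((hMarkov f u t hut).trans (coeFn_pullback u _).symm))
  rw [← h3]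
  have h6 := inner_condExpL2_eq_inner_fun (𝕜 := ℂ) hm (pullback hπ t f) (pullback hπ r h) h1
  rw [← inner_conj_symm, ← h6, inner_conj_symm]

theorem inner_pullback (hprog : IsProgressive ℱ ξ) (hMarkov : HasMarkovProperty P π ℱ ξ hπ)
    {u t : ℝ≥0} (hut : u ≤ t) (h f : Lp ℂ 2 π) :
    ⟪pullback hπ u h, pullback hπ t f⟫_ℂ = ⟪h, transitionOp P π ξ hπ (t - u) f⟫_ℂ := by
  rcases hut.eq_or_lt with rfl | hlt
  · rw [tsub_self, transitionOp_zero, LinearIsometry.inner_map_map]; rfl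
  · rw [inner_pullback_of_lt hprog hMarkov le_rfl hlt, LinearIsometry.inner_map_map]

/-- The semigroup law is the Markov property at the intermediate time s, tested against functions of
ξ_0. -/
theorem isContractionSemigroup_transitionOp (hprog : IsProgressive ℱ ξ)
    (hMarkov : HasMarkovProperty P π ℱ ξ hπ)
    (hcont : ∀ f : Lp ℂ 2 π, Continuous fun t => transitionOp P π ξ hπ t f) :
    IsContractionSemigroup (transitionOp P π ξ hπ) where
  zero := transitionOp_zero
  add s t := by
    rcases eq_or_ne t 0 with rfl | ht
    · rw [add_zero, transitionOp_zero, mul_one]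
    ext1 f
    refine ext_inner_left ℂ fun h => ?_
    have h1 : s < s + t := lt_add_of_pos_right s (pos_iff_ne_zero.2 ht)
    rw [inner_transitionOp, inner_pullback_of_lt hprog hMarkov zero_le h1,
      ← inner_transitionOp, add_tsub_cancel_left]
    rfl
  norm_apply_le := norm_transitionOp_apply_le
  continuous := hcont

/-- Fubini for the second moment of `∫ X_s dm(s)`. -/
theorem integral_sq_integral {m : Measure ℝ} [IsFiniteMeasure m] {X : ℝ → Ω → ℝ}
    (hX : StronglyMeasurable (Function.uncurry X))
    (hint : Integrable (fun p : ℝ × Ω => X p.1 p.2 ^ 2) (m.prod P)) :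
    ∫ ω, (∫ s, X s ω ∂m) ^ 2 ∂P = ∫ s, ∫ t, ∫ ω, X s ω * X t ω ∂P ∂m ∂m := by
  have h1 : Integrable (fun p : (ℝ × ℝ) × Ω => X p.1.1 p.2 * X p.1.2 p.2) ((m.prod m).prod P) := by
    have e2 : Integrable (fun p : (ℝ × ℝ) × Ω => X p.1.2 p.2 ^ 2) ((m.prod m).prod P) :=
      ((measurePreserving_prodAssoc m m P).integrable_comp_emb
        MeasurableEquiv.prodAssoc.measurableEmbedding).2 (hint.comp_snd m)
    have e1 : Integrable (fun p : (ℝ × ℝ) × Ω => X p.1.1 p.2 ^ 2) ((m.prod m).prod P) :=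
      (((Measure.measurePreserving_swap (μ := m) (ν := m)).prod
        (MeasurePreserving.id P)).integrable_comp e2.aestronglyMeasurable).2 e2
    refine (e1.add e2).mono' ?_ (Eventually.of_forall fun p => ?_)
    · have m1 : Measurable fun p : (ℝ × ℝ) × Ω => (p.1.1, p.2) := by fun_prop
      have m2 : Measurable fun p : (ℝ × ℝ) × Ω => (p.1.2, p.2) := by fun_prop
      exact ((hX.comp_measurable m1).mul (hX.comp_measurable m2)).aestronglyMeasurable
    · simp only [Pi.add_apply]
      rw [Real.norm_eq_abs, abs_le]
      constructor <;> nlinarith [sq_nonneg (X p.1.1 p.2 + X p.1.2 p.2),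
        sq_nonneg (X p.1.1 p.2 - X p.1.2 p.2), sq_nonneg (X p.1.1 p.2), sq_nonneg (X p.1.2 p.2)]
  have h2 : ∀ ω, (∫ s, X s ω ∂m) ^ 2 = ∫ p, X p.1 ω * X p.2 ω ∂(m.prod m) := fun ω => by
    rw [sq, integral_prod_mul (fun s => X s ω) (fun s => X s ω)]
  simp_rw [h2]
  rw [← integral_integral_swap (f := fun (p : ℝ × ℝ) ω => X p.1 ω * X p.2 ω) h1]
  exact integral_prod _ h1.integral_prod_left

theorem integral_mul_toComplexLp {g : S → ℝ} (hg : MemLp g 2 π) (hprog : IsProgressive ℱ ξ)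
    (hMarkov : HasMarkovProperty P π ℱ ξ hπ) (s t : ℝ≥0) :
    ∫ ω, g (ξ s ω) * g (ξ t ω) ∂P = (⟪toComplexLp π g hg,
      transitionOp P π ξ hπ (max s t - min s t) (toComplexLp π g hg)⟫_ℂ).re := by
  wlog hst : s ≤ t generalizing s t
  · rw [max_comm, min_comm, ← this t s (le_of_not_ge hst)]
    simp_rw [mul_comm]
  rw [max_eq_right hst, min_eq_left hst, ← inner_pullback hprog hMarkov hst, L2.inner_def]
  have h1 : ∀ r, pullback hπ r (toComplexLp π g hg) =ᵐ[P] fun ω => (g (ξ r ω) : ℂ) := fun r =>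
    (coeFn_pullback r _).trans ((hπ r).quasiMeasurePreserving.ae_eq_comp hg.ofReal.coeFn_toLp)
  have h2 : ∫ ω, ⟪pullback hπ s (toComplexLp π g hg) ω, pullback hπ t (toComplexLp π g hg) ω⟫_ℂ ∂P =
      ∫ ω, ((g (ξ s ω) * g (ξ t ω) : ℝ) : ℂ) ∂P := by
    refine integral_congr_ae ?_
    filter_upwards [h1 s, h1 t] with ω e1 e2
    rw [e1, e2]
    simp [mul_comm]
  rw [h2, integral_complex_ofReal, Complex.ofReal_re]

/-- S_T is centred, so its variance is a second moment, and Fubini reduces it to covariances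
depending on |s - t| only. The work lies in joint measurability and in g being determined only up to
π-null sets. -/
theorem variance_additiveFunctional {g : S → ℝ} (hg : MemLp g 2 π) (hg0 : ∫ x, g x ∂π = 0)
    (hprog : IsProgressive ℱ ξ) (hMarkov : HasMarkovProperty P π ℱ ξ hπ) {T : ℝ} (hT : 0 ≤ T) :
    variance (additiveFunctional ξ g T) P = ∫ s in Set.Ioc 0 T, ∫ t in Set.Ioc 0 T,
      (⟪toComplexLp π g hg,
        transitionOp P π ξ hπ (|s - t|).toNNReal (toComplexLp π g hg)⟫_ℂ).re := by
  have : IsProbabilityMeasure π := by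
    rw [← (hπ 0).map_eq]
    exact Measure.isProbabilityMeasure_map (hπ 0).measurable.aemeasurable
  set m : Measure ℝ := volume.restrict (Set.Ioc 0 T) with hm
  -- Clamping the time at T makes the process factor through [0, T] × Ω, where progressive
  -- measurability at the single time T gives joint measurability.
  let τ : ℝ → ℝ≥0 := fun s => min s.toNNReal T.toNNReal
  have hτ : ∀ s ∈ Set.Ioc 0 T, τ s = s.toNNReal := fun s hs =>
    min_eq_left (Real.toNNReal_le_toNNReal hs.2)
  have hξm : Measurable fun p : ℝ × Ω => ξ (τ p.1) p.2 := by
    have e1 := hprog T.toNNReal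
    have e2 : Measurable fun p : Set.Iic T.toNNReal × Ω => ξ p.1 p.2 :=
      e1.mono (sup_le_sup le_rfl (MeasurableSpace.comap_mono (ℱ.le _))) le_rfl
    have e3 : Measurable fun p : ℝ × Ω =>
        ((⟨τ p.1, Set.mem_Iic.2 (min_le_right _ _)⟩ : Set.Iic T.toNNReal), p.2) := by
      refine Measurable.prodMk (Measurable.subtype_mk ?_) measurable_snd
      exact (measurable_real_toNNReal.comp measurable_fst).min measurable_const
    exact e2.comp e3
  obtain ⟨g₀, hg₀m, hg₀⟩ := hg.1
  let X : ℝ → Ω → ℝ := fun s ω => g₀ (ξ (τ s) ω)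
  have hX : StronglyMeasurable (Function.uncurry X) := hg₀m.comp_measurable hξm
  have hg₀L : MemLp g₀ 2 π := hg.ae_eq hg₀
  have hXint : Integrable (fun p : ℝ × Ω => X p.1 p.2 ^ 2) (m.prod P) := by
    have e1 : AEStronglyMeasurable (fun p : ℝ × Ω => X p.1 p.2 ^ 2) (m.prod P) :=
      (hX.pow 2).aestronglyMeasurable
    have e2 : ∀ s, ∫ ω, X s ω ^ 2 ∂P = ∫ x, g₀ x ^ 2 ∂π := fun s => by
      rw [← (hπ (τ s)).map_eq, integral_map (hπ (τ s)).measurable.aemeasurable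
        (f := fun x => g₀ x ^ 2) (hg₀m.pow 2).aestronglyMeasurable]
    rw [integrable_prod_iff e1]
    refine ⟨Eventually.of_forall fun s => ?_, ?_⟩
    · exact (hπ (τ s)).integrable_comp_of_integrable hg₀L.integrable_sq
    · simp only [norm_pow, Real.norm_eq_abs, sq_abs, e2]
      exact integrable_const _
  have hXint1 : Integrable (Function.uncurry X) (m.prod P) :=
    ((memLp_two_iff_integrable_sq hX.aestronglyMeasurable).2 hXint).integrable one_le_two
  -- Each ξ_s almost surely avoids the null set where g and g₀ differ; exchanging the two
  -- almost-everywhere quantifiers gives, for almost every path, agreement at almost every time.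
  have hae : additiveFunctional ξ g T =ᵐ[P] fun ω => ∫ s, X s ω ∂m := by
    set A := toMeasurable π {x | ¬ g x = g₀ x} with hA
    have hA0 : π A = 0 := by rw [measure_toMeasurable]; exact hg₀
    have e1 : ∀ᵐ s ∂m, ∀ᵐ ω ∂P, ξ (τ s) ω ∉ A := Eventually.of_forall fun s =>
      (hπ (τ s)).quasiMeasurePreserving.ae (p := fun x => x ∉ A)
          (measure_eq_zero_iff_ae_notMem.1 hA0)
    have e2 := (Measure.ae_ae_comm (p := fun s ω => ξ (τ s) ω ∉ A)
      (hξm (measurableSet_toMeasurable _ _).compl)).1 e1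
    filter_upwards [e2] with ω hω
    rw [additiveFunctional, intervalIntegral.integral_of_le hT]
    refine integral_congr_ae ?_
    filter_upwards [hω, ae_restrict_mem measurableSet_Ioc] with s hs hsT
    rw [← hτ s hsT]
    by_contra h
    exact hs (subset_toMeasurable _ _ h)
  have hmean : ∫ ω, ∫ s, X s ω ∂m ∂P = 0 := by
    rw [← integral_integral_swap hXint1]
    have e2 : ∀ s, ∫ ω, X s ω ∂P = 0 := fun s => by
      rw [← hg0, integral_congr_ae hg₀, ← (hπ (τ s)).map_eq,
        integral_map (hπ (τ s)).measurable.aemeasurable hg₀m.aestronglyMeasurable]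
    simp [e2]
  have hmeas : AEMeasurable (fun ω => ∫ s, X s ω ∂m) P :=
    hXint1.integral_prod_right.aestronglyMeasurable.aemeasurable
  rw [variance_congr hae, variance_of_integral_eq_zero hmeas hmean,
    integral_sq_integral hX hXint]
  refine setIntegral_congr_fun measurableSet_Ioc fun s hs => ?_
  refine setIntegral_congr_fun measurableSet_Ioc fun t ht => ?_
  have e3 : max (τ s) (τ t) - min (τ s) (τ t) = (|s - t|).toNNReal := by
    rw [hτ s hs, hτ t ht]
    rcases le_total s t with h | h
    · rw [max_eq_right (Real.toNNReal_le_toNNReal h), min_eq_left (Real.toNNReal_le_toNNReal h),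
        abs_sub_comm, abs_of_nonneg (sub_nonneg.2 h), NNReal.sub_def,
        Real.coe_toNNReal _ hs.1.le, Real.coe_toNNReal _ ht.1.le]
    · rw [max_eq_left (Real.toNNReal_le_toNNReal h), min_eq_right (Real.toNNReal_le_toNNReal h),
        abs_of_nonneg (sub_nonneg.2 h), NNReal.sub_def,
        Real.coe_toNNReal _ hs.1.le, Real.coe_toNNReal _ ht.1.le]
  have e4 : (fun ω => X s ω * X t ω) =ᵐ[P] fun ω => g (ξ (τ s) ω) * g (ξ (τ t) ω) := by
    filter_upwards [(hπ (τ s)).quasiMeasurePreserving.ae_eq_comp hg₀,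
      (hπ (τ t)).quasiMeasurePreserving.ae_eq_comp hg₀] with ω h1 h2
    simp only [Function.comp] at h1 h2
    simp only [X, h1, h2]
  rw [integral_congr_ae e4, integral_mul_toComplexLp hg hprog hMarkov, e3]

end Markov

/-! ### The kernel of the variance -/

/-- `∫_0^t e^{sz} ds`, which is `(e^{tz} - 1) / z` off `0`. -/
noncomputable def orbit (z : ℂ) (t : ℝ) : ℂ := ∫ s in (0 : ℝ)..t, Complex.exp (s * z)

theorem continuous_orbit_uncurry : Continuous fun p : ℂ × ℝ => orbit p.1 p.2 :=
  intervalIntegral.continuous_parametric_intervalIntegral_of_continuous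
    (f := fun (p : ℂ × ℝ) (s : ℝ) => Complex.exp (s * p.1)) (by fun_prop) continuous_snd

theorem continuous_orbit (z : ℂ) : Continuous (orbit z) :=
  continuous_orbit_uncurry.comp (by fun_prop : Continuous fun t : ℝ => (z, t))

theorem continuous_orbit_left (t : ℝ) : Continuous fun z => orbit z t :=
  continuous_orbit_uncurry.comp (by fun_prop : Continuous fun z : ℂ => (z, t))

theorem hasDerivAt_orbit (z : ℂ) (t : ℝ) : HasDerivAt (orbit z) (Complex.exp (t * z)) t := by
  have hc : Continuous fun s : ℝ => Complex.exp (s * z) := by fun_prop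
  exact intervalIntegral.integral_hasDerivAt_right (hc.intervalIntegrable _ _)
    (hc.stronglyMeasurableAtFilter _ _) hc.continuousAt

theorem orbit_eq {z : ℂ} (hz : z ≠ 0) (t : ℝ) : orbit z t = (Complex.exp (t * z) - 1) / z := by
  have := integral_exp_mul_complex (a := 0) (b := t) hz
  simp only [mul_comm z] at this
  rw [orbit, this]
  simp

theorem mul_orbit (z : ℂ) (t : ℝ) : z * orbit z t = Complex.exp (t * z) - 1 := by
  by_cases hz : z = 0
  · simp [hz]
  · rw [orbit_eq hz, mul_div_cancel₀ _ hz]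

theorem norm_exp_mul_le {z : ℂ} (hz : z.re ≤ 0) {t : ℝ} (ht : 0 ≤ t) :
    ‖Complex.exp (t * z)‖ ≤ 1 := by
  rw [Complex.norm_exp, Complex.re_ofReal_mul]
  exact Real.exp_le_one_iff.2 (mul_nonpos_of_nonneg_of_nonpos ht hz)

theorem norm_orbit_le {z : ℂ} (hz : z.re ≤ 0) {t : ℝ} (ht : 0 ≤ t) : ‖orbit z t‖ ≤ t := by
  have := intervalIntegral.norm_integral_le_of_norm_le_const (a := 0) (b := t) (C := 1)
    (f := fun s : ℝ => Complex.exp (s * z)) fun s hs => by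
      rw [Set.uIoc_of_le ht] at hs
      exact norm_exp_mul_le hz hs.1.le
  rwa [one_mul, sub_zero, abs_of_nonneg ht] at this

theorem norm_mul_norm_orbit_le {z : ℂ} (hz : z.re ≤ 0) {t : ℝ} (ht : 0 ≤ t) :
    ‖z‖ * ‖orbit z t‖ ≤ 2 := by
  rw [← norm_mul, mul_orbit]
  refine norm_exp_sub_one_le_two ?_
  rw [Complex.re_ofReal_mul]
  exact mul_nonpos_of_nonneg_of_nonpos ht hz

/-- The energy identity for `y' = z y + 1`. -/
theorem two_mul_re_integral_orbit (z : ℂ) (T : ℝ) :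
    2 * (∫ t in (0 : ℝ)..T, orbit z t).re =
      ‖orbit z T‖ ^ 2 + 2 * (-z.re) * ∫ t in (0 : ℝ)..T, ‖orbit z t‖ ^ 2 := by
  have hc := continuous_orbit z
  have h1 : ∀ t ∈ Set.uIcc 0 T, HasDerivAt (fun t => ‖orbit z t‖ ^ 2)
      (2 * (orbit z t).re + 2 * z.re * ‖orbit z t‖ ^ 2) t := by
    intro t _
    refine (hasDerivAt_orbit z t).norm_sq.congr_deriv ?_
    rw [show Complex.exp (t * z) = z * orbit z t + 1 by rw [mul_orbit]; ring]
    rw [Complex.inner, ← Complex.normSq_eq_norm_sq, Complex.normSq_apply]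
    simp
    ring
  have h2 : Continuous fun t => 2 * (orbit z t).re + 2 * z.re * ‖orbit z t‖ ^ 2 := by fun_prop
  have h3 := intervalIntegral.integral_eq_sub_of_hasDerivAt h1 (h2.intervalIntegrable _ _)
  have c1 : Continuous fun t => 2 * (orbit z t).re := by fun_prop
  have c2 : Continuous fun t => 2 * z.re * ‖orbit z t‖ ^ 2 := by fun_prop
  rw [intervalIntegral.integral_add (c1.intervalIntegrable _ _) (c2.intervalIntegrable _ _),
    intervalIntegral.integral_const_mul, intervalIntegral.integral_const_mul] at h3
  have h4 : (∫ t in (0 : ℝ)..T, orbit z t).re = ∫ t in (0 : ℝ)..T, (orbit z t).re :=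
    (Complex.reCLM.intervalIntegral_comp_comm (hc.intervalIntegrable _ _)).symm
  have h5 : orbit z 0 = 0 := by simp [orbit]
  rw [h5] at h3
  rw [h4]
  simp at h3
  linarith

/-- `∫_0^T ∫_0^T e^{|s - t| z} ds dt`, in the form which is visibly nonnegative for `Re z ≤ 0`. -/
noncomputable def varKernel (T : ℝ) (z : ℂ) : ℝ :=
  ‖orbit z T‖ ^ 2 + 2 * (-z.re) * ∫ t in (0 : ℝ)..T, ‖orbit z t‖ ^ 2

theorem integral_exp_abs_sub (z : ℂ) {T : ℝ} (hT : 0 ≤ T) :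
    ∫ s in Set.Ioc 0 T, ∫ t in Set.Ioc 0 T, Complex.exp ((|s - t| : ℝ) * z) =
      2 * ∫ t in (0 : ℝ)..T, orbit z t := by
  have h1 : ∀ s ∈ Set.Ioc 0 T, ∫ t in Set.Ioc 0 T, Complex.exp ((|s - t| : ℝ) * z) =
      orbit z s + orbit z (T - s) := by
    intro s hs
    have hc : Continuous fun t : ℝ => Complex.exp ((|s - t| : ℝ) * z) := by fun_prop
    rw [← intervalIntegral.integral_of_le hT, ← intervalIntegral.integral_add_adjacent_intervals
      (hc.intervalIntegrable 0 s) (hc.intervalIntegrable s T)]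
    congr 1
    · have : ∫ t in (0 : ℝ)..s, Complex.exp ((|s - t| : ℝ) * z) =
          ∫ t in (0 : ℝ)..s, Complex.exp ((s - t : ℝ) * z) := by
        refine intervalIntegral.integral_congr fun t ht => ?_
        rw [Set.uIcc_of_le hs.1.le] at ht
        simp only [abs_of_nonneg (sub_nonneg.2 ht.2)]
      rw [this, intervalIntegral.integral_comp_sub_left (fun u : ℝ => Complex.exp (u * z)) s]
      simp [orbit]
    · have : ∫ t in s..T, Complex.exp ((|s - t| : ℝ) * z) =
          ∫ t in s..T, Complex.exp ((t - s : ℝ) * z) := by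
        refine intervalIntegral.integral_congr fun t ht => ?_
        rw [Set.uIcc_of_le hs.2] at ht
        simp only [abs_sub_comm s t, abs_of_nonneg (sub_nonneg.2 ht.1)]
      rw [this, intervalIntegral.integral_comp_sub_right (fun u : ℝ => Complex.exp (u * z)) s]
      simp [orbit]
  have hc := continuous_orbit z
  rw [setIntegral_congr_fun measurableSet_Ioc h1, ← intervalIntegral.integral_of_le hT,
    intervalIntegral.integral_add (hc.intervalIntegrable _ _)
      ((by fun_prop : Continuous fun s => orbit z (T - s)).intervalIntegrable _ _),
    intervalIntegral.integral_comp_sub_left (orbit z) T]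
  simp only [sub_self, sub_zero]
  ring

theorem integral_re_exp_abs_sub (z : ℂ) {T : ℝ} (hT : 0 ≤ T) :
    ∫ p in Set.Ioc 0 T ×ˢ Set.Ioc 0 T, (Complex.exp ((|p.1 - p.2| : ℝ) * z)).re =
      varKernel T z := by
  have hc : Continuous fun p : ℝ × ℝ => Complex.exp ((|p.1 - p.2| : ℝ) * z) := by fun_prop
  have h1 : IntegrableOn (fun p : ℝ × ℝ => Complex.exp ((|p.1 - p.2| : ℝ) * z))
      (Set.Ioc 0 T ×ˢ Set.Ioc 0 T) :=
    (hc.continuousOn.integrableOn_compact (isCompact_Icc.prod isCompact_Icc)).mono_set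
      (Set.prod_mono Set.Ioc_subset_Icc_self Set.Ioc_subset_Icc_self)
  have h2 := Complex.reCLM.integral_comp_comm h1
  simp only [Complex.reCLM_apply] at h2
  rw [h2, Measure.volume_eq_prod, setIntegral_prod _ h1, integral_exp_abs_sub z hT, varKernel,
    ← two_mul_re_integral_orbit]
  simp

theorem integral_integral_re_exp {ν : Measure ℂ} [IsFiniteMeasure ν] (hν : ∀ᵐ z ∂ν, z.re ≤ 0)
    {T : ℝ} (hT : 0 ≤ T) :
    ∫ s in Set.Ioc 0 T, ∫ t in Set.Ioc 0 T, (∫ z, Complex.exp ((|s - t| : ℝ) * z) ∂ν).re =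
      ∫ z, varKernel T z ∂ν := by
  set m : Measure ℝ := volume.restrict (Set.Ioc 0 T) with hm
  have hc : Continuous fun q : (ℝ × ℝ) × ℂ => Complex.exp ((|q.1.1 - q.1.2| : ℝ) * q.2) := by
    fun_prop
  have h1 : Integrable (fun q : (ℝ × ℝ) × ℂ => Complex.exp ((|q.1.1 - q.1.2| : ℝ) * q.2))
      ((m.prod m).prod ν) := by
    refine Integrable.of_bound hc.aestronglyMeasurable 1 ?_
    have : ∀ᵐ q ∂((m.prod m).prod ν), q.2.re ≤ 0 :=
      Measure.quasiMeasurePreserving_snd.ae hν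
    filter_upwards [this] with q hq using norm_exp_mul_le hq (abs_nonneg _)
  have h2 : ∀ p : ℝ × ℝ, (∫ z, Complex.exp ((|p.1 - p.2| : ℝ) * z) ∂ν).re =
      ∫ z, (Complex.exp ((|p.1 - p.2| : ℝ) * z)).re ∂ν := by
    intro p
    have : Integrable (fun z => Complex.exp ((|p.1 - p.2| : ℝ) * z)) ν := by
      refine Integrable.of_bound (by fun_prop) 1 ?_
      filter_upwards [hν] with z hz using norm_exp_mul_le hz (abs_nonneg _)
    exact (Complex.reCLM.integral_comp_comm this).symm
  have h3 : Integrable (fun p : ℝ × ℝ => (∫ z, Complex.exp ((|p.1 - p.2| : ℝ) * z) ∂ν).re)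
      (m.prod m) := h1.integral_prod_left.re
  rw [← integral_prod (fun p : ℝ × ℝ => (∫ z, Complex.exp ((|p.1 - p.2| : ℝ) * z) ∂ν).re) h3]
  simp_rw [h2]
  rw [integral_integral_swap (f := fun (p : ℝ × ℝ) (z : ℂ) =>
    (Complex.exp ((|p.1 - p.2| : ℝ) * z)).re) h1.re]
  refine integral_congr_ae (Eventually.of_forall fun z => ?_)
  simp only
  rw [← integral_re_exp_abs_sub z hT, Measure.volume_eq_prod, ← Measure.prod_restrict]

/-! ### Splitting off the part of the variance which grows linearly -/

/-- The sector `0 ≤ -Re z ≤ |Im z|` around the imaginary axis. -/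
def imagSector : Set ℂ := {z | 0 ≤ -z.re ∧ -z.re ≤ |z.im|}

theorem measurableSet_imagSector : MeasurableSet imagSector := by
  have h1 : Measurable fun z : ℂ => -z.re := by fun_prop
  have h2 : Measurable fun z : ℂ => |z.im| := by fun_prop
  exact (measurableSet_le measurable_const h1).inter (measurableSet_le h1 h2)

/-- `∫_0^T e^{isb} ds` squared, that is `2 (1 - cos (b T)) / b²`. -/
noncomputable def fejerKernel (T b : ℝ) : ℝ := ‖orbit (b * Complex.I) T‖ ^ 2

/-- `-Re (1/z)`, nonnegative on the left half plane. -/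
noncomputable def negReInv (z : ℂ) : ℝ := -(1 / z).re

theorem negReInv_eq (z : ℂ) : negReInv z = -z.re / ‖z‖ ^ 2 := by
  rw [negReInv, one_div, Complex.inv_re, Complex.normSq_eq_norm_sq, neg_div]

theorem negReInv_nonneg {z : ℂ} (hz : z.re ≤ 0) : 0 ≤ negReInv z := by
  rw [negReInv_eq]
  exact div_nonneg (neg_nonneg.2 hz) (by positivity)

theorem measurable_negReInv : Measurable negReInv := by
  unfold negReInv
  fun_prop

theorem sq_norm_eq (z : ℂ) : ‖z‖ ^ 2 = z.re ^ 2 + z.im ^ 2 := by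
  rw [← Complex.normSq_eq_norm_sq, Complex.normSq_apply]; ring

theorem fejerKernel_nonneg (T b : ℝ) : 0 ≤ fejerKernel T b := by unfold fejerKernel; positivity

theorem continuous_fejerKernel_uncurry : Continuous fun p : ℝ × ℝ => fejerKernel p.1 p.2 := by
  have h : Continuous fun p : ℝ × ℝ => ((p.2 * Complex.I : ℂ), p.1) := by fun_prop
  have h2 : Continuous fun p : ℝ × ℝ => orbit (p.2 * Complex.I) p.1 :=
    continuous_orbit_uncurry.comp h
  exact h2.norm.pow 2

theorem continuous_fejerKernel (T : ℝ) : Continuous (fejerKernel T) :=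
  have h : Continuous fun b : ℝ => orbit (b * Complex.I) T :=
    (continuous_orbit_left T).comp (by fun_prop)
  h.norm.pow 2

theorem fejerKernel_eq {b : ℝ} (hb : b ≠ 0) (T : ℝ) :
    fejerKernel T b = 2 * (1 - Real.cos (b * T)) / b ^ 2 := by
  have h : (b * Complex.I : ℂ) ≠ 0 := mul_ne_zero (by exact_mod_cast hb) Complex.I_ne_zero
  rw [fejerKernel, orbit_eq h, norm_div, div_pow, norm_mul, Complex.norm_I, mul_one,
    Complex.norm_real, Real.norm_eq_abs, sq_abs]
  congr 1
  rw [show (T * (b * Complex.I) : ℂ) = ((b * T : ℝ) : ℂ) * Complex.I by push_cast; ring,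
    sq_norm_eq, Complex.sub_re, Complex.sub_im, Complex.exp_ofReal_mul_I_re,
    Complex.exp_ofReal_mul_I_im, Complex.one_re, Complex.one_im]
  nlinarith [Real.sin_sq_add_cos_sq (b * T)]

theorem fejerKernel_zero (T : ℝ) : fejerKernel T 0 = T ^ 2 := by
  simp [fejerKernel, orbit]

theorem fejerKernel_abs (T b : ℝ) : fejerKernel T |b| = fejerKernel T b := by
  by_cases hb : b = 0
  · simp [hb]
  · rw [fejerKernel_eq hb, fejerKernel_eq (abs_ne_zero.2 hb), sq_abs]
    congr 3
    rcases abs_choice b with h | h <;> rw [h]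
    rw [neg_mul, Real.cos_neg]

theorem fejerKernel_le_sq {T : ℝ} (hT : 0 ≤ T) (b : ℝ) : fejerKernel T b ≤ T ^ 2 := by
  unfold fejerKernel
  gcongr
  exact norm_orbit_le (by simp) hT

theorem abs_mul_norm_orbit_le (b : ℝ) {T : ℝ} (hT : 0 ≤ T) :
    |b| * ‖orbit (b * Complex.I) T‖ ≤ 2 := by
  have := norm_mul_norm_orbit_le (z := b * Complex.I) (by simp) hT
  rwa [norm_mul, Complex.norm_I, mul_one, Complex.norm_real, Real.norm_eq_abs] at this

/-- With w = i Im z, w times the difference of the two orbits equals e^{Tw}(e^{T Re z} - 1) - Re z ·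
`orbit z T`, and each term has norm at most -T Re z. -/
theorem norm_orbit_sub_le {z : ℂ} (hz : z.re ≤ 0) {T : ℝ} (hT : 0 ≤ T) :
    |z.im| * ‖orbit z T - orbit (z.im * Complex.I) T‖ ≤ 2 * (-z.re) * T := by
  set w : ℂ := z.im * Complex.I with hw
  have h1 : w * (orbit z T - orbit w T) =
      Complex.exp (T * w) * (Complex.exp ((T * z.re : ℝ) : ℂ) - 1) - z.re * orbit z T := by
    have e1 := mul_orbit z T
    have e2 := mul_orbit w T
    have e3 : z = z.re + w := (Complex.re_add_im z).symm
    have e4 : Complex.exp (T * z) = Complex.exp (T * w) * Complex.exp ((T * z.re : ℝ) : ℂ) := by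
      rw [← Complex.exp_add]
      congr 1
      nth_rw 1 [e3]
      push_cast
      ring
    rw [e4] at e1
    rw [mul_sub, e2]
    have e5 : z * orbit z T = z.re * orbit z T + w * orbit z T := by
      rw [← add_mul, ← e3]
    rw [e5] at e1
    linear_combination e1
  have h2 : |z.im| = ‖w‖ := by
    rw [hw, norm_mul, Complex.norm_I, mul_one, Complex.norm_real, Real.norm_eq_abs]
  rw [h2, ← norm_mul, h1]
  refine (norm_sub_le _ _).trans ?_
  have h3 : ‖Complex.exp (T * w)‖ ≤ 1 := norm_exp_mul_le (by simp [hw]) hT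
  have h4 : ‖Complex.exp ((T * z.re : ℝ) : ℂ) - 1‖ ≤ T * (-z.re) := by
    rw [← Complex.ofReal_exp, ← Complex.ofReal_one, ← Complex.ofReal_sub, Complex.norm_real,
      Real.norm_eq_abs, abs_sub_comm, abs_of_nonneg]
    · linarith [Real.add_one_le_exp (T * z.re)]
    · rw [sub_nonneg]
      exact Real.exp_le_one_iff.2 (mul_nonpos_of_nonneg_of_nonpos hT hz)
  have h5 := norm_orbit_le hz hT
  rw [norm_mul, norm_mul, Complex.norm_real, Real.norm_eq_abs, abs_of_nonpos hz]
  have h6 := mul_le_mul h3 h4 (norm_nonneg _) zero_le_one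
  have h7 := mul_le_mul_of_nonneg_left h5 (neg_nonneg.2 hz)
  linarith

/-- The difference between the boundary term of the variance kernel and its imaginary part. -/
noncomputable def boundaryDefect (T : ℝ) (z : ℂ) : ℝ :=
  ‖orbit z T‖ ^ 2 - imagSector.indicator (fun z => fejerKernel T z.im) z

/-- Inside the sector |z|² ≤ 2 |Im z|², and the difference of squares factors into a difference
bounded by `norm_orbit_sub_le` and a sum bounded by 4/|Im z|. Outside it |z| ≤ 2(-Re z), and |y|² ≤
T · 2/|z| suffices. At z = 0 both sides vanish. -/
theorem abs_boundaryDefect_le {z : ℂ} (hz : z.re ≤ 0) {T : ℝ} (hT : 0 ≤ T) :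
    |boundaryDefect T z| ≤ 16 * negReInv z * T := by
  have hr := neg_nonneg.2 hz
  rw [negReInv_eq, boundaryDefect]
  by_cases h0 : z = 0
  · subst h0
    have : (0 : ℂ) ∈ imagSector := by simp [imagSector]
    rw [Set.indicator_of_mem this]
    simp [fejerKernel]
  have hn : 0 < ‖z‖ := norm_pos_iff.2 h0
  have hy := norm_mul_norm_orbit_le hz hT
  rw [mul_div_assoc', div_mul_eq_mul_div, le_div_iff₀ (by positivity)]
  by_cases h : z ∈ imagSector
  · rw [Set.indicator_of_mem h]
    have hb := h.2
    have h1 := norm_orbit_sub_le hz hT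
    have h2 := abs_mul_norm_orbit_le z.im hT
    have h3 : ‖z‖ ^ 2 ≤ 2 * |z.im| ^ 2 := by
      rw [sq_norm_eq, sq_abs]
      nlinarith [sq_abs z.im]
    have h4 : |z.im| ≤ ‖z‖ := Complex.abs_im_le_norm z
    set p := ‖orbit z T‖
    set q := ‖orbit (z.im * Complex.I) T‖
    set d := ‖orbit z T - orbit (z.im * Complex.I) T‖
    have h5 : |p - q| ≤ d := abs_norm_sub_norm_le _ _
    have hp : 0 ≤ p := norm_nonneg _
    have hq : 0 ≤ q := norm_nonneg _
    have hd : 0 ≤ d := norm_nonneg _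
    have h6 : |p ^ 2 - q ^ 2| ≤ d * (p + q) := by
      rw [show p ^ 2 - q ^ 2 = (p - q) * (p + q) by ring, abs_mul, abs_of_nonneg (add_nonneg hp hq)]
      gcongr
    have h7 : |z.im| * p ≤ 2 := (mul_le_mul_of_nonneg_right h4 hp).trans hy
    calc |p ^ 2 - q ^ 2| * ‖z‖ ^ 2 ≤ (d * (p + q)) * (2 * |z.im| ^ 2) := by gcongr
      _ = 2 * ((|z.im| * d) * (|z.im| * p + |z.im| * q)) := by ring
      _ ≤ 2 * ((2 * -z.re * T) * (2 + 2)) := by gcongr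
      _ = 16 * -z.re * T := by ring
  · rw [Set.indicator_of_notMem h, sub_zero, abs_of_nonneg (by positivity)]
    have hb : |z.im| ≤ -z.re := by
      by_contra! hb
      exact h ⟨hr, hb.le⟩
    have h3 : ‖z‖ ≤ 2 * -z.re := by
      have := Complex.norm_le_abs_re_add_abs_im z
      rw [abs_of_nonpos hz] at this
      linarith
    have h5 := norm_orbit_le hz hT
    calc ‖orbit z T‖ ^ 2 * ‖z‖ ^ 2 = ‖orbit z T‖ * (‖z‖ * ‖orbit z T‖) * ‖z‖ := by ring
      _ ≤ T * 2 * (2 * -z.re) := by gcongr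
      _ ≤ 16 * -z.re * T := by nlinarith [mul_nonneg hr hT]

/-- For fixed z ≠ 0 both terms are bounded in T, since Im z ≠ 0 inside the sector. At z = 0 each may
grow like T², but they cancel exactly; this is why 0 belongs to the sector. -/
theorem tendsto_boundaryDefect_div {z : ℂ} (hz : z.re ≤ 0) :
    Tendsto (fun T => boundaryDefect T z / T) atTop (𝓝 0) := by
  by_cases h0 : z = 0
  · subst h0
    have : (0 : ℂ) ∈ imagSector := by simp [imagSector]
    refine tendsto_const_nhds.congr fun T => ?_
    rw [boundaryDefect, Set.indicator_of_mem this]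
    simp [fejerKernel]
  have hbd : ∃ C, ∀ T : ℝ, 0 ≤ T → |boundaryDefect T z| ≤ C := by
    refine ⟨(2 / ‖z‖) ^ 2 + (2 / |z.im|) ^ 2, fun T hT => ?_⟩
    have hn : 0 < ‖z‖ := norm_pos_iff.2 h0
    have h1 : ‖orbit z T‖ ≤ 2 / ‖z‖ := by
      rw [le_div_iff₀ hn, mul_comm]; exact norm_mul_norm_orbit_le hz hT
    have h2 : |imagSector.indicator (fun z => fejerKernel T z.im) z| ≤ (2 / |z.im|) ^ 2 := by
      by_cases h : z ∈ imagSector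
      · rw [Set.indicator_of_mem h, abs_of_nonneg (fejerKernel_nonneg _ _), fejerKernel]
        have him : 0 < |z.im| := by
          rw [abs_pos]
          intro him
          have e1 := h.2
          rw [him, abs_zero] at e1
          exact h0 (Complex.ext (by simp; linarith) (by simpa using him))
        have : ‖orbit (z.im * Complex.I) T‖ ≤ 2 / |z.im| := by
          rw [le_div_iff₀ him, mul_comm]; exact abs_mul_norm_orbit_le z.im hT
        gcongr
      · rw [Set.indicator_of_notMem h, abs_zero]; positivity
    rw [boundaryDefect]
    refine (abs_sub _ _).trans (add_le_add ?_ h2)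
    rw [abs_of_nonneg (by positivity)]
    gcongr
  obtain ⟨C, hC⟩ := hbd
  refine squeeze_zero_norm' ?_ (tendsto_const_nhds (x := C).div_atTop tendsto_id)
  filter_upwards [eventually_gt_atTop 0] with T hT
  rw [norm_div, Real.norm_eq_abs, Real.norm_eq_abs, abs_of_pos hT]
  exact div_le_div_of_nonneg_right (hC T hT.le) hT.le

/-- The integrand |e^{tz} - 1|²/|z|² approaches 1/|z|² exponentially fast, so the integral of the
error over [0, T] stays bounded. -/
theorem tendsto_mean_sq_orbit {z : ℂ} (hz : z.re < 0) :
    Tendsto (fun T : ℝ => (∫ t in (0 : ℝ)..T, ‖orbit z t‖ ^ 2) / T) atTop (𝓝 (1 / ‖z‖ ^ 2)) := by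
  have h0 : z ≠ 0 := fun h => by simp [h] at hz
  have hn : 0 < ‖z‖ := norm_pos_iff.2 h0
  set L := 1 / ‖z‖ ^ 2
  have hc : Continuous fun t => ‖orbit z t‖ ^ 2 := (continuous_orbit z).norm.pow 2
  have h1 : ∀ t : ℝ, 0 ≤ t → |‖orbit z t‖ ^ 2 - L| ≤ 3 * L * Real.exp (z.re * t) := by
    intro t ht
    have e1 : ‖orbit z t‖ = ‖Complex.exp (t * z) - 1‖ / ‖z‖ := by rw [orbit_eq h0, norm_div]
    have e2 : ‖Complex.exp (t * z)‖ = Real.exp (z.re * t) := by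
      rw [Complex.norm_exp, Complex.re_ofReal_mul, mul_comm]
    have e3 : ‖Complex.exp (t * z) - 1‖ ≤ 2 := by
      refine norm_exp_sub_one_le_two ?_
      rw [Complex.re_ofReal_mul]
      exact mul_nonpos_of_nonneg_of_nonpos ht hz.le
    set r := ‖Complex.exp (t * z) - 1‖
    have e4 : |r - 1| ≤ Real.exp (z.re * t) := by
      rw [← e2]
      have := abs_norm_sub_norm_le (1 - Complex.exp (t * z)) 1
      rwa [norm_one, norm_sub_rev, sub_sub_cancel_left, norm_neg] at this
    have e5 : (r / ‖z‖) ^ 2 - L = L * ((r - 1) * (r + 1)) := by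
      simp only [L]; field_simp; ring
    have hr : 0 ≤ r := norm_nonneg _
    have hL : 0 ≤ L := by positivity
    rw [e1, e5, abs_mul, abs_mul, abs_of_nonneg hL, abs_of_nonneg (by linarith : 0 ≤ r + 1)]
    calc L * (|r - 1| * (r + 1)) ≤ L * (Real.exp (z.re * t) * 3) := by gcongr; linarith
      _ = _ := by ring
  have h2 : ∀ T : ℝ, 0 ≤ T → ∫ t in (0 : ℝ)..T, Real.exp (z.re * t) ≤ 1 / (-z.re) := by
    intro T hT
    rw [intervalIntegral.integral_comp_mul_left (fun x => Real.exp x) hz.ne, integral_exp,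
      smul_eq_mul, mul_zero, Real.exp_zero, ← neg_mul_neg, neg_sub, ← inv_neg, ← div_eq_inv_mul]
    refine div_le_div_of_nonneg_right ?_ (by linarith)
    linarith [Real.exp_pos (z.re * T)]
  rw [tendsto_iff_norm_sub_tendsto_zero]
  have hlim : Tendsto (fun T : ℝ => 3 * L * (1 / (-z.re)) / T) atTop (𝓝 0) :=
    tendsto_const_nhds.div_atTop tendsto_id
  refine squeeze_zero' (Eventually.of_forall fun _ => norm_nonneg _) ?_ hlim
  filter_upwards [eventually_gt_atTop 0] with T hT
  have e1 : (∫ t in (0 : ℝ)..T, ‖orbit z t‖ ^ 2) / T - L =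
      (∫ t in (0 : ℝ)..T, (‖orbit z t‖ ^ 2 - L)) / T := by
    rw [intervalIntegral.integral_sub (hc.intervalIntegrable _ _)
      (continuous_const.intervalIntegrable _ _), intervalIntegral.integral_const, smul_eq_mul,
      sub_zero]
    field_simp
  rw [e1, norm_div, Real.norm_of_nonneg hT.le]
  refine div_le_div_of_nonneg_right ?_ hT.le
  have hce : Continuous fun t => Real.exp (z.re * t) := by fun_prop
  refine (intervalIntegral.norm_integral_le_of_norm_le hT.le (Eventually.of_forall fun t ht =>
    h1 t ht.1.le) ((hce.const_mul _).intervalIntegrable _ _)).trans ?_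
  rw [intervalIntegral.integral_const_mul]
  gcongr
  exact h2 T hT.le

/-- The dissipative part of the variance kernel. -/
noncomputable def dissipation (T : ℝ) (z : ℂ) : ℝ :=
  2 * (-z.re) * ∫ t in (0 : ℝ)..T, ‖orbit z t‖ ^ 2

theorem varKernel_eq (T : ℝ) (z : ℂ) : varKernel T z = ‖orbit z T‖ ^ 2 + dissipation T z := rfl

theorem dissipation_nonneg {z : ℂ} (hz : z.re ≤ 0) {T : ℝ} (hT : 0 ≤ T) : 0 ≤ dissipation T z := by
  unfold dissipation
  have h1 : 0 ≤ ∫ t in (0 : ℝ)..T, ‖orbit z t‖ ^ 2 :=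
    intervalIntegral.integral_nonneg hT fun t _ => by positivity
  have h2 := neg_nonneg.2 hz
  positivity

theorem continuous_dissipation (T : ℝ) : Continuous (dissipation T) := by
  unfold dissipation
  have h1 : Continuous fun p : ℂ × ℝ => ‖orbit p.1 p.2‖ ^ 2 := continuous_orbit_uncurry.norm.pow 2
  have h : Continuous fun z => ∫ t in (0 : ℝ)..T, ‖orbit z t‖ ^ 2 :=
    intervalIntegral.continuous_parametric_intervalIntegral_of_continuous' h1 0 T
  fun_prop

theorem tendsto_dissipation_div {z : ℂ} (hz : z.re ≤ 0) :
    Tendsto (fun T => dissipation T z / T) atTop (𝓝 (2 * negReInv z)) := by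
  rcases hz.eq_or_lt with h | h
  · simp [dissipation, negReInv_eq, h]
  · have := (tendsto_mean_sq_orbit h).const_mul (2 * (-z.re))
    rw [negReInv_eq]
    refine (this.congr fun T => ?_).trans_eq ?_
    · rw [dissipation, mul_div_assoc]
    · congr 1; ring

theorem dissipation_le {z : ℂ} (hz : z.re ≤ 0) {T : ℝ} (hT : 0 ≤ T) :
    dissipation T z ≤ 8 * negReInv z * T := by
  by_cases h0 : z = 0
  · simp [h0, dissipation, negReInv]
  have hn : 0 < ‖z‖ := norm_pos_iff.2 h0
  have h1 : ∫ t in (0 : ℝ)..T, ‖orbit z t‖ ^ 2 ≤ ∫ t in (0 : ℝ)..T, (2 / ‖z‖) ^ 2 := by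
    refine intervalIntegral.integral_mono_on hT
      (((continuous_orbit z).norm.pow 2).intervalIntegrable _ _)
      (continuous_const.intervalIntegrable _ _) fun t ht => ?_
    gcongr
    rw [le_div_iff₀ hn, mul_comm]
    exact norm_mul_norm_orbit_le hz ht.1
  rw [intervalIntegral.integral_const, smul_eq_mul, sub_zero] at h1
  have h2 := neg_nonneg.2 hz
  calc dissipation T z ≤ 2 * (-z.re) * (T * (2 / ‖z‖) ^ 2) := by unfold dissipation; gcongr
    _ = 8 * negReInv z * T := by rw [negReInv_eq]; field_simp; ring

/-! ### Integration against ν: finiteness of ς² and reduction to the Fejér kernel -/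

section

variable {ν : Measure ℂ}

theorem varsigmaSq_eq (hν : ∀ᵐ z ∂ν, z.re ≤ 0) :
    varsigmaSq ν = ∫⁻ z, ENNReal.ofReal (2 * negReInv z) ∂ν := by
  rw [varsigmaSq, Measure.restrict_eq_self_of_ae_mem (s := {z : ℂ | z.re ≤ 0}) hν]
  refine lintegral_congr fun z => ?_
  rw [negReInv]
  congr 1
  ring

theorem integrable_negReInv (hν : ∀ᵐ z ∂ν, z.re ≤ 0) (h : varsigmaSq ν < ∞) :
    Integrable (fun z => 2 * negReInv z) ν := by
  refine ⟨(measurable_negReInv.const_mul 2).aestronglyMeasurable, ?_⟩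
  rw [hasFiniteIntegral_iff_ofReal]
  · rwa [← varsigmaSq_eq hν]
  · filter_upwards [hν] with z hz
    have := negReInv_nonneg hz
    simp only [Pi.zero_apply]
    linarith

theorem integral_negReInv (hν : ∀ᵐ z ∂ν, z.re ≤ 0) :
    ∫ z, 2 * negReInv z ∂ν = (varsigmaSq ν).toReal := by
  rw [varsigmaSq_eq hν, integral_eq_lintegral_of_nonneg_ae]
  · filter_upwards [hν] with z hz
    have := negReInv_nonneg hz
    simp only [Pi.zero_apply]
    linarith
  · exact (measurable_negReInv.const_mul 2).aestronglyMeasurable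

theorem continuous_varKernel (T : ℝ) : Continuous (varKernel T) :=
  ((continuous_orbit_left T).norm.pow 2).add (continuous_dissipation T)

/-- The distribution of `|Im z|` on the sector around the imaginary axis. -/
noncomputable def sectorMeasure (ν : Measure ℂ) : Measure ℝ :=
  (ν.restrict imagSector).map fun z => |z.im|

theorem sectorMeasure_Iic (x : ℝ) : (sectorMeasure ν).real (Set.Iic x) = ν.real (U x) := by
  have hm : Measurable fun z : ℂ => |z.im| := by fun_prop
  rw [measureReal_def, measureReal_def, sectorMeasure, Measure.map_apply hm measurableSet_Iic,
    Measure.restrict_apply (hm measurableSet_Iic)]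
  congr 2
  ext z
  simp only [U, imagSector, Set.mem_inter_iff, Set.mem_preimage, Set.mem_Iic, Set.mem_ofPred_eq]
  tauto

theorem sectorMeasure_Iio_zero : sectorMeasure ν (Set.Iio 0) = 0 := by
  have hm : Measurable fun z : ℂ => |z.im| := by fun_prop
  rw [sectorMeasure, Measure.map_apply hm measurableSet_Iio]
  convert measure_empty (μ := ν.restrict imagSector)
  ext z
  simp

variable [IsFiniteMeasure ν]

instance : IsFiniteMeasure (sectorMeasure ν) := by
  unfold sectorMeasure; infer_instance

omit [IsFiniteMeasure ν] in
theorem integral_fejerKernel_sectorMeasure (T : ℝ) :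
    ∫ b, fejerKernel T b ∂(sectorMeasure ν) =
      ∫ z, imagSector.indicator (fun z => fejerKernel T z.im) z ∂ν := by
  have hm : Measurable fun z : ℂ => |z.im| := by fun_prop
  rw [sectorMeasure, integral_map hm.aemeasurable (continuous_fejerKernel T).aestronglyMeasurable,
    integral_indicator measurableSet_imagSector]
  simp_rw [fejerKernel_abs]

/-- The double integral form bounds the kernel by T² without assuming ς² < ∞, which the dissipative
form alone would not give. -/
theorem integrable_varKernel (hν : ∀ᵐ z ∂ν, z.re ≤ 0) {T : ℝ} (hT : 0 ≤ T) :
    Integrable (varKernel T) ν := by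
  have h : ∀ z, varKernel T z =
      ∫ p in Set.Ioc 0 T ×ˢ Set.Ioc 0 T, (Complex.exp ((|p.1 - p.2| : ℝ) * z)).re :=
    fun z => (integral_re_exp_abs_sub z hT).symm
  refine Integrable.of_bound (continuous_varKernel T).aestronglyMeasurable
    (volume.real (Set.Ioc (0 : ℝ) T ×ˢ Set.Ioc (0 : ℝ) T)) ?_
  filter_upwards [hν] with z hz
  rw [h]
  have := norm_setIntegral_le_of_norm_le_const (μ := (volume : Measure (ℝ × ℝ)))
    (s := Set.Ioc (0 : ℝ) T ×ˢ Set.Ioc (0 : ℝ) T)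
    (f := fun p : ℝ × ℝ => (Complex.exp ((|p.1 - p.2| : ℝ) * z)).re) (C := 1)
    ((measure_mono (Set.prod_mono Set.Ioc_subset_Icc_self Set.Ioc_subset_Icc_self)).trans_lt
      (isCompact_Icc.prod isCompact_Icc).measure_lt_top)
    (fun p _ => (Complex.abs_re_le_norm _).trans (norm_exp_mul_le hz (abs_nonneg _)))
  rwa [one_mul] at this

/-- The dissipative part is at most the whole kernel, so its normalised integrals stay bounded along
integer times; Fatou's lemma passes to the pointwise limit -2 Re(1/z). -/
theorem varsigmaSq_lt_top_of_tendsto (hν : ∀ᵐ z ∂ν, z.re ≤ 0) {L : ℝ}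
    (h : Tendsto (fun T => (∫ z, varKernel T z ∂ν) / T) atTop (𝓝 L)) : varsigmaSq ν < ∞ := by
  rw [varsigmaSq_eq hν]
  have h1 : ∫⁻ z, ENNReal.ofReal (2 * negReInv z) ∂ν ≤
      liminf (fun n : ℕ => ∫⁻ z, ENNReal.ofReal (dissipation n z / n) ∂ν) atTop := by
    refine le_trans (le_of_eq ?_) (lintegral_liminf_le fun n => ?_)
    · refine lintegral_congr_ae ?_
      filter_upwards [hν] with z hz
      have := (tendsto_dissipation_div hz).comp tendsto_natCast_atTop_atTop
      exact ((ENNReal.continuous_ofReal.tendsto _).comp this).liminf_eq.symm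
    · exact ENNReal.measurable_ofReal.comp ((continuous_dissipation n).measurable.div_const _)
  have h2 : ∀ᶠ n : ℕ in atTop, ∫⁻ z, ENNReal.ofReal (dissipation n z / n) ∂ν ≤
      ENNReal.ofReal (L + 1) := by
    have h3 := (h.comp tendsto_natCast_atTop_atTop).eventually (gt_mem_nhds (lt_add_one L))
    filter_upwards [h3] with n hn
    have hn0 : (0 : ℝ) ≤ n := n.cast_nonneg
    have hint := (integrable_varKernel hν hn0).div_const (n : ℝ)
    calc ∫⁻ z, ENNReal.ofReal (dissipation n z / n) ∂ν
        ≤ ∫⁻ z, ENNReal.ofReal (varKernel n z / n) ∂ν := by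
          refine lintegral_mono fun z => ENNReal.ofReal_le_ofReal ?_
          refine div_le_div_of_nonneg_right ?_ hn0
          rw [varKernel_eq]
          linarith [sq_nonneg ‖orbit z n‖]
      _ = ENNReal.ofReal (∫ z, varKernel n z / n ∂ν) := by
          rw [ofReal_integral_eq_lintegral_ofReal hint]
          filter_upwards [hν] with z hz
          rw [varKernel_eq]
          have := dissipation_nonneg hz hn0
          simp only [Pi.zero_apply]
          positivity
      _ ≤ ENNReal.ofReal (L + 1) := by
          rw [integral_div]
          exact ENNReal.ofReal_le_ofReal hn.le
  refine h1.trans_lt ((liminf_le_of_frequently_le' h2.frequently).trans_lt ENNReal.ofReal_lt_top)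

/-- Two dominated convergences with multiples of -Re(1/z) as majorants: the dissipation contributes
ς² and the boundary defect contributes 0. -/
theorem tendsto_variance_sub (hν : ∀ᵐ z ∂ν, z.re ≤ 0) (h : varsigmaSq ν < ∞) :
    Tendsto (fun T => (∫ z, varKernel T z ∂ν) / T -
      (∫ b, fejerKernel T b ∂(sectorMeasure ν)) / T) atTop (𝓝 (varsigmaSq ν).toReal) := by
  have hint := integrable_negReInv hν h
  have hmb : ∀ T, Measurable (boundaryDefect T) := fun T =>
    ((continuous_orbit_left T).norm.pow 2).measurable.sub
      (((continuous_fejerKernel T).comp Complex.continuous_im).measurable.indicator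
        measurableSet_imagSector)
  have h1 : Tendsto (fun T => ∫ z, dissipation T z / T ∂ν) atTop (𝓝 (∫ z, 2 * negReInv z ∂ν)) := by
    refine tendsto_integral_filter_of_dominated_convergence (fun z => 4 * (2 * negReInv z))
      (Eventually.of_forall fun T => ((continuous_dissipation T).div_const T).aestronglyMeasurable)
      ?_ (hint.const_mul 4) ?_
    · filter_upwards [eventually_gt_atTop 0] with T hT
      filter_upwards [hν] with z hz
      rw [norm_div, Real.norm_of_nonneg hT.le, Real.norm_of_nonneg (dissipation_nonneg hz hT.le),
        div_le_iff₀ hT]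
      linarith [dissipation_le hz hT.le]
    · filter_upwards [hν] with z hz using tendsto_dissipation_div hz
  have h2 : Tendsto (fun T => ∫ z, boundaryDefect T z / T ∂ν) atTop (𝓝 (∫ _, (0 : ℝ) ∂ν)) := by
    refine tendsto_integral_filter_of_dominated_convergence (fun z => 8 * (2 * negReInv z))
      (Eventually.of_forall fun T => ((hmb T).div_const T).aestronglyMeasurable)
      ?_ (hint.const_mul 8) ?_
    · filter_upwards [eventually_gt_atTop 0] with T hT
      filter_upwards [hν] with z hz
      rw [norm_div, Real.norm_of_nonneg hT.le, Real.norm_eq_abs, div_le_iff₀ hT]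
      linarith [abs_boundaryDefect_le hz hT.le]
    · filter_upwards [hν] with z hz using tendsto_boundaryDefect_div hz
  have h3 := h1.add h2
  rw [integral_zero, add_zero, integral_negReInv hν] at h3
  refine h3.congr' ?_
  filter_upwards [eventually_gt_atTop 0] with T hT
  have i1 : Integrable (dissipation T) ν := by
    refine (hint.const_mul (4 * T)).mono' (continuous_dissipation T).aestronglyMeasurable ?_
    filter_upwards [hν] with z hz
    rw [Real.norm_of_nonneg (dissipation_nonneg hz hT.le)]
    linarith [dissipation_le hz hT.le]
  have i2 : Integrable (boundaryDefect T) ν := by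
    refine (hint.const_mul (8 * T)).mono' (hmb T).aestronglyMeasurable ?_
    filter_upwards [hν] with z hz
    rw [Real.norm_eq_abs]
    linarith [abs_boundaryDefect_le hz hT.le]
  rw [integral_div, integral_div, ← add_div, ← sub_div, ← integral_add i1 i2,
    integral_fejerKernel_sectorMeasure, ← integral_sub (integrable_varKernel hν hT.le)]
  · congr 2
    ext z
    rw [varKernel_eq, boundaryDefect]
    ring
  · have := (integrable_varKernel hν hT.le).sub (i1.add i2)
    refine this.congr (Eventually.of_forall fun z => ?_)
    simp only [Pi.sub_apply, Pi.add_apply, varKernel_eq, boundaryDefect]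
    ring

end

/-! ### The measures `d(u^β)` on the half line, Gaussian integrals and tails -/

/-- The measure on `(0, ∞)` with distribution function `u ^ β`. -/
noncomputable def powerMeasure (β : ℝ) : Measure ℝ :=
  (volume.restrict (Set.Ioi 0)).withDensity fun u => ENNReal.ofReal (β * u ^ (β - 1))

instance (β : ℝ) : SigmaFinite (powerMeasure β) := by
  unfold powerMeasure
  infer_instance

theorem measurable_powerDensity (β : ℝ) : Measurable fun u : ℝ => β * u ^ (β - 1) := by
  fun_prop

theorem powerMeasure_Iio_zero (β : ℝ) : powerMeasure β (Set.Iio 0) = 0 := by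
  rw [powerMeasure, withDensity_apply _ measurableSet_Iio,
      Measure.restrict_restrict measurableSet_Iio]
  have : Set.Iio (0 : ℝ) ∩ Set.Ioi 0 = ∅ := by
    ext x
    simp only [Set.mem_inter_iff, Set.mem_Iio, Set.mem_Ioi, Set.mem_empty_iff_false, iff_false]
    intro h
    linarith [h.1, h.2]
  simp [this]

theorem powerMeasure_Iic {β : ℝ} (hβ : 0 < β) {x : ℝ} (hx : 0 ≤ x) :
    powerMeasure β (Set.Iic x) = ENNReal.ofReal (x ^ β) := by
  rw [powerMeasure, withDensity_apply _ measurableSet_Iic,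
      Measure.restrict_restrict measurableSet_Iic,
    Set.inter_comm, Set.Ioi_inter_Iic]
  have h1 : IntervalIntegrable (fun u : ℝ => β * u ^ (β - 1)) volume 0 x :=
    (intervalIntegral.intervalIntegrable_rpow' (by linarith)).const_mul β
  rw [← ofReal_integral_eq_lintegral_ofReal
    ((intervalIntegrable_iff_integrableOn_Ioc_of_le hx).1 h1)]
  · rw [← intervalIntegral.integral_of_le hx, intervalIntegral.integral_const_mul,
      integral_rpow (Or.inl (by linarith)), sub_add_cancel, Real.zero_rpow hβ.ne', sub_zero,
      mul_div_cancel₀ _ hβ.ne']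
  · filter_upwards [ae_restrict_mem measurableSet_Ioc] with u hu
    have : (0 : ℝ) ≤ u := hu.1.le
    simp only [Pi.zero_apply]
    positivity

theorem integral_powerMeasure {β : ℝ} (hβ : 0 < β) (f : ℝ → ℝ) :
    ∫ u, f u ∂(powerMeasure β) = ∫ u in Set.Ioi 0, β * u ^ (β - 1) * f u := by
  rw [powerMeasure, integral_withDensity_eq_integral_toReal_smul
    (measurable_powerDensity β).ennreal_ofReal
    (Eventually.of_forall fun _ => ENNReal.ofReal_lt_top)]
  refine setIntegral_congr_fun measurableSet_Ioi fun u hu => ?_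
  have : (0 : ℝ) < u := hu
  rw [ENNReal.toReal_ofReal (by positivity), smul_eq_mul]

/-- The Gaussian `e^{-u²/2}`. -/
noncomputable def gauss (u : ℝ) : ℝ := Real.exp (-(u ^ 2 / 2))

theorem continuous_gauss : Continuous gauss := by unfold gauss; fun_prop

theorem gauss_pos (u : ℝ) : 0 < gauss u := Real.exp_pos _

theorem gauss_le_one (u : ℝ) : gauss u ≤ 1 := Real.exp_le_one_iff.2 (by linarith [sq_nonneg u])

/-- `∫ e^{-u²/2} d(u^β)`. -/
noncomputable def gaussMoment (β : ℝ) : ℝ := ∫ u, gauss u ∂(powerMeasure β)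

theorem integral_gauss_mul_powerMeasure {β : ℝ} (hβ : 0 < β) {s : ℝ} (hs : 0 < s) :
    ∫ u, gauss (s * u) ∂(powerMeasure β) =
      s ^ (-β) * (β * ((1 / 2 : ℝ) ^ (-β / 2) * (1 / 2) * Real.Gamma (β / 2))) := by
  rw [integral_powerMeasure hβ]
  have h := integral_rpow_mul_exp_neg_mul_rpow (p := 2) (q := β - 1) (b := s ^ 2 / 2) (by norm_num)
    (by linarith) (by positivity)
  have h2 : ∫ u in Set.Ioi (0 : ℝ), β * u ^ (β - 1) * gauss (s * u) =
      β * ∫ u in Set.Ioi (0 : ℝ), u ^ (β - 1) * Real.exp (-(s ^ 2 / 2) * u ^ (2 : ℝ)) := by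
    rw [← integral_const_mul]
    refine setIntegral_congr_fun measurableSet_Ioi fun u _ => ?_
    simp only [gauss, Real.rpow_two]
    rw [mul_assoc]
    congr 3
    ring
  rw [h2, h, sub_add_cancel, show s ^ 2 / 2 = s ^ 2 * (1 / 2) by ring,
    Real.mul_rpow (by positivity) (by norm_num), ← Real.rpow_natCast s 2, ← Real.rpow_mul hs.le,
    show ((2 : ℕ) : ℝ) * (-β / 2) = -β by push_cast; ring]
  ring

theorem gaussMoment_eq {β : ℝ} (hβ : 0 < β) :
    gaussMoment β = β * ((1 / 2 : ℝ) ^ (-β / 2) * (1 / 2) * Real.Gamma (β / 2)) := by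
  have := integral_gauss_mul_powerMeasure hβ one_pos
  simpa [gaussMoment] using this

theorem gaussMoment_pos {β : ℝ} (hβ : 0 < β) : 0 < gaussMoment β := by
  rw [gaussMoment_eq hβ]
  have := Real.Gamma_pos_of_pos (half_pos hβ)
  positivity

/-- Otherwise the Bochner integral would take its default value 0, whereas the explicit moment is
positive. -/
theorem integrable_gauss_powerMeasure {β : ℝ} (hβ : 0 < β) : Integrable gauss (powerMeasure β) :=
  by_contra fun h => (gaussMoment_pos hβ).ne' (integral_undef h)

/-- Tonelli for functions given by a density on the right. -/
theorem lintegral_lintegral_Ici (G : Measure ℝ) [SFinite G] {κ : ℝ → ℝ≥0∞} (hκ : Measurable κ) :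
    ∫⁻ b, (∫⁻ u in Set.Ici b, κ u) ∂G = ∫⁻ u, κ u * G (Set.Iic u) := by
  have hm : MeasurableSet {p : ℝ × ℝ | p.1 ≤ p.2} := measurableSet_le measurable_fst measurable_snd
  have h1 : ∀ b, ∫⁻ u in Set.Ici b, κ u =
      ∫⁻ u, {p : ℝ × ℝ | p.1 ≤ p.2}.indicator (fun p => κ p.2) (b, u) := fun b => by
    rw [← lintegral_indicator measurableSet_Ici]
    rfl
  simp_rw [h1]
  rw [lintegral_lintegral_swap]
  · refine lintegral_congr fun u => ?_
    have h2 : ∀ b, {p : ℝ × ℝ | p.1 ≤ p.2}.indicator (fun p => κ p.2) (b, u) =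
        (Set.Iic u).indicator (fun _ => κ u) b := fun b => rfl
    simp_rw [h2]
    rw [lintegral_indicator_const measurableSet_Iic]
  · exact ((hκ.comp measurable_snd).indicator hm).aemeasurable

/-- Integration by parts in Tonelli form: gauss b = ∫_b^∞ u gauss(u) du, and exchanging the
integrals brings in the distribution function. -/
theorem integral_gauss_eq (G : Measure ℝ) [SFinite G] (hG : G (Set.Iio 0) = 0)
    (hfin : ∀ u, G (Set.Iic u) ≠ ∞) :
    ∫ b, gauss b ∂G = ∫ u in Set.Ioi 0, u * gauss u * G.real (Set.Iic u) := by
  have hderiv : ∀ u : ℝ, HasDerivAt (fun u => -gauss u) (u * gauss u) u := fun u => by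
    have h1 : HasDerivAt (fun u : ℝ => -(u ^ 2 / 2)) (-u) u :=
      (((hasDerivAt_pow 2 u).div_const 2).neg).congr_deriv (by simp)
    exact h1.exp.neg.congr_deriv (by simp only [gauss]; ring)
  have hlim : Tendsto (fun u => -gauss u) atTop (𝓝 0) := by
    have h1 : Tendsto (fun u : ℝ => -(u ^ 2 / 2)) atTop atBot :=
      tendsto_neg_atTop_atBot.comp ((tendsto_pow_atTop two_ne_zero).atTop_div_const two_pos)
    have h2 := (Real.tendsto_exp_atBot.comp h1).neg
    rwa [neg_zero] at h2
  have h1 : ∀ b : ℝ, 0 ≤ b → ∫⁻ u in Set.Ici b, (Set.Ioi (0 : ℝ)).indicator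
      (fun u => ENNReal.ofReal (u * gauss u)) u = ENNReal.ofReal (gauss b) := by
    intro b hb
    have e1 : ∫⁻ u in Set.Ici b, (Set.Ioi (0 : ℝ)).indicator
        (fun u => ENNReal.ofReal (u * gauss u)) u =
        ∫⁻ u in Set.Ioi b, ENNReal.ofReal (u * gauss u) := by
      rw [setLIntegral_congr Ioi_ae_eq_Ici.symm]
      refine setLIntegral_congr_fun measurableSet_Ioi fun u hu => ?_
      exact Set.indicator_of_mem (s := Set.Ioi (0 : ℝ)) (hb.trans_lt hu) _
    have e2 := integrableOn_Ioi_deriv_of_nonneg' (fun u _ => hderiv u)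
      (fun u (hu : u ∈ Set.Ioi b) => mul_nonneg (hb.trans hu.le) (gauss_pos u).le) hlim
    have e3 := integral_Ioi_of_hasDerivAt_of_nonneg' (a := b) (fun u _ => hderiv u)
      (fun u (hu : u ∈ Set.Ioi b) => mul_nonneg (hb.trans hu.le) (gauss_pos u).le) hlim
    rw [e1, ← ofReal_integral_eq_lintegral_ofReal e2, e3]
    · simp
    · filter_upwards [ae_restrict_mem measurableSet_Ioi] with u hu
      exact mul_nonneg (hb.trans (le_of_lt hu)) (gauss_pos u).le
  have hmeas : Measurable fun u : ℝ => ENNReal.ofReal (u * gauss u) :=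
    (measurable_id.mul continuous_gauss.measurable).ennreal_ofReal
  have h2 := lintegral_lintegral_Ici G (hmeas.indicator (measurableSet_Ioi (a := (0 : ℝ))))
  have h3 : ∀ᵐ b ∂G, 0 ≤ b := by
    rw [ae_iff]
    convert hG using 2
    ext; simp
  have h4 : ∫⁻ b, ENNReal.ofReal (gauss b) ∂G =
      ∫⁻ u in Set.Ioi 0, ENNReal.ofReal (u * gauss u * G.real (Set.Iic u)) := by
    rw [← lintegral_congr_ae (h3.mono fun b hb => h1 b hb), h2,
        ← lintegral_indicator measurableSet_Ioi]
    refine lintegral_congr fun u => ?_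
    by_cases hu : u ∈ Set.Ioi (0 : ℝ)
    · rw [Set.indicator_of_mem hu, Set.indicator_of_mem hu, ENNReal.ofReal_mul
        (mul_nonneg (le_of_lt hu) (gauss_pos u).le), measureReal_def,
        ENNReal.ofReal_toReal (hfin u)]
    · rw [Set.indicator_of_notMem hu, Set.indicator_of_notMem hu, zero_mul]
  have hmono : Measurable fun u => G.real (Set.Iic u) :=
    ENNReal.measurable_toReal.comp
      (Monotone.measurable fun u v huv => measure_mono (Set.Iic_subset_Iic.2 huv))
  rw [integral_eq_lintegral_of_nonneg_ae (Eventually.of_forall fun b => (gauss_pos b).le)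
    continuous_gauss.aestronglyMeasurable, h4, integral_eq_lintegral_of_nonneg_ae]
  · filter_upwards [ae_restrict_mem measurableSet_Ioi] with u hu
    exact mul_nonneg (mul_nonneg (le_of_lt hu) (gauss_pos u).le) measureReal_nonneg
  · exact ((measurable_id.mul continuous_gauss.measurable).mul hmono).aestronglyMeasurable

/-- Tails of `u⁻²` against a measure whose distribution function grows more slowly than
`u ^ (3/2)`. -/
theorem setLIntegral_inv_sq_le (G : Measure ℝ) [SFinite G] {A M : ℝ} (hM : 0 < M) (hA : 0 ≤ A)
    (hG : ∀ u, M ≤ u → G (Set.Iic u) ≤ ENNReal.ofReal (A * u ^ (3 / 2 : ℝ))) :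
    ∫⁻ b in Set.Ici M, ENNReal.ofReal (1 / b ^ 2) ∂G ≤
      ENNReal.ofReal (4 * A * M ^ (-(1 / 2) : ℝ)) := by
  -- Since 1/b² = ∫_b^∞ 2u⁻³ du, Tonelli leaves at most ∫_M^∞ 2A u^{-3/2} du = 4A M^{-1/2}.
  have hκ : Measurable fun u : ℝ => ENNReal.ofReal (2 * u ^ (-3 : ℝ)) := by fun_prop
  have h1 : ∀ b : ℝ, M ≤ b → ∫⁻ u in Set.Ici b, (Set.Ici M).indicator
      (fun u => ENNReal.ofReal (2 * u ^ (-3 : ℝ))) u = ENNReal.ofReal (1 / b ^ 2) := by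
    intro b hb
    have hb0 : 0 < b := hM.trans_le hb
    have e1 : ∫⁻ u in Set.Ici b, (Set.Ici M).indicator
        (fun u => ENNReal.ofReal (2 * u ^ (-3 : ℝ))) u =
        ∫⁻ u in Set.Ioi b, ENNReal.ofReal (2 * u ^ (-3 : ℝ)) := by
      rw [setLIntegral_congr Ioi_ae_eq_Ici.symm]
      refine setLIntegral_congr_fun measurableSet_Ioi fun u hu => ?_
      exact Set.indicator_of_mem (s := Set.Ici M) (hb.trans (le_of_lt hu)) _
    rw [e1, ← ofReal_integral_eq_lintegral_ofReal
      ((integrableOn_Ioi_rpow_of_lt (by norm_num) hb0).const_mul 2), integral_const_mul,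
      integral_Ioi_rpow_of_lt (by norm_num) hb0]
    · congr 1
      rw [show (-3 : ℝ) + 1 = -(2 : ℕ) by norm_num, Real.rpow_neg hb0.le, Real.rpow_natCast]
      push_cast
      ring
    · filter_upwards [ae_restrict_mem measurableSet_Ioi] with u hu
      have : 0 < u := hb0.trans hu
      simp only [Pi.zero_apply]
      positivity
  have h2 := lintegral_lintegral_Ici G (hκ.indicator (measurableSet_Ici (a := M)))
  calc ∫⁻ b in Set.Ici M, ENNReal.ofReal (1 / b ^ 2) ∂G
      = ∫⁻ b in Set.Ici M, (∫⁻ u in Set.Ici b, (Set.Ici M).indicator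
          (fun u => ENNReal.ofReal (2 * u ^ (-3 : ℝ))) u) ∂G :=
        (setLIntegral_congr_fun measurableSet_Ici fun b hb => h1 b hb).symm
    _ ≤ ∫⁻ b, (∫⁻ u in Set.Ici b, (Set.Ici M).indicator
          (fun u => ENNReal.ofReal (2 * u ^ (-3 : ℝ))) u) ∂G := setLIntegral_le_lintegral _ _
    _ = ∫⁻ u in Set.Ici M, ENNReal.ofReal (2 * u ^ (-3 : ℝ)) * G (Set.Iic u) := by
        rw [h2, ← lintegral_indicator measurableSet_Ici]
        refine lintegral_congr fun u => ?_
        by_cases hu : u ∈ Set.Ici M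
        · rw [Set.indicator_of_mem hu, Set.indicator_of_mem hu]
        · rw [Set.indicator_of_notMem hu, Set.indicator_of_notMem hu, zero_mul]
    _ ≤ ∫⁻ u in Set.Ici M, ENNReal.ofReal (2 * A * u ^ (-(3 / 2) : ℝ)) := by
        refine setLIntegral_mono' measurableSet_Ici fun u hu => ?_
        have hu0 : 0 < u := hM.trans_le hu
        refine (mul_le_mul_right (hG u hu) _).trans (le_of_eq ?_)
        rw [← ENNReal.ofReal_mul (by positivity)]
        congr 1
        have : u ^ (-(3 / 2) : ℝ) = u ^ (-3 : ℝ) * u ^ (3 / 2 : ℝ) := by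
          rw [← Real.rpow_add hu0]; norm_num
        rw [this]
        ring
    _ = ENNReal.ofReal (4 * A * M ^ (-(1 / 2) : ℝ)) := by
        rw [setLIntegral_congr Ioi_ae_eq_Ici.symm, ← ofReal_integral_eq_lintegral_ofReal
          ((integrableOn_Ioi_rpow_of_lt (by norm_num) hM).const_mul _), integral_const_mul,
          integral_Ioi_rpow_of_lt (by norm_num) hM]
        · congr 1
          rw [show (-(3 / 2) : ℝ) + 1 = -(1 / 2) by norm_num]
          ring
        · filter_upwards [ae_restrict_mem measurableSet_Ioi] with u hu
          have : 0 < u := hM.trans hu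
          simp only [Pi.zero_apply]
          positivity

/-! ### Regular variation and Karamata's theorem -/

/-- `r` is positive and regularly varying at infinity with index `-β`. -/
structure IsRegVarying (r : ℝ → ℝ) (β : ℝ) : Prop where
  pos : ∀ T, 0 < T → 0 < r T
  ratio : ∀ s, 0 < s → Tendsto (fun T => r (s * T) / r T) atTop (𝓝 (s ^ (-β)))

theorem tendsto_of_approx {a : ℝ → ℝ} {L : ℝ}
    (h : ∀ ε > 0, ∃ (a' : ℝ → ℝ) (L' : ℝ), Tendsto a' atTop (𝓝 L') ∧
      (∀ᶠ T in atTop, |a T - a' T| ≤ ε) ∧ |L - L'| ≤ ε) : Tendsto a atTop (𝓝 L) := by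
  rw [Metric.tendsto_nhds]
  intro ε hε
  obtain ⟨a', L', h1, h2, h3⟩ := h (ε / 4) (by positivity)
  have h4 := Metric.tendsto_nhds.1 h1 (ε / 4) (by positivity)
  filter_upwards [h2, h4] with T h5 h6
  rw [Real.dist_eq] at h6 ⊢
  rw [abs_le] at h5 h3
  rw [abs_lt] at h6 ⊢
  constructor <;> linarith

theorem IsRegVarying.tendsto_comp_mul {r : ℝ → ℝ} {β : ℝ} (hr : IsRegVarying r β) {a : ℝ → ℝ}
    {c : ℝ} (ha : Tendsto (fun T => a T / r T) atTop (𝓝 c)) {s : ℝ} (hs : 0 < s) :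
    Tendsto (fun T => a (s * T) / r T) atTop (𝓝 (c * s ^ (-β))) := by
  have h1 := (ha.comp (tendsto_id.const_mul_atTop hs)).mul (hr.ratio s hs)
  refine h1.congr' ?_
  filter_upwards [eventually_gt_atTop 0] with T hT
  have := (hr.pos (s * T) (by positivity)).ne'
  simp only [Function.comp, id]
  field_simp

/-! ### A Potter bound and the Abelian theorem for the Gaussian kernel -/

section

variable {G : Measure ℝ} {r : ℝ → ℝ} {β c : ℝ}

theorem map_mul_Iic {T : ℝ} (hT : 0 < T) (u : ℝ) :
    (G.map fun b => T * b) (Set.Iic u) = G (Set.Iic (u / T)) := by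
  rw [Measure.map_apply (by fun_prop) measurableSet_Iic]
  congr 1
  ext b
  simp [le_div_iff₀ hT, mul_comm]

theorem tendsto_distribution_div (hr : IsRegVarying r β)
    (hF : Tendsto (fun T => G.real (Set.Iic (1 / T)) / r T) atTop (𝓝 c)) {u : ℝ} (hu : 0 < u) :
    Tendsto (fun T => G.real (Set.Iic (u / T)) / r T) atTop (𝓝 (c * u ^ β)) := by
  have := hr.tendsto_comp_mul hF (inv_pos.2 hu)
  rw [Real.inv_rpow hu.le, Real.rpow_neg hu.le, inv_inv] at this
  refine this.congr fun T => ?_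
  rw [one_div, mul_inv, inv_inv, div_eq_mul_inv u]

variable [IsFiniteMeasure G]

/-- A Potter type bound. -/
theorem exists_distribution_le (hr : IsRegVarying r β) (hβ1 : β ≤ 1) (hc : 0 < c)
    (hF : Tendsto (fun T => G.real (Set.Iic (1 / T)) / r T) atTop (𝓝 c)) :
    ∃ A T₀ : ℝ, 0 < T₀ ∧ 0 ≤ A ∧ ∀ T, T₀ ≤ T → ∀ u, 1 ≤ u →
      G.real (Set.Iic (u / T)) / r T ≤ A * u ^ (3 / 2 : ℝ) := by
  have hmono : ∀ x y : ℝ, x ≤ y → G.real (Set.Iic x) ≤ G.real (Set.Iic y) := fun x y hxy =>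
    measureReal_mono (Set.Iic_subset_Iic.2 hxy)
  have h1 : Tendsto (fun T => (G.real (Set.Iic (2 / T)) / r T) / (G.real (Set.Iic (1 / T)) / r T))
      atTop (𝓝 (2 ^ β)) := by
    have := (tendsto_distribution_div hr hF two_pos).div hF hc.ne'
    rwa [mul_div_cancel_left₀ _ hc.ne'] at this
  -- Because β ≤ 1 < 3/2, the distribution function eventually grows by less than 2^{3/2} at each
  -- doubling.
  have h2 : (2 : ℝ) ^ β < 2 ^ (3 / 2 : ℝ) :=
    Real.rpow_lt_rpow_of_exponent_lt (by norm_num) (by linarith)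
  obtain ⟨T₁, hT₁⟩ := eventually_atTop.1 ((h1.eventually (gt_mem_nhds h2)).and
    ((hF.eventually (lt_mem_nhds hc)).and ((hF.eventually (gt_mem_nhds (lt_add_one c))).and
      (eventually_gt_atTop 0))))
  have hT₁0 : 0 < T₁ := (hT₁ T₁ le_rfl).2.2.2
  have hFpos : ∀ T, T₁ ≤ T → 0 < G.real (Set.Iic (1 / T)) := fun T hT => by
    have h3 := (hT₁ T hT).2.1
    have h4 := hr.pos T (hT₁0.trans_le hT)
    by_contra! h
    exact absurd h3 (not_lt.2 (div_nonpos_of_nonpos_of_nonneg h h4.le))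
  have hdouble : ∀ T, T₁ ≤ T → G.real (Set.Iic (2 / T)) ≤
      2 ^ (3 / 2 : ℝ) * G.real (Set.Iic (1 / T)) := fun T hT => by
    have h3 := (hT₁ T hT).1
    have h4 := hr.pos T (hT₁0.trans_le hT)
    rw [div_div_div_cancel_right₀ h4.ne', div_lt_iff₀ (hFpos T hT)] at h3
    exact h3.le
  -- The second entry covers T₁ ≤ T ≤ 2T₁, where halving T would leave the range of the doubling
  -- estimate and only the total mass is used.
  set A := max (2 ^ (3 / 2 : ℝ)) (G.real Set.univ / G.real (Set.Iic (1 / (2 * T₁)))) with hA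
  have hA0 : 0 ≤ A := le_max_of_le_left (by positivity)
  -- Induction on the number of doublings: halving u and T together leaves u/T unchanged.
  have main : ∀ n : ℕ, ∀ T, T₁ ≤ T → ∀ u : ℝ, 1 ≤ u → u ≤ 2 ^ n →
      G.real (Set.Iic (u / T)) ≤ A * u ^ (3 / 2 : ℝ) * G.real (Set.Iic (1 / T)) := by
    have base : ∀ T, T₁ ≤ T → ∀ u : ℝ, 1 ≤ u → u ≤ 2 →
        G.real (Set.Iic (u / T)) ≤ A * u ^ (3 / 2 : ℝ) * G.real (Set.Iic (1 / T)) := by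
      intro T hT u hu hu2
      have h5 : 0 < T := hT₁0.trans_le hT
      calc G.real (Set.Iic (u / T)) ≤ G.real (Set.Iic (2 / T)) := hmono _ _ (by gcongr)
        _ ≤ 2 ^ (3 / 2 : ℝ) * G.real (Set.Iic (1 / T)) := hdouble T hT
        _ ≤ A * G.real (Set.Iic (1 / T)) := by gcongr; exact le_max_left _ _
        _ ≤ A * u ^ (3 / 2 : ℝ) * G.real (Set.Iic (1 / T)) := by
          gcongr
          exact le_mul_of_one_le_right hA0 (Real.one_le_rpow hu (by norm_num))
    intro n
    induction n with
    | zero => intro T hT u hu hu2; exact base T hT u hu (by linarith [pow_zero (2 : ℝ)])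
    | succ n ih =>
      intro T hT u hu hu2
      rcases le_total u 2 with h | h
      · exact base T hT u hu h
      rcases le_total (2 * T₁) T with h' | h'
      · have h5 : 0 < T := hT₁0.trans_le hT
        have e1 := ih (T / 2) (by linarith) (u / 2) (by linarith)
          (by rw [pow_succ] at hu2; linarith)
        have e2 := hdouble T hT
        rw [div_div_div_cancel_right₀ two_ne_zero, one_div_div,
          Real.div_rpow (by linarith) two_pos.le] at e1
        refine e1.trans ((mul_le_mul_of_nonneg_left e2 (by positivity)).trans (le_of_eq ?_))
        field_simp
      · have e1 : G.real (Set.Iic (u / T)) ≤ G.real Set.univ := measureReal_mono (Set.subset_univ _)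
        have e2 := hFpos (2 * T₁) (by linarith)
        have e3 : G.real (Set.Iic (1 / (2 * T₁))) ≤ G.real (Set.Iic (1 / T)) :=
          hmono _ _ (one_div_le_one_div_of_le (hT₁0.trans_le hT) h')
        calc G.real (Set.Iic (u / T)) ≤ G.real Set.univ := e1
          _ = G.real Set.univ / G.real (Set.Iic (1 / (2 * T₁))) *
              G.real (Set.Iic (1 / (2 * T₁))) := by
            field_simp
          _ ≤ A * G.real (Set.Iic (1 / T)) := by gcongr; exact le_max_right _ _
          _ ≤ A * u ^ (3 / 2 : ℝ) * G.real (Set.Iic (1 / T)) := by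
            gcongr
            exact le_mul_of_one_le_right hA0 (Real.one_le_rpow hu (by norm_num))
  refine ⟨A * (c + 1), T₁, hT₁0, by positivity, fun T hT u hu => ?_⟩
  obtain ⟨n, hn⟩ := pow_unbounded_of_one_lt u (one_lt_two)
  have e1 := main n T hT u hu hn.le
  have e2 := hr.pos T (hT₁0.trans_le hT)
  have e3 := (hT₁ T hT).2.2.1
  calc G.real (Set.Iic (u / T)) / r T
      ≤ A * u ^ (3 / 2 : ℝ) * G.real (Set.Iic (1 / T)) / r T := by gcongr
    _ = A * u ^ (3 / 2 : ℝ) * (G.real (Set.Iic (1 / T)) / r T) := by ring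
    _ ≤ A * u ^ (3 / 2 : ℝ) * (c + 1) := by
      have : 0 ≤ u := by linarith
      gcongr
    _ = _ := by ring

theorem integral_gauss_mul_eq (hG : G (Set.Iio 0) = 0) {T : ℝ} (hT : 0 < T) :
    ∫ b, gauss (T * b) ∂G = ∫ u in Set.Ioi 0, u * gauss u * G.real (Set.Iic (u / T)) := by
  have h1 : ∫ b, gauss (T * b) ∂G = ∫ b, gauss b ∂(G.map fun b => T * b) :=
    (integral_map (by fun_prop) continuous_gauss.aestronglyMeasurable).symm
  have h2 : (G.map fun b => T * b) (Set.Iio 0) = 0 := by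
    rw [Measure.map_apply (by fun_prop) measurableSet_Iio]
    convert hG using 2
    ext b
    simp [hT]
  rw [h1, integral_gauss_eq _ h2 fun u => measure_ne_top _ _]
  simp only [measureReal_def, map_mul_Iic hT]

theorem integrableOn_mul_gauss {s : ℝ} (hs : -1 < s) :
    IntegrableOn (fun u : ℝ => u ^ s * gauss u) (Set.Ioi 0) := by
  refine (integrableOn_rpow_mul_exp_neg_mul_sq (b := 1 / 2) (by norm_num) hs).congr_fun
    (fun u _ => ?_) measurableSet_Ioi
  simp only [gauss]
  congr 2
  ring

/-- After integration by parts the integrand converges pointwise by regular variation. The Potter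
bound for u ≥ 1 and monotonicity for u ≤ 1 give a majorant integrable against u gauss(u). -/
theorem tendsto_gauss_of_distribution (hG : G (Set.Iio 0) = 0) (hr : IsRegVarying r β)
    (hβ : 0 < β) (hβ1 : β ≤ 1) (hc : 0 < c)
    (hF : Tendsto (fun T => G.real (Set.Iic (1 / T)) / r T) atTop (𝓝 c)) :
    Tendsto (fun T => (∫ b, gauss (T * b) ∂G) / r T) atTop (𝓝 (c * gaussMoment β)) := by
  obtain ⟨A, T₀, hT₀, hA0, hA⟩ := exists_distribution_le hr hβ1 hc hF
  have hlim : c * gaussMoment β = ∫ u in Set.Ioi 0, u * gauss u * (c * u ^ β) := by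
    rw [gaussMoment, integral_gauss_eq _ (powerMeasure_Iio_zero β), ← integral_const_mul]
    · refine setIntegral_congr_fun measurableSet_Ioi fun u hu => ?_
      have hu0 : (0 : ℝ) ≤ u := le_of_lt hu
      rw [measureReal_def, powerMeasure_Iic hβ hu0, ENNReal.toReal_ofReal (by positivity)]
      ring
    · intro u
      rcases le_total 0 u with h | h
      · rw [powerMeasure_Iic hβ h]; exact ENNReal.ofReal_ne_top
      · refine ((measure_mono (Set.Iic_subset_Iic.2 h)).trans_lt ?_).ne
        rw [powerMeasure_Iic hβ le_rfl]; exact ENNReal.ofReal_lt_top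
  have hmono : ∀ T : ℝ, 0 < T → Measurable fun u => G.real (Set.Iic (u / T)) := fun T hT =>
    Monotone.measurable fun u v huv => measureReal_mono (Set.Iic_subset_Iic.2 (by gcongr))
  have key : Tendsto (fun T => ∫ u in Set.Ioi 0, u * gauss u * (G.real (Set.Iic (u / T)) / r T))
      atTop (𝓝 (c * gaussMoment β)) := by
    rw [hlim]
    refine tendsto_integral_filter_of_dominated_convergence
      (fun u => A * (u ^ (1 : ℝ) * gauss u) + A * (u ^ (5 / 2 : ℝ) * gauss u)) ?_ ?_ ?_ ?_
    · filter_upwards [eventually_gt_atTop 0] with T hT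
      exact ((measurable_id.mul continuous_gauss.measurable).mul
        ((hmono T hT).div_const _)).aestronglyMeasurable
    · filter_upwards [eventually_ge_atTop T₀] with T hT
      filter_upwards [ae_restrict_mem measurableSet_Ioi] with u hu
      have hu0 : 0 < u := hu
      have hrT := hr.pos T (hT₀.trans_le hT)
      have hTpos := hT₀.trans_le hT
      have hg := gauss_pos u
      have e1 : G.real (Set.Iic (u / T)) / r T ≤ A * (1 + u ^ (3 / 2 : ℝ)) := by
        rcases le_total 1 u with h | h
        · refine (hA T hT u h).trans ?_
          gcongr
          linarith
        · have e2 := hA T hT 1 le_rfl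
          rw [Real.one_rpow] at e2
          calc G.real (Set.Iic (u / T)) / r T ≤ G.real (Set.Iic (1 / T)) / r T := by
                exact div_le_div_of_nonneg_right (measureReal_mono
                  (Set.Iic_subset_Iic.2 (div_le_div_of_nonneg_right h hTpos.le))) hrT.le
            _ ≤ A * 1 := e2
            _ ≤ _ := by gcongr; linarith [Real.rpow_nonneg hu0.le (3 / 2)]
      rw [Real.norm_of_nonneg (by positivity)]
      have e3 : u ^ (5 / 2 : ℝ) = u * u ^ (3 / 2 : ℝ) := by
        rw [show (5 / 2 : ℝ) = 1 + 3 / 2 by norm_num, Real.rpow_add hu0, Real.rpow_one]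
      calc u * gauss u * (G.real (Set.Iic (u / T)) / r T)
          ≤ u * gauss u * (A * (1 + u ^ (3 / 2 : ℝ))) := by gcongr
        _ = _ := by rw [e3, Real.rpow_one]; ring
    · exact ((integrableOn_mul_gauss (by norm_num)).const_mul A).add
        ((integrableOn_mul_gauss (by norm_num)).const_mul A)
    · filter_upwards [ae_restrict_mem measurableSet_Ioi] with u hu
      exact (tendsto_distribution_div hr hF hu).const_mul _
  refine key.congr' ?_
  filter_upwards [eventually_gt_atTop 0] with T hT
  rw [integral_gauss_mul_eq hG hT, ← integral_div]
  simp only [mul_div_assoc]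

end

/-! ### Karamata's argument: from the Gaussian kernel to the distribution function -/

section

variable {G : Measure ℝ} [IsFiniteMeasure G] {r : ℝ → ℝ} {β c : ℝ}

theorem integrable_gauss_mul_powerMeasure (hβ : 0 < β) {f : ℝ → ℝ} (hf : Continuous f) :
    Integrable (fun u => gauss u * f (gauss u)) (powerMeasure β) := by
  obtain ⟨B, hB⟩ :=
    isCompact_Icc.exists_bound_of_continuousOn (s := Set.Icc (0 : ℝ) 1) hf.continuousOn
  refine (integrable_gauss_powerMeasure hβ).mul_bdd (c := B)
    (hf.comp continuous_gauss).aestronglyMeasurable (Eventually.of_forall fun u => ?_)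
  exact hB _ ⟨(gauss_pos u).le, gauss_le_one u⟩

theorem integrable_gauss_mul_comp {f : ℝ → ℝ} (hf : Continuous f) (T : ℝ) :
    Integrable (fun b => gauss (T * b) * f (gauss (T * b))) G := by
  obtain ⟨B, hB⟩ :=
    isCompact_Icc.exists_bound_of_continuousOn (s := Set.Icc (0 : ℝ) 1) hf.continuousOn
  have hc : Continuous fun b => gauss (T * b) := continuous_gauss.comp (by fun_prop)
  refine Integrable.of_bound (hc.mul (hf.comp hc)).aestronglyMeasurable B
    (Eventually.of_forall fun b => ?_)
  rw [norm_mul, Real.norm_of_nonneg (gauss_pos _).le]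
  have h1 := hB _ ⟨(gauss_pos (T * b)).le, gauss_le_one _⟩
  exact (mul_le_of_le_one_left (norm_nonneg _) (gauss_le_one _)).trans h1

/-- A power of the Gaussian is a dilated Gaussian, so regular variation extends a limit for one
kernel to every polynomial in it. -/
theorem gauss_mul_pow (u : ℝ) (n : ℕ) : gauss u * gauss u ^ n = gauss (√(n + 1) * u) := by
  rw [← pow_succ', gauss, gauss, ← Real.exp_nat_mul, mul_pow, Real.sq_sqrt (by positivity)]
  congr 1
  push_cast
  ring

omit [IsFiniteMeasure G] in
theorem tendsto_gauss_mul_pow (hr : IsRegVarying r β) (hβ : 0 < β)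
    (hJ : Tendsto (fun T => (∫ b, gauss (T * b) ∂G) / r T) atTop (𝓝 (c * gaussMoment β))) (n : ℕ) :
    Tendsto (fun T => (∫ b, gauss (T * b) * gauss (T * b) ^ n ∂G) / r T) atTop
      (𝓝 (c * ∫ u, gauss u * gauss u ^ n ∂(powerMeasure β))) := by
  have hs : 0 < √((n : ℝ) + 1) := by positivity
  have h1 := hr.tendsto_comp_mul hJ hs
  simp only [gauss_mul_pow]
  rw [integral_gauss_mul_powerMeasure hβ hs, ← gaussMoment_eq hβ]
  rw [mul_assoc, mul_comm (gaussMoment β)] at h1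
  simpa only [mul_assoc] using h1

theorem tendsto_gauss_mul_polynomial (hr : IsRegVarying r β) (hβ : 0 < β)
    (hJ : Tendsto (fun T => (∫ b, gauss (T * b) ∂G) / r T) atTop (𝓝 (c * gaussMoment β)))
    (p : Polynomial ℝ) :
    Tendsto (fun T => (∫ b, gauss (T * b) * p.eval (gauss (T * b)) ∂G) / r T) atTop
      (𝓝 (c * ∫ u, gauss u * p.eval (gauss u) ∂(powerMeasure β))) := by
  induction p using Polynomial.induction_on' with
  | add p q hp hq =>
    simp only [Polynomial.eval_add, mul_add]
    rw [integral_add (integrable_gauss_mul_powerMeasure hβ p.continuous)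
      (integrable_gauss_mul_powerMeasure hβ q.continuous), mul_add]
    refine (hp.add hq).congr fun T => ?_
    rw [integral_add (integrable_gauss_mul_comp p.continuous T)
      (integrable_gauss_mul_comp q.continuous T), add_div]
  | monomial n a =>
    have h := (tendsto_gauss_mul_pow hr hβ hJ n).const_mul a
    simp only [Polynomial.eval_monomial, mul_left_comm (gauss _) a, integral_const_mul]
    rw [mul_left_comm]
    simpa only [mul_div_assoc] using h

/-- Weierstrass approximation on [0, 1], where gauss takes its values. The factor gauss in front
makes the error at most η · gauss, whose normalised integral is controlled by the hypothesis itself.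
-/
theorem tendsto_gauss_mul_continuous (hr : IsRegVarying r β) (hβ : 0 < β) (hc : 0 ≤ c)
    (hJ : Tendsto (fun T => (∫ b, gauss (T * b) ∂G) / r T) atTop (𝓝 (c * gaussMoment β)))
    {f : ℝ → ℝ} (hf : Continuous f) :
    Tendsto (fun T => (∫ b, gauss (T * b) * f (gauss (T * b)) ∂G) / r T) atTop
      (𝓝 (c * ∫ u, gauss u * f (gauss u) ∂(powerMeasure β))) := by
  refine tendsto_of_approx fun ε hε => ?_
  have hm := gaussMoment_pos hβ
  have hη : 0 < ε / (c * gaussMoment β + 1) := by positivity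
  obtain ⟨p, hp⟩ := exists_polynomial_near_of_continuousOn 0 1 f hf.continuousOn _ hη
  set η := ε / (c * gaussMoment β + 1) with hηdef
  have hle : η * (c * gaussMoment β + 1) = ε := by rw [hηdef]; field_simp
  have hpt : ∀ u, |gauss u * f (gauss u) - gauss u * p.eval (gauss u)| ≤ η * gauss u := fun u => by
    rw [← mul_sub, abs_mul, abs_of_pos (gauss_pos u), mul_comm, abs_sub_comm]
    exact mul_le_mul_of_nonneg_right (hp _ ⟨(gauss_pos u).le, gauss_le_one u⟩).le (gauss_pos u).le
  refine ⟨_, _, tendsto_gauss_mul_polynomial hr hβ hJ p, ?_, ?_⟩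
  · have h1 := hJ.eventually (gt_mem_nhds (lt_add_one (c * gaussMoment β)))
    filter_upwards [h1, eventually_gt_atTop 0] with T h2 hT
    have hrT := hr.pos T hT
    have hgi : Integrable (fun b => gauss (T * b)) G := by
      simpa using integrable_gauss_mul_comp (G := G) (f := fun _ => (1 : ℝ)) continuous_const T
    rw [← sub_div, ← integral_sub (integrable_gauss_mul_comp hf T)
      (integrable_gauss_mul_comp p.continuous T), abs_div, abs_of_pos hrT]
    calc _ ≤ (∫ b, η * gauss (T * b) ∂G) / r T := by
          rw [← Real.norm_eq_abs]
          refine div_le_div_of_nonneg_right (norm_integral_le_of_norm_le (hgi.const_mul η)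
            (Eventually.of_forall fun b => hpt _)) hrT.le
      _ = η * ((∫ b, gauss (T * b) ∂G) / r T) := by rw [integral_const_mul, mul_div_assoc]
      _ ≤ η * (c * gaussMoment β + 1) := by gcongr
      _ = ε := hle
  · rw [← mul_sub, ← integral_sub (integrable_gauss_mul_powerMeasure hβ hf)
      (integrable_gauss_mul_powerMeasure hβ p.continuous), abs_mul, abs_of_nonneg hc]
    calc _ ≤ c * ∫ u, η * gauss u ∂(powerMeasure β) := by
          rw [← Real.norm_eq_abs]
          refine mul_le_mul_of_nonneg_left (norm_integral_le_of_norm_le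
            ((integrable_gauss_powerMeasure hβ).const_mul η) (Eventually.of_forall hpt)) hc
      _ = η * (c * gaussMoment β) := by rw [integral_const_mul, gaussMoment]; ring
      _ ≤ η * (c * gaussMoment β + 1) := by gcongr; linarith
      _ = ε := hle

/-- Vague convergence of the rescaled measures. -/
theorem tendsto_integral_comp_mul (hG : G (Set.Iio 0) = 0) (hr : IsRegVarying r β) (hβ : 0 < β)
    (hc : 0 ≤ c)
    (hJ : Tendsto (fun T => (∫ b, gauss (T * b) ∂G) / r T) atTop (𝓝 (c * gaussMoment β)))
    {k : ℝ → ℝ} (hk : Continuous k) {M : ℝ} (hM : 0 ≤ M) (hkM : ∀ u, M ≤ u → k u = 0) :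
    Tendsto (fun T => (∫ b, k (T * b) ∂G) / r T) atTop
      (𝓝 (c * ∫ u, k u ∂(powerMeasure β))) := by
  -- f inverts v = e^{-u²/2} so that gauss · f(gauss) = k on [0, ∞). Clamping v below at gauss M
  -- keeps the logarithm and the quotient continuous and is harmless because k vanishes beyond M.
  set f : ℝ → ℝ := fun v => k √(-(2 * Real.log (max v (gauss M)))) / max v (gauss M) with hf
  have hpos : ∀ v, 0 < max v (gauss M) := fun v => lt_max_of_lt_right (gauss_pos M)
  have hfc : Continuous f := by
    have h1 : Continuous fun v : ℝ => Real.log (max v (gauss M)) :=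
      Continuous.log (by fun_prop) fun v => (hpos v).ne'
    exact (hk.comp (by fun_prop)).div (by fun_prop) fun v => (hpos v).ne'
  have hkf : ∀ u, 0 ≤ u → gauss u * f (gauss u) = k u := fun u hu => by
    simp only [hf]
    have hlog : ∀ w, 0 ≤ w → √(-(2 * Real.log (gauss w))) = w := fun w hw => by
      rw [gauss, Real.log_exp, show -(2 * -(w ^ 2 / 2)) = w ^ 2 by ring, Real.sqrt_sq hw]
    rcases le_total u M with h | h
    · have h2 : gauss M ≤ gauss u := by
        unfold gauss
        gcongr
      rw [max_eq_left h2, hlog u hu, mul_div_cancel₀ _ (gauss_pos u).ne']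
    · have h2 : gauss u ≤ gauss M := by
        unfold gauss
        gcongr
      rw [max_eq_right h2, hlog M hM, hkM M le_rfl, hkM u h, zero_div, mul_zero]
  have hae : ∀ {μ : Measure ℝ}, μ (Set.Iio 0) = 0 → ∀ᵐ b ∂μ, 0 ≤ b := fun {μ} h => by
    rw [ae_iff]
    convert h using 2
    ext; simp
  have h1 := tendsto_gauss_mul_continuous hr hβ hc hJ hfc
  rw [integral_congr_ae ((hae (powerMeasure_Iio_zero β)).mono fun u hu => hkf u hu)] at h1
  refine h1.congr' ?_
  filter_upwards [eventually_ge_atTop 0] with T hT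
  rw [integral_congr_ae ((hae hG).mono fun b hb => hkf (T * b) (mul_nonneg hT hb))]

theorem integrable_powerMeasure_of_bound (hβ : 0 < β) {k : ℝ → ℝ} (hk : Measurable k) {M B : ℝ}
    (hM : 0 ≤ M) (hkM : ∀ u, M ≤ u → k u = 0) (hB : ∀ u, |k u| ≤ B) :
    Integrable k (powerMeasure β) := by
  have h1 : IntegrableOn k (Set.Iic M) (powerMeasure β) := by
    refine Measure.integrableOn_of_bounded (M := B) ?_ hk.aestronglyMeasurable
      (Eventually.of_forall hB)
    rw [powerMeasure_Iic hβ hM]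
    exact ENNReal.ofReal_ne_top
  refine (integrableOn_iff_integrable_of_support_subset fun u hu => ?_).1 h1
  by_contra h
  exact hu (hkM u (not_le.1 h).le)

/-- **Karamata's Tauberian theorem** for the Gaussian kernel. -/
theorem tendsto_distribution_of_gauss (hG : G (Set.Iio 0) = 0) (hr : IsRegVarying r β) (hβ : 0 < β)
    (hβ1 : β ≤ 1) (hc : 0 ≤ c)
    (hJ : Tendsto (fun T => (∫ b, gauss (T * b) ∂G) / r T) atTop (𝓝 (c * gaussMoment β))) :
    Tendsto (fun T => G.real (Set.Iic (1 / T)) / r T) atTop (𝓝 c) := by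
  -- These trapezoids lie between the indicators of (-∞, a - δ] and (-∞, a]; a = 1 bounds the
  -- distribution function from below and a = 1 + δ from above.
  have hclamp : ∀ a δ : ℝ, Continuous fun u : ℝ => max 0 (min 1 ((a - u) / δ)) := by
    intro a δ; fun_prop
  have hbound : ∀ a δ u : ℝ, |max 0 (min 1 ((a - u) / δ))| ≤ 1 := fun a δ u => by
    rw [abs_of_nonneg (le_max_left _ _)]
    exact max_le zero_le_one (min_le_left _ _)
  have hzero : ∀ a δ : ℝ, 0 < δ → ∀ u, a ≤ u → max 0 (min 1 ((a - u) / δ)) = 0 := fun a δ hδ u hu =>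
    max_eq_left ((min_le_right _ _).trans (div_nonpos_of_nonpos_of_nonneg (by linarith) hδ.le))
  have hone : ∀ a δ : ℝ, 0 < δ → ∀ u, u ≤ a - δ → max 0 (min 1 ((a - u) / δ)) = 1 :=
    fun a δ hδ u hu => by
      rw [min_eq_left ((one_le_div₀ hδ).2 (by linarith)), max_eq_right zero_le_one]
  have hle : ∀ a δ : ℝ, 0 < δ → ∀ u, max 0 (min 1 ((a - u) / δ)) ≤ (Set.Iic a).indicator 1 u :=
    fun a δ hδ u => by
      by_cases h : u ≤ a
      · rw [Set.indicator_of_mem (show u ∈ Set.Iic a from h)]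
        exact max_le zero_le_one (min_le_left _ _)
      · rw [hzero a δ hδ u (not_le.1 h).le]
        exact Set.indicator_nonneg (fun _ _ => zero_le_one) _
  have hge : ∀ a δ : ℝ, 0 < δ → ∀ u, (Set.Iic (a - δ)).indicator 1 u ≤
      max 0 (min 1 ((a - u) / δ)) :=
    fun a δ hδ u => by
      by_cases h : u ≤ a - δ
      · rw [Set.indicator_of_mem (show u ∈ Set.Iic (a - δ) from h), hone a δ hδ u h]
        exact le_rfl
      · rw [Set.indicator_of_notMem (show u ∉ Set.Iic (a - δ) from h)]
        exact le_max_left _ _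
  have hpmI : ∀ a : ℝ, 0 ≤ a → Integrable ((Set.Iic a).indicator (1 : ℝ → ℝ)) (powerMeasure β) :=
    fun a ha => (integrable_indicator_iff measurableSet_Iic).2 <| by
      refine integrableOn_const ?_
      rw [powerMeasure_Iic hβ ha]
      exact ENNReal.ofReal_ne_top
  have hpm : ∀ a : ℝ, 0 ≤ a → ∫ u, (Set.Iic a).indicator (1 : ℝ → ℝ) u ∂(powerMeasure β) = a ^ β :=
    fun a ha => by
      rw [integral_indicator_one measurableSet_Iic, measureReal_def, powerMeasure_Iic hβ ha,
        ENNReal.toReal_ofReal (by positivity)]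
  have hF : ∀ T : ℝ, 0 < T →
      G.real (Set.Iic (1 / T)) = ∫ b, (Set.Iic (1 : ℝ)).indicator (1 : ℝ → ℝ) (T * b) ∂G :=
    fun T hT => by
      rw [← integral_indicator_one measurableSet_Iic]
      refine integral_congr_ae (Eventually.of_forall fun b => ?_)
      have : b ∈ Set.Iic (1 / T) ↔ T * b ∈ Set.Iic (1 : ℝ) := by
        rw [Set.mem_Iic, Set.mem_Iic, le_div_iff₀ hT, mul_comm]
      by_cases h : T * b ∈ Set.Iic (1 : ℝ)
      · simp only [Set.indicator_of_mem h, Set.indicator_of_mem (this.2 h), Pi.one_apply]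
      · simp only [Set.indicator_of_notMem h, Set.indicator_of_notMem (this.not.2 h)]
  have hGi : ∀ a δ T : ℝ, Integrable (fun b => max 0 (min 1 ((a - T * b) / δ))) G := fun a δ T =>
    Integrable.of_bound ((hclamp a δ).comp (continuous_const_mul T)).aestronglyMeasurable 1
      (Eventually.of_forall fun b => hbound a δ _)
  have hGind : ∀ T : ℝ, Integrable (fun b => (Set.Iic (1 : ℝ)).indicator (1 : ℝ → ℝ) (T * b)) G :=
    fun T => Integrable.of_bound ((measurable_one.indicator measurableSet_Iic).comp
      (measurable_const_mul T)).aestronglyMeasurable 1 (Eventually.of_forall fun b => by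
        by_cases h : T * b ∈ Set.Iic (1 : ℝ)
        · rw [Set.indicator_of_mem h]; simp
        · rw [Set.indicator_of_notMem h]; simp)
  refine tendsto_order.2 ⟨fun x hx => ?_, fun x hx => ?_⟩
  · obtain ⟨δ, hδ0, hδ1, hδ⟩ : ∃ δ : ℝ, 0 < δ ∧ δ < 1 ∧ x < c * (1 - δ) := by
      refine ⟨min (1 / 2) ((c - x) / (2 * (c + 1))), ?_, ?_, ?_⟩
      · have : 0 < c - x := by linarith
        positivity
      · exact (min_le_left _ _).trans_lt (by norm_num)
      · have h1 : min (1 / 2) ((c - x) / (2 * (c + 1))) ≤ (c - x) / (2 * (c + 1)) :=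
          min_le_right _ _
        have h2 : (c - x) / (2 * (c + 1)) * (2 * (c + 1)) = c - x := by field_simp
        nlinarith [mul_le_mul_of_nonneg_left h1 hc]
    have h1 := tendsto_integral_comp_mul hG hr hβ hc hJ (hclamp 1 δ) zero_le_one (hzero 1 δ hδ0)
    -- β ≤ 1 gives (1 - δ)^β ≥ 1 - δ here and (1 + δ)^β ≤ 1 + δ in the upper bound, so δ can be
    -- chosen explicitly.
    have h2 : c * (1 - δ) ≤ c * ∫ u, max 0 (min 1 ((1 - u) / δ)) ∂(powerMeasure β) := by
      refine mul_le_mul_of_nonneg_left ?_ hc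
      calc (1 - δ) ≤ (1 - δ) ^ β := by
            conv_lhs => rw [← Real.rpow_one (1 - δ)]
            exact Real.rpow_le_rpow_of_exponent_ge (by linarith) (by linarith) hβ1
        _ ≤ _ := by
            rw [← hpm _ (by linarith)]
            exact integral_mono (hpmI _ (by linarith)) (integrable_powerMeasure_of_bound hβ
              (hclamp 1 δ).measurable zero_le_one (hzero 1 δ hδ0) (hbound 1 δ)) (hge 1 δ hδ0)
    filter_upwards [h1.eventually (lt_mem_nhds (hδ.trans_le h2)),
        eventually_gt_atTop 0] with T h3 hT
    refine h3.trans_le (div_le_div_of_nonneg_right ?_ (hr.pos T hT).le)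
    rw [hF T hT]
    exact integral_mono (hGi 1 δ T) (hGind T) fun b => hle 1 δ hδ0 (T * b)
  · obtain ⟨δ, hδ0, hδ⟩ : ∃ δ : ℝ, 0 < δ ∧ c * (1 + δ) < x := by
      refine ⟨(x - c) / (2 * (c + 1)), ?_, ?_⟩
      · have : 0 < x - c := by linarith
        positivity
      · have h2 : (x - c) / (2 * (c + 1)) * (2 * (c + 1)) = x - c := by field_simp
        have : 0 < (x - c) / (2 * (c + 1)) := by
          have : 0 < x - c := by linarith
          positivity
        nlinarith
    have h1 := tendsto_integral_comp_mul hG hr hβ hc hJ (hclamp (1 + δ) δ)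
      (by linarith : (0 : ℝ) ≤ 1 + δ) (hzero (1 + δ) δ hδ0)
    have h2 : c * ∫ u, max 0 (min 1 ((1 + δ - u) / δ)) ∂(powerMeasure β) ≤ c * (1 + δ) := by
      refine mul_le_mul_of_nonneg_left ?_ hc
      calc _ ≤ (1 + δ) ^ β := by
            rw [← hpm _ (by linarith)]
            exact integral_mono (integrable_powerMeasure_of_bound hβ
              (hclamp (1 + δ) δ).measurable (by linarith) (hzero (1 + δ) δ hδ0) (hbound (1 + δ) δ))
              (hpmI _ (by linarith)) (hle (1 + δ) δ hδ0)
        _ ≤ 1 + δ := by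
            conv_rhs => rw [← Real.rpow_one (1 + δ)]
            exact Real.rpow_le_rpow_of_exponent_le (by linarith) hβ1
    filter_upwards [h1.eventually (gt_mem_nhds (h2.trans_lt hδ)),
        eventually_gt_atTop 0] with T h3 hT
    refine (div_le_div_of_nonneg_right ?_ (hr.pos T hT).le).trans_lt h3
    rw [hF T hT]
    refine integral_mono (hGind T) (hGi (1 + δ) δ T) fun b => ?_
    have := hge (1 + δ) δ hδ0 (T * b)
    rwa [add_sub_cancel_right] at this

end

/-! ### From the Fejér kernel to the Gaussian kernel -/

theorem orbit_add (z : ℂ) (s t : ℝ) :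
    orbit z (s + t) = orbit z s + Complex.exp (s * z) * orbit z t := by
  by_cases hz : z = 0
  · simp [hz, orbit]
  · rw [orbit_eq hz, orbit_eq hz, orbit_eq hz]
    push_cast
    rw [add_mul, Complex.exp_add]
    ring

/-- On the imaginary axis the exponential has modulus 1, so the square root of the Fejér kernel is
subadditive in time. This is the source of all bounds uniform in t below. -/
theorem norm_orbit_mul_I_add_le (b s t : ℝ) :
    ‖orbit (b * Complex.I) (s + t)‖ ≤ ‖orbit (b * Complex.I) s‖ + ‖orbit (b * Complex.I) t‖ := by
  rw [orbit_add]
  refine (norm_add_le _ _).trans (le_of_eq ?_)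
  rw [norm_mul, Complex.norm_exp]
  simp

theorem fejerKernel_neg (T b : ℝ) : fejerKernel (-T) b = fejerKernel T b := by
  by_cases hb : b = 0
  · simp [hb, fejerKernel_zero]
  · rw [fejerKernel_eq hb, fejerKernel_eq hb, mul_neg, Real.cos_neg]

theorem fejerKernel_mul (T t b : ℝ) : fejerKernel (t * T) b = T ^ 2 * fejerKernel t (T * b) := by
  by_cases hT : T = 0
  · simp [hT, fejerKernel, orbit]
  by_cases hb : b = 0
  · simp [hb, fejerKernel_zero, mul_pow, mul_comm]
  · rw [fejerKernel_eq hb, fejerKernel_eq (mul_ne_zero hT hb), show T * b * t = b * (t * T) by ring]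
    field_simp

theorem abs_fejerKernel_le (T b : ℝ) : |fejerKernel T b| ≤ T ^ 2 := by
  rw [abs_of_nonneg (fejerKernel_nonneg T b)]
  rcases le_total 0 T with h | h
  · exact fejerKernel_le_sq h b
  · rw [← fejerKernel_neg, ← neg_sq]
    exact fejerKernel_le_sq (by linarith) b

theorem fejerKernel_sub_le (s t b : ℝ) :
    fejerKernel (s - t) b ≤ 2 * fejerKernel s b + 2 * fejerKernel t b := by
  have h := norm_orbit_mul_I_add_le b s (-t)
  rw [← fejerKernel_neg t, sub_eq_add_neg]
  unfold fejerKernel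
  nlinarith [norm_nonneg (orbit (b * Complex.I) (s + -t)),
    sq_nonneg (‖orbit (b * Complex.I) s‖ - ‖orbit (b * Complex.I) (-t)‖)]

theorem fejerKernel_nat_mul_le (n : ℕ) (t b : ℝ) :
    fejerKernel (n * t) b ≤ n ^ 2 * fejerKernel t b := by
  have h : ‖orbit (b * Complex.I) (n * t)‖ ≤ n * ‖orbit (b * Complex.I) t‖ := by
    induction n with
    | zero => simp [orbit]
    | succ n ih =>
      push_cast
      rw [add_mul, add_mul, one_mul, one_mul]
      exact (norm_orbit_mul_I_add_le b _ _).trans (by gcongr)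
  unfold fejerKernel
  rw [← mul_pow]
  gcongr

theorem hasDerivAt_fejerKernel (b t : ℝ) :
    HasDerivAt (fun t => fejerKernel t b) (2 * (orbit (b * Complex.I) t).re) t := by
  refine (hasDerivAt_orbit (b * Complex.I) t).norm_sq.congr_deriv ?_
  rw [show Complex.exp (t * (b * Complex.I)) = b * Complex.I * orbit (b * Complex.I) t + 1 by
    rw [mul_orbit]; ring]
  rw [Complex.inner]
  simp
  ring

theorem hasDerivAt_re_orbit (b t : ℝ) :
    HasDerivAt (fun t => (orbit (b * Complex.I) t).re) (Real.cos (b * t)) t := by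
  have h := (Complex.reCLM.hasFDerivAt).comp_hasDerivAt t (hasDerivAt_orbit (b * Complex.I) t)
  refine h.congr_deriv ?_
  rw [Complex.reCLM_apply, show (t * (b * Complex.I) : ℂ) = ((b * t : ℝ) : ℂ) * Complex.I by
    push_cast; ring, Complex.exp_ofReal_mul_I_re]

theorem integrable_pow_mul_gauss (n : ℕ) : Integrable fun t : ℝ => t ^ n * gauss t := by
  have h := integrable_rpow_mul_exp_neg_mul_sq (b := 1 / 2) (by norm_num)
    (s := n) (by have : (0 : ℝ) ≤ n := n.cast_nonneg
                 linarith)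
  refine h.congr (Eventually.of_forall fun t => ?_)
  simp only [Real.rpow_natCast, gauss]
  congr 2
  ring

theorem hasDerivAt_gauss (t : ℝ) : HasDerivAt gauss (-t * gauss t) t := by
  have h1 : HasDerivAt (fun u : ℝ => -(u ^ 2 / 2)) (-t) t :=
    (((hasDerivAt_pow 2 t).div_const 2).neg).congr_deriv (by simp)
  exact h1.exp.congr_deriv (by simp only [gauss]; ring)

theorem hasDerivAt_neg_mul_gauss (t : ℝ) :
    HasDerivAt (fun t => -t * gauss t) ((t ^ 2 - 1) * gauss t) t :=
  ((hasDerivAt_id t).neg.mul (hasDerivAt_gauss t)).congr_deriv (by simp; ring)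

theorem integral_cos_mul_gauss (b : ℝ) :
    ∫ t, Real.cos (b * t) * gauss t = √(2 * Real.pi) * gauss b := by
  have h := fourierIntegral_gaussian (b := (1 / 2 : ℂ)) (by norm_num) (b : ℂ)
  have h1 : ∀ t : ℝ, (Complex.exp (Complex.I * b * t) * Complex.exp (-(1 / 2) * (t : ℂ) ^ 2)).re =
      Real.cos (b * t) * gauss t := fun t => by
    rw [show (Complex.I * b * t : ℂ) = ((b * t : ℝ) : ℂ) * Complex.I by push_cast; ring,
      show (-(1 / 2) * (t : ℂ) ^ 2) = ((-(t ^ 2 / 2) : ℝ) : ℂ) by push_cast; ring,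
      ← Complex.ofReal_exp, Complex.re_mul_ofReal, Complex.exp_ofReal_mul_I_re, gauss]
  have hint : Integrable fun t : ℝ =>
      Complex.exp (Complex.I * b * t) * Complex.exp (-(1 / 2) * (t : ℂ) ^ 2) := by
    refine (integrable_pow_mul_gauss 0).mono' (by fun_prop) (Eventually.of_forall fun t => ?_)
    rw [show (Complex.I * b * t : ℂ) = ((b * t : ℝ) : ℂ) * Complex.I by push_cast; ring,
      show (-(1 / 2) * (t : ℂ) ^ 2) = ((-(t ^ 2 / 2) : ℝ) : ℂ) by push_cast; ring, norm_mul,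
      Complex.norm_exp_ofReal_mul_I, ← Complex.ofReal_exp, Complex.norm_real,
      Real.norm_of_nonneg (Real.exp_pos _).le, gauss]
    simp
  have h2 : ∫ t, Real.cos (b * t) * gauss t =
      (∫ t : ℝ, Complex.exp (Complex.I * b * t) * Complex.exp (-(1 / 2) * (t : ℂ) ^ 2)).re := by
    simp_rw [← h1]
    exact Complex.reCLM.integral_comp_comm hint
  rw [h2, h, show (Real.pi / (1 / 2) : ℂ) = ((2 * Real.pi : ℝ) : ℂ) by push_cast; ring,
    show (1 / 2 : ℂ) = ((1 / 2 : ℝ) : ℂ) by push_cast; rfl, ← Complex.ofReal_cpow (by positivity),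
    show -(b : ℂ) ^ 2 / (4 * ((1 / 2 : ℝ) : ℂ)) = ((-(b ^ 2 / 2) : ℝ) : ℂ) by push_cast; ring,
    ← Complex.ofReal_exp, ← Complex.ofReal_mul, Complex.ofReal_re, Real.sqrt_eq_rpow, gauss]

theorem integrable_mul_gauss_of_abs_le {f : ℝ → ℝ} (hf : Continuous f) {A : ℝ}
    (h : ∀ t, |f t| ≤ A * (t ^ 4 + 1)) : Integrable fun t => f t * gauss t := by
  refine (((integrable_pow_mul_gauss 4).add (integrable_pow_mul_gauss 0)).const_mul A).mono'
    (hf.mul continuous_gauss).aestronglyMeasurable (Eventually.of_forall fun t => ?_)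
  rw [norm_mul, Real.norm_of_nonneg (gauss_pos t).le]
  simp only [Pi.add_apply]
  rw [← add_mul, ← mul_assoc, pow_zero]
  exact mul_le_mul_of_nonneg_right (h t) (gauss_pos t).le

theorem abs_re_orbit_le (b t : ℝ) : |(orbit (b * Complex.I) t).re| ≤ |t| := by
  have h1 := Complex.abs_re_le_norm (orbit (b * Complex.I) t)
  have h2 : ‖orbit (b * Complex.I) t‖ ^ 2 ≤ |t| ^ 2 := by
    rw [sq_abs]
    exact (le_abs_self _).trans (abs_fejerKernel_le t b)
  exact h1.trans (abs_le_of_sq_le_sq' h2 (abs_nonneg t)).2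

theorem continuous_fejerKernel_left (b : ℝ) : Continuous fun t => fejerKernel t b :=
  continuous_iff_continuousAt.2 fun t => (hasDerivAt_fejerKernel b t).continuousAt

theorem continuous_re_orbit (b : ℝ) : Continuous fun t => (orbit (b * Complex.I) t).re :=
  Complex.continuous_re.comp (continuous_orbit _)

theorem integral_re_orbit_mul_gauss (b : ℝ) :
    ∫ t, (orbit (b * Complex.I) t).re * (-t * gauss t) = -(√(2 * Real.pi) * gauss b) := by
  rw [← integral_cos_mul_gauss]
  have hle : ∀ t, |(orbit (b * Complex.I) t).re| ≤ 2 * (t ^ 4 + 1) := fun t => by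
    nlinarith [abs_re_orbit_le b t, sq_nonneg (|t| - 1), sq_nonneg (t ^ 2 - 1), sq_abs t]
  have hle' : ∀ t, |(orbit (b * Complex.I) t).re * -t| ≤ 2 * (t ^ 4 + 1) := fun t => by
    rw [abs_mul, abs_neg]
    nlinarith [mul_le_mul_of_nonneg_right (abs_re_orbit_le b t) (abs_nonneg t),
      sq_nonneg (t ^ 2 - 1), sq_abs t]
  refine integral_mul_deriv_eq_deriv_mul_of_integrable
    (fun t _ => hasDerivAt_re_orbit b t) (fun t _ => hasDerivAt_gauss t) ?_ ?_ ?_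
  · refine (integrable_mul_gauss_of_abs_le ((continuous_re_orbit b).mul continuous_neg)
      hle').congr (Eventually.of_forall fun t => ?_)
    simp only [Pi.mul_apply]
    ring
  · refine integrable_mul_gauss_of_abs_le (by fun_prop) (A := 1) fun t => ?_
    nlinarith [Real.abs_cos_le_one (b * t), sq_nonneg (t ^ 2)]
  · exact integrable_mul_gauss_of_abs_le (continuous_re_orbit b) hle

/-- (t² - 1) gauss t is the second derivative of gauss, and the second time derivative of the Fejér
kernel is 2 cos(bt). Two integrations by parts leave the Fourier transform of a Gaussian. -/
theorem integral_fejerKernel_mul_gauss (b : ℝ) :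
    ∫ t, fejerKernel t b * ((t ^ 2 - 1) * gauss t) = 2 * √(2 * Real.pi) * gauss b := by
  have h1 : ∀ t, |fejerKernel t b * (t ^ 2 - 1)| ≤ 3 * (t ^ 4 + 1) := fun t => by
    rw [abs_mul]
    have h3 : |t ^ 2 - 1| ≤ t ^ 2 + 1 := by
      rw [abs_le]
      constructor <;> nlinarith [sq_nonneg t]
    nlinarith [mul_le_mul (abs_fejerKernel_le t b) h3 (abs_nonneg _) (sq_nonneg t),
      sq_nonneg (t ^ 2 - 1)]
  have h2 : ∀ t, |2 * (orbit (b * Complex.I) t).re * -t| ≤ 4 * (t ^ 4 + 1) := fun t => by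
    rw [abs_mul, abs_mul, abs_neg, abs_two]
    nlinarith [mul_le_mul_of_nonneg_right (abs_re_orbit_le b t) (abs_nonneg t),
      sq_nonneg (t ^ 2 - 1), sq_abs t]
  have h3 : ∀ t, |fejerKernel t b * -t| ≤ 2 * (t ^ 4 + 1) := fun t => by
    rw [abs_mul, abs_neg]
    have h4 := mul_le_mul_of_nonneg_right (abs_fejerKernel_le t b) (abs_nonneg t)
    have h5 : t ^ 2 * |t| ≤ t ^ 2 * ((t ^ 2 + 1) / 2) :=
      mul_le_mul_of_nonneg_left (by nlinarith [sq_nonneg (|t| - 1), sq_abs t]) (sq_nonneg t)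
    nlinarith [sq_nonneg (t ^ 2 - 1)]
  have p := integral_mul_deriv_eq_deriv_mul_of_integrable
    (fun t _ => hasDerivAt_fejerKernel b t) (fun t _ => hasDerivAt_neg_mul_gauss t)
    ((integrable_mul_gauss_of_abs_le ((continuous_fejerKernel_left b).mul
      (by fun_prop : Continuous fun t : ℝ => t ^ 2 - 1)) h1).congr
        (Eventually.of_forall fun t => by simp only [Pi.mul_apply]; ring))
    ((integrable_mul_gauss_of_abs_le (((continuous_re_orbit b).const_mul 2).mul continuous_neg)
      h2).congr (Eventually.of_forall fun t => by simp only [Pi.mul_apply]; ring))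
    ((integrable_mul_gauss_of_abs_le ((continuous_fejerKernel_left b).mul continuous_neg)
      h3).congr (Eventually.of_forall fun t => by simp only [Pi.mul_apply]; ring))
  rw [p]
  simp only [mul_assoc (2 : ℝ)]
  rw [integral_const_mul, integral_re_orbit_mul_gauss]
  ring

/-! ### Averaging the Fejér asymptotics in time -/

section

variable {G : Measure ℝ} [IsFiniteMeasure G] {r : ℝ → ℝ} {β : ℝ}

theorem integrable_fejerKernel (T : ℝ) : Integrable (fejerKernel T) G :=
  Integrable.of_bound (continuous_fejerKernel T).aestronglyMeasurable (T ^ 2)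
    (Eventually.of_forall fun b => abs_fejerKernel_le T b)

theorem continuous_integral_fejerKernel : Continuous fun T => ∫ b, fejerKernel T b ∂G := by
  refine continuous_iff_continuousAt.2 fun T₀ => ?_
  refine continuousAt_of_dominated (bound := fun _ => (|T₀| + 1) ^ 2)
    (Eventually.of_forall fun T => (continuous_fejerKernel T).aestronglyMeasurable) ?_
    (integrable_const _) (Eventually.of_forall fun b => ?_)
  · filter_upwards [Metric.ball_mem_nhds T₀ one_pos] with T hT
    refine Eventually.of_forall fun b => (abs_fejerKernel_le T b).trans ?_
    rw [← sq_abs]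
    have : |T| ≤ |T₀| + 1 := by
      have := abs_sub_abs_le_abs_sub T T₀
      rw [Metric.mem_ball, Real.dist_eq] at hT
      linarith
    gcongr
  · exact (continuous_fejerKernel_left b).continuousAt

/-- Baire category in place of a uniform convergence theorem. The closed sets of t for which the
ratio is at most n for every T ≥ n + 1 cover the line, so one contains an interval; subadditivity
moves the bound to a neighbourhood of 0 and then to all t with quadratic growth. -/
theorem exists_integral_fejerKernel_le {ρ : ℝ → ℝ} (hρ : ∀ T, 0 < T → 0 < ρ T)
    (h : ∀ t : ℝ, ∃ l, Tendsto (fun T => (∫ b, fejerKernel (t * T) b ∂G) / ρ T) atTop (𝓝 l)) :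
    ∃ B T₀ : ℝ, 0 < T₀ ∧ 0 ≤ B ∧ ∀ T, T₀ ≤ T → ∀ t,
      (∫ b, fejerKernel (t * T) b ∂G) / ρ T ≤ B * (t ^ 2 + 1) := by
  set A : ℕ → Set ℝ := fun n =>
    ⋂ T ∈ Set.Ici ((n : ℝ) + 1), {t : ℝ | (∫ b, fejerKernel (t * T) b ∂G) / ρ T ≤ n} with hA
  have hclosed : ∀ n, IsClosed (A n) := fun n => by
    refine isClosed_biInter fun T _ => isClosed_le ?_ continuous_const
    exact (continuous_integral_fejerKernel.comp (continuous_mul_const T)).div_const _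
  have hcover : ⋃ n, A n = Set.univ := by
    refine Set.eq_univ_of_forall fun t => ?_
    obtain ⟨l, hl⟩ := h t
    obtain ⟨T₁, hT₁⟩ := eventually_atTop.1 (hl.eventually (gt_mem_nhds (lt_add_one l)))
    obtain ⟨n, hn⟩ := exists_nat_ge (max T₁ (l + 1))
    refine Set.mem_iUnion.2 ⟨n, Set.mem_iInter₂.2 fun T hT => ?_⟩
    have hT' : (n : ℝ) + 1 ≤ T := hT
    have := hT₁ T (by linarith [le_max_left T₁ (l + 1)])
    have h2 := le_max_right T₁ (l + 1)
    exact this.le.trans (by linarith)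
  obtain ⟨n, a, ha⟩ := nonempty_interior_of_iUnion_of_closed hclosed hcover
  obtain ⟨η, hη, hball⟩ := Metric.isOpen_iff.1 isOpen_interior a ha
  have hmem : ∀ t, |t - a| < η → ∀ T, (n : ℝ) + 1 ≤ T →
      (∫ b, fejerKernel (t * T) b ∂G) / ρ T ≤ n := fun t ht T hT =>
    Set.mem_iInter₂.1 (interior_subset (hball (by rwa [Metric.mem_ball, Real.dist_eq]))) T hT
  have hpos : (0 : ℝ) < n + 1 := by positivity
  -- Write s = (s + a) - a with both times in the interval; `fejerKernel_sub_le` then gives 2n + 2n.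
  have hsmall : ∀ s, |s| < η → ∀ T, (n : ℝ) + 1 ≤ T →
      (∫ b, fejerKernel (s * T) b ∂G) / ρ T ≤ 4 * n := fun s hs T hT => by
    have h1 := hmem (s + a) (by simpa using hs) T hT
    have h2 := hmem a (by simpa using hη) T hT
    have hρT := hρ T (hpos.trans_le hT)
    have h3 : ∫ b, fejerKernel (s * T) b ∂G ≤
        2 * ∫ b, fejerKernel ((s + a) * T) b ∂G + 2 * ∫ b, fejerKernel (a * T) b ∂G := by
      rw [← integral_const_mul, ← integral_const_mul,
        ← integral_add ((integrable_fejerKernel _).const_mul 2)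
            ((integrable_fejerKernel _).const_mul 2)]
      refine integral_mono (integrable_fejerKernel _) (((integrable_fejerKernel _).const_mul 2).add
        ((integrable_fejerKernel _).const_mul 2)) fun b => ?_
      have := fejerKernel_sub_le ((s + a) * T) (a * T) b
      rwa [show (s + a) * T - a * T = s * T by ring] at this
    rw [div_le_iff₀ hρT] at h1 h2 ⊢
    linarith
  refine ⟨4 * n * (2 / η ^ 2 + 2), n + 1, hpos, by positivity, fun T hT t => ?_⟩
  have hρT := hρ T (hpos.trans_le hT)
  -- The least convenient integer with |t|/m < η; the bound at t/m costs a factor m² ≤ (|t|/η + 1)².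
  set m : ℕ := ⌊|t| / η⌋₊ + 1 with hm
  have hm1 : |t| / η < m := by rw [hm]; push_cast; exact Nat.lt_floor_add_one _
  have hm2 : (m : ℝ) ≤ |t| / η + 1 := by
    rw [hm]; push_cast
    linarith [Nat.floor_le (show 0 ≤ |t| / η by positivity)]
  have hm0 : (0 : ℝ) < m := by rw [hm]; positivity
  have h1 := hsmall (t / m) (by
    rw [abs_div, Nat.abs_cast, div_lt_iff₀ hm0, mul_comm]
    exact (div_lt_iff₀ hη).1 hm1) T hT
  have h2 : ∫ b, fejerKernel (t * T) b ∂G ≤ m ^ 2 * ∫ b, fejerKernel (t / m * T) b ∂G := by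
    rw [← integral_const_mul]
    refine integral_mono (integrable_fejerKernel _) ((integrable_fejerKernel _).const_mul _)
        fun b => ?_
    have := fejerKernel_nat_mul_le m (t / m * T) b
    rwa [show (m : ℝ) * (t / m * T) = t * T by field_simp] at this
  calc (∫ b, fejerKernel (t * T) b ∂G) / ρ T
      ≤ m ^ 2 * (∫ b, fejerKernel (t / m * T) b ∂G) / ρ T := by gcongr
    _ = m ^ 2 * ((∫ b, fejerKernel (t / m * T) b ∂G) / ρ T) := by ring
    _ ≤ (|t| / η + 1) ^ 2 * (4 * n) := by
        refine mul_le_mul (by gcongr) h1 ?_ (by positivity)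
        exact div_nonneg (integral_nonneg fun b => fejerKernel_nonneg _ _) hρT.le
    _ ≤ (2 / η ^ 2 + 2) * (t ^ 2 + 1) * (4 * n) := by
        gcongr
        have h5 : (|t| / η) ^ 2 = t ^ 2 / η ^ 2 := by rw [div_pow, sq_abs]
        have h6 : (2 / η ^ 2 + 2) * (t ^ 2 + 1) =
            2 * (t ^ 2 / η ^ 2) + 2 / η ^ 2 + 2 * t ^ 2 + 2 := by
          ring
        have h7 : 0 < 2 / η ^ 2 := by positivity
        rw [h6, ← h5]
        nlinarith [sq_nonneg (|t| / η - 1), sq_nonneg t]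
    _ = _ := by ring

theorem integral_integral_fejerKernel (T : ℝ) :
    ∫ t, (∫ b, fejerKernel (t * T) b ∂G) * ((t ^ 2 - 1) * gauss t) =
      2 * √(2 * Real.pi) * (T ^ 2 * ∫ b, gauss (T * b) ∂G) := by
  have hgc := continuous_gauss
  have hint : Integrable (Function.uncurry fun t b =>
      fejerKernel (t * T) b * ((t ^ 2 - 1) * gauss t))
      (volume.prod G) := by
    have h1 : Integrable (fun p : ℝ × ℝ => T ^ 2 * (p.1 ^ 4 * gauss p.1 + p.1 ^ 2 * gauss p.1) * 1)
        (volume.prod G) :=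
      (((integrable_pow_mul_gauss 4).add (integrable_pow_mul_gauss 2)).const_mul (T ^ 2)).mul_prod
        (integrable_const (1 : ℝ))
    refine h1.mono' ?_ (Eventually.of_forall fun p => ?_)
    · have : Continuous fun p : ℝ × ℝ => fejerKernel (p.1 * T) p.2 :=
        continuous_fejerKernel_uncurry.comp
          (by fun_prop : Continuous fun p : ℝ × ℝ => (p.1 * T, p.2))
      exact (this.mul (by fun_prop)).aestronglyMeasurable
    · simp only [Function.uncurry]
      rw [norm_mul, norm_mul, Real.norm_of_nonneg (gauss_pos p.1).le, ← mul_assoc]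
      have h2 : ‖fejerKernel (p.1 * T) p.2‖ ≤ (p.1 * T) ^ 2 := abs_fejerKernel_le _ _
      have h3 : ‖p.1 ^ 2 - 1‖ ≤ p.1 ^ 2 + 1 := by
        rw [Real.norm_eq_abs, abs_le]
        constructor <;> nlinarith [sq_nonneg p.1]
      have hg := gauss_pos p.1
      calc _ ≤ (p.1 * T) ^ 2 * (p.1 ^ 2 + 1) * gauss p.1 := by gcongr
        _ = _ := by ring
  simp_rw [← integral_mul_const]
  rw [integral_integral_swap hint]
  have h1 : ∀ b, ∫ t, fejerKernel (t * T) b * ((t ^ 2 - 1) * gauss t) =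
      2 * √(2 * Real.pi) * (T ^ 2 * gauss (T * b)) := fun b => by
    simp_rw [fejerKernel_mul, mul_assoc (T ^ 2)]
    rw [integral_const_mul, integral_fejerKernel_mul_gauss]
    ring
  simp_rw [h1]
  rw [integral_const_mul, integral_const_mul]

/-- The Gaussian moment of order α + 2 is α + 1 times that of order α, so the difference is α times
a positive moment. The weight t² - 1 changes sign, hence the explicit evaluation. -/
theorem integral_abs_rpow_mul_gauss_pos {α : ℝ} (hα : 0 < α) :
    0 < ∫ t : ℝ, |t| ^ α * ((t ^ 2 - 1) * gauss t) := by
  have h0 : ∫ t : ℝ, |t| ^ α * ((t ^ 2 - 1) * gauss t) =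
      2 * ∫ t in Set.Ioi (0 : ℝ), t ^ α * ((t ^ 2 - 1) * gauss t) := by
    rw [← integral_comp_abs]
    simp only [sq_abs, gauss]
  have h1 : ∀ q : ℝ, -1 < q → ∫ t in Set.Ioi (0 : ℝ), t ^ q * gauss t =
      (1 / 2 : ℝ) ^ (-(q + 1) / 2) * (1 / 2) * Real.Gamma ((q + 1) / 2) := fun q hq => by
    rw [← integral_rpow_mul_exp_neg_mul_rpow (by norm_num) hq (by norm_num)]
    refine setIntegral_congr_fun measurableSet_Ioi fun t _ => ?_
    simp only [gauss, Real.rpow_two]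
    congr 2
    ring
  have h2 : ∫ t in Set.Ioi (0 : ℝ), t ^ α * ((t ^ 2 - 1) * gauss t) =
      (∫ t in Set.Ioi (0 : ℝ), t ^ (α + 2) * gauss t) -
        ∫ t in Set.Ioi (0 : ℝ), t ^ α * gauss t := by
    rw [← integral_sub (integrableOn_mul_gauss (by linarith))
      (integrableOn_mul_gauss (by linarith))]
    refine setIntegral_congr_fun measurableSet_Ioi fun t ht => ?_
    rw [Real.rpow_add ht, Real.rpow_two]
    ring
  have h3 : (1 / 2 : ℝ) ^ (-(α + 2 + 1) / 2) = (1 / 2 : ℝ) ^ (-(α + 1) / 2) * 2 := by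
    rw [show -(α + 2 + 1) / 2 = -(α + 1) / 2 + (-1) by ring, Real.rpow_add (by norm_num),
      Real.rpow_neg_one]
    norm_num
  have h4 : Real.Gamma ((α + 2 + 1) / 2) = (α + 1) / 2 * Real.Gamma ((α + 1) / 2) := by
    rw [show (α + 2 + 1) / 2 = (α + 1) / 2 + 1 by ring, Real.Gamma_add_one (by positivity)]
  have h5 : 0 < Real.Gamma ((α + 1) / 2) := Real.Gamma_pos_of_pos (by positivity)
  rw [h0, h2, h1 _ (by linarith), h1 _ (by linarith), h3, h4]
  have h6 : 0 < (1 / 2 : ℝ) ^ (-(α + 1) / 2) * Real.Gamma ((α + 1) / 2) * α := by positivity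
  nlinarith

/-- Regular variation gives the limit |t|^{2-β} at each dilation t; averaging against (t² - 1) gauss
t yields the Gaussian kernel, with the Baire bound as majorant. The value of d is irrelevant, only
its positivity is used. -/
theorem tendsto_gauss_of_fejerKernel (hr : IsRegVarying r β) (hβ1 : β ≤ 1)
    (hW : Tendsto (fun T => (∫ b, fejerKernel T b ∂G) / (T ^ 2 * r T)) atTop (𝓝 1)) :
    ∃ d, 0 < d ∧ Tendsto (fun T => (∫ b, gauss (T * b) ∂G) / r T) atTop (𝓝 d) := by
  have hρ : IsRegVarying (fun T => T ^ 2 * r T) (β - 2) := by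
    refine ⟨fun T hT => mul_pos (by positivity) (hr.pos T hT), fun s hs => ?_⟩
    have h1 := (hr.ratio s hs).const_mul (s ^ 2)
    rw [← Real.rpow_two, ← Real.rpow_add hs, show 2 + -β = -(β - 2) by ring] at h1
    refine h1.congr' ?_
    filter_upwards [eventually_gt_atTop 0] with T hT
    have := (hr.pos T hT).ne'
    rw [Real.rpow_two]
    field_simp
  have hα : 0 < 2 - β := by linarith
  have hlim : ∀ t : ℝ, Tendsto (fun T => (∫ b, fejerKernel (t * T) b ∂G) / (T ^ 2 * r T)) atTop
      (𝓝 (|t| ^ (2 - β))) := by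
    have hpos : ∀ t : ℝ, 0 < t → Tendsto (fun T => (∫ b, fejerKernel (t * T) b ∂G) / (T ^ 2 * r T))
        atTop (𝓝 (|t| ^ (2 - β))) := fun t ht => by
      have := hρ.tendsto_comp_mul hW ht
      rwa [one_mul, neg_sub, ← congrArg (· ^ (2 - β)) (abs_of_pos ht)] at this
    intro t
    rcases lt_trichotomy t 0 with h | h | h
    · have := hpos (-t) (by linarith)
      simpa only [neg_mul, fejerKernel_neg, abs_neg] using this
    · simp [h, fejerKernel, orbit, Real.zero_rpow hα.ne']
    · exact hpos t h
  obtain ⟨B, T₀, hT₀, hB, hbound⟩ := exists_integral_fejerKernel_le (G := G) hρ.pos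
    fun t => ⟨_, hlim t⟩
  have hgc := continuous_gauss
  have key : Tendsto (fun T => ∫ t, (∫ b, fejerKernel (t * T) b ∂G) / (T ^ 2 * r T) *
      ((t ^ 2 - 1) * gauss t)) atTop (𝓝 (∫ t : ℝ, |t| ^ (2 - β) * ((t ^ 2 - 1) * gauss t))) := by
    refine tendsto_integral_filter_of_dominated_convergence
      (fun t => B * (t ^ 4 * gauss t + 2 * (t ^ 2 * gauss t) + t ^ 0 * gauss t)) ?_ ?_ ?_ ?_
    · refine Eventually.of_forall fun T => ?_
      exact (((continuous_integral_fejerKernel.comp (continuous_mul_const T)).div_const _).mul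
        (by fun_prop)).aestronglyMeasurable
    · filter_upwards [eventually_ge_atTop T₀] with T hT
      refine Eventually.of_forall fun t => ?_
      have hρT := hρ.pos T (hT₀.trans_le hT)
      have h0 : 0 ≤ (∫ b, fejerKernel (t * T) b ∂G) / (T ^ 2 * r T) :=
        div_nonneg (integral_nonneg fun b => fejerKernel_nonneg _ _) hρT.le
      rw [norm_mul, norm_mul, Real.norm_of_nonneg (gauss_pos t).le, Real.norm_of_nonneg h0]
      have h3 : ‖t ^ 2 - 1‖ ≤ t ^ 2 + 1 := by
        rw [Real.norm_eq_abs, abs_le]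
        constructor <;> nlinarith [sq_nonneg t]
      have hg := gauss_pos t
      calc _ ≤ B * (t ^ 2 + 1) * ((t ^ 2 + 1) * gauss t) := by
            gcongr
            exact hbound T hT t
        _ = _ := by ring
    · exact (((integrable_pow_mul_gauss 4).add ((integrable_pow_mul_gauss 2).const_mul 2)).add
        (integrable_pow_mul_gauss 0)).const_mul B
    · exact Eventually.of_forall fun t => (hlim t).mul_const _
  have hs : 0 < 2 * √(2 * Real.pi) := by positivity
  refine ⟨_, div_pos (integral_abs_rpow_mul_gauss_pos hα) hs, (key.div_const _).congr' ?_⟩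
  filter_upwards [eventually_gt_atTop 0] with T hT
  have := (hr.pos T hT).ne'
  have h1 := integral_integral_fejerKernel (G := G) T
  have h2 : ∀ t, (∫ b, fejerKernel (t * T) b ∂G) / (T ^ 2 * r T) * ((t ^ 2 - 1) * gauss t) =
      (T ^ 2 * r T)⁻¹ * ((∫ b, fejerKernel (t * T) b ∂G) * ((t ^ 2 - 1) * gauss t)) := fun t => by
    rw [div_eq_inv_mul, mul_assoc]
  simp_rw [h2]
  rw [integral_const_mul, h1]
  field_simp

end

/-! ### From the distribution function to the Fejér kernel -/

theorem fejerKernel_one_le {u : ℝ} (hu : 0 < u) : fejerKernel 1 u ≤ 4 * (1 / u ^ 2) := by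
  rw [fejerKernel_eq hu.ne', mul_one_div]
  gcongr
  linarith [Real.neg_one_le_cos (u * 1)]

theorem abs_fejerKernel_one_le (u : ℝ) : |fejerKernel 1 u| ≤ 1 := by
  simpa using abs_fejerKernel_le 1 u

section Tail

variable {μ : Measure ℝ} [SFinite μ] {A M : ℝ}

theorem setLIntegral_fejerKernel_le (hM : 0 < M) (hA : 0 ≤ A)
    (hμ : ∀ u, M ≤ u → μ (Set.Iic u) ≤ ENNReal.ofReal (A * u ^ (3 / 2 : ℝ))) :
    ∫⁻ b in Set.Ici M, ENNReal.ofReal (fejerKernel 1 b) ∂μ ≤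
      ENNReal.ofReal (16 * A * M ^ (-(1 / 2) : ℝ)) := by
  calc ∫⁻ b in Set.Ici M, ENNReal.ofReal (fejerKernel 1 b) ∂μ
      ≤ ∫⁻ b in Set.Ici M, ENNReal.ofReal 4 * ENNReal.ofReal (1 / b ^ 2) ∂μ := by
        refine setLIntegral_mono' measurableSet_Ici fun b hb => ?_
        rw [← ENNReal.ofReal_mul (by norm_num)]
        exact ENNReal.ofReal_le_ofReal (fejerKernel_one_le (hM.trans_le hb))
    _ = ENNReal.ofReal 4 * ∫⁻ b in Set.Ici M, ENNReal.ofReal (1 / b ^ 2) ∂μ :=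
        lintegral_const_mul' _ _ ENNReal.ofReal_ne_top
    _ ≤ ENNReal.ofReal 4 * ENNReal.ofReal (4 * A * M ^ (-(1 / 2) : ℝ)) := by
        gcongr
        exact setLIntegral_inv_sq_le μ hM hA hμ
    _ = _ := by
        rw [← ENNReal.ofReal_mul (by norm_num)]
        congr 1
        ring

theorem setIntegral_fejerKernel_le (hM : 0 < M) (hA : 0 ≤ A)
    (hμ : ∀ u, M ≤ u → μ (Set.Iic u) ≤ ENNReal.ofReal (A * u ^ (3 / 2 : ℝ))) :
    ∫ b in Set.Ici M, fejerKernel 1 b ∂μ ≤ 16 * A * M ^ (-(1 / 2) : ℝ) := by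
  rw [integral_eq_lintegral_of_nonneg_ae (Eventually.of_forall fun b => fejerKernel_nonneg _ _)
    (continuous_fejerKernel 1).aestronglyMeasurable]
  exact ENNReal.toReal_le_of_le_ofReal (by positivity) (setLIntegral_fejerKernel_le hM hA hμ)

theorem integrable_fejerKernel_of_le (hM : 0 < M) (hA : 0 ≤ A)
    (hμ : ∀ u, M ≤ u → μ (Set.Iic u) ≤ ENNReal.ofReal (A * u ^ (3 / 2 : ℝ))) :
    Integrable (fejerKernel 1) μ := by
  have h1 : IntegrableOn (fejerKernel 1) (Set.Iic M) μ :=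
    Measure.integrableOn_of_bounded (M := 1) ((hμ M le_rfl).trans_lt ENNReal.ofReal_lt_top).ne
      (continuous_fejerKernel 1).aestronglyMeasurable (Eventually.of_forall abs_fejerKernel_one_le)
  have h2 : IntegrableOn (fejerKernel 1) (Set.Ici M) μ := by
    refine ⟨(continuous_fejerKernel 1).aestronglyMeasurable, ?_⟩
    rw [hasFiniteIntegral_iff_ofReal (Eventually.of_forall fun b => fejerKernel_nonneg _ _)]
    exact (setLIntegral_fejerKernel_le hM hA hμ).trans_lt ENNReal.ofReal_lt_top
  have := h1.union h2
  rwa [Set.Iic_union_Ici, integrableOn_univ] at this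

/-- A continuous cutoff: `1` for `u ≤ M` and `0` for `u ≥ M + 1`. -/
noncomputable def cutoff (M u : ℝ) : ℝ := max 0 (min 1 (M + 1 - u))

theorem continuous_cutoff (M : ℝ) : Continuous (cutoff M) := by unfold cutoff; fun_prop

theorem cutoff_nonneg (M u : ℝ) : 0 ≤ cutoff M u := le_max_left _ _

theorem cutoff_le_one (M u : ℝ) : cutoff M u ≤ 1 := max_le zero_le_one (min_le_left _ _)

theorem cutoff_of_le {M u : ℝ} (h : u ≤ M) : cutoff M u = 1 := by
  rw [cutoff, min_eq_left (by linarith), max_eq_right zero_le_one]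

theorem cutoff_of_ge {M u : ℝ} (h : M + 1 ≤ u) : cutoff M u = 0 :=
  max_eq_left ((min_le_right _ _).trans (by linarith))

theorem abs_integral_fejerKernel_sub_cutoff_le (hM : 0 < M) (hA : 0 ≤ A)
    (hμ : ∀ u, M ≤ u → μ (Set.Iic u) ≤ ENNReal.ofReal (A * u ^ (3 / 2 : ℝ))) :
    |(∫ b, fejerKernel 1 b ∂μ) - ∫ b, fejerKernel 1 b * cutoff M b ∂μ| ≤
      16 * A * M ^ (-(1 / 2) : ℝ) := by
  have h1 := integrable_fejerKernel_of_le hM hA hμ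
  have h2 : Integrable (fun b => fejerKernel 1 b * cutoff M b) μ :=
    h1.mul_bdd (c := 1) (continuous_cutoff M).aestronglyMeasurable
      (Eventually.of_forall fun b => by
        rw [Real.norm_of_nonneg (cutoff_nonneg M b)]; exact cutoff_le_one M b)
  rw [← integral_sub h1 h2]
  refine le_trans ?_ (setIntegral_fejerKernel_le hM hA hμ)
  rw [← integral_indicator measurableSet_Ici, ← Real.norm_eq_abs]
  refine norm_integral_le_of_norm_le (h1.indicator measurableSet_Ici)
    (Eventually.of_forall fun b => ?_)
  have h0 := fejerKernel_nonneg 1 b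
  by_cases h : M ≤ b
  · rw [Set.indicator_of_mem (show b ∈ Set.Ici M from h), Real.norm_of_nonneg]
    · linarith [mul_nonneg h0 (cutoff_nonneg M b)]
    · linarith [mul_le_mul_of_nonneg_left (cutoff_le_one M b) h0]
  · rw [Set.indicator_of_notMem (show b ∉ Set.Ici M from h), cutoff_of_le (not_le.1 h).le]
    simp

end Tail

theorem integral_fejerKernel_eq (G : Measure ℝ) (T : ℝ) :
    ∫ b, fejerKernel T b ∂G = T ^ 2 * ∫ b, fejerKernel 1 (T * b) ∂G := by
  rw [← integral_const_mul]
  refine integral_congr_ae (Eventually.of_forall fun b => ?_)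
  simp only [← fejerKernel_mul, one_mul]

/-- The Fejér kernel is not compactly supported, but it decays like u⁻² while the rescaled
distribution functions grow at most like u^{3/2}. The tail beyond M is thus O(M^{-1/2}) uniformly in
T, and the truncated kernel is handled by vague convergence. -/
theorem tendsto_fejerKernel_of_distribution {G : Measure ℝ} [IsFiniteMeasure G] {r : ℝ → ℝ}
    {β c : ℝ} (hG : G (Set.Iio 0) = 0) (hr : IsRegVarying r β) (hβ : 0 < β) (hβ1 : β ≤ 1)
    (hc : 0 < c) (hF : Tendsto (fun T => G.real (Set.Iic (1 / T)) / r T) atTop (𝓝 c)) :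
    Tendsto (fun T => (∫ b, fejerKernel T b ∂G) / (T ^ 2 * r T)) atTop
      (𝓝 (c * ∫ u, fejerKernel 1 u ∂(powerMeasure β))) := by
  have hJ := tendsto_gauss_of_distribution hG hr hβ hβ1 hc hF
  obtain ⟨A, T₀, hT₀, hA0, hA⟩ := exists_distribution_le hr hβ1 hc hF
  have hk := continuous_fejerKernel 1
  have key : Tendsto (fun T => (∫ b, fejerKernel 1 (T * b) ∂G) / r T) atTop
      (𝓝 (c * ∫ u, fejerKernel 1 u ∂(powerMeasure β))) := by
    refine tendsto_of_approx fun ε hε => ?_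
    -- The factor A + c covers both truncation errors: A for the rescaled measures, c for the limit.
    have hlim : Tendsto (fun M : ℝ => 16 * (A + c) * M ^ (-(1 / 2) : ℝ)) atTop (𝓝 0) := by
      have := (tendsto_rpow_neg_atTop (y := 1 / 2) (by norm_num)).const_mul (16 * (A + c))
      rwa [mul_zero] at this
    obtain ⟨M, hM1, hMε⟩ : ∃ M : ℝ, 1 ≤ M ∧ 16 * (A + c) * M ^ (-(1 / 2) : ℝ) ≤ ε := by
      obtain ⟨M, h1, h2⟩ := ((hlim.eventually (gt_mem_nhds hε)).and (eventually_ge_atTop 1)).exists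
      exact ⟨M, h2, h1.le⟩
    have hM0 : 0 < M := by linarith
    have hM : 0 ≤ M ^ (-(1 / 2) : ℝ) := by positivity
    refine ⟨_, _, tendsto_integral_comp_mul (k := fun u => fejerKernel 1 u * cutoff M u) hG hr hβ
      hc.le hJ (hk.mul (continuous_cutoff M)) (by linarith : 0 ≤ M + 1)
      (fun u hu => by rw [cutoff_of_ge hu, mul_zero]), ?_, ?_⟩
    · filter_upwards [eventually_ge_atTop T₀] with T hT
      have hT0 := hT₀.trans_le hT
      have hrT := hr.pos T hT0
      have h1 : ∀ u, M ≤ u → (G.map fun b => T * b) (Set.Iic u) ≤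
          ENNReal.ofReal (A * r T * u ^ (3 / 2 : ℝ)) := fun u hu => by
        rw [map_mul_Iic hT0, ← ENNReal.ofReal_toReal (measure_ne_top G (Set.Iic (u / T)))]
        refine ENNReal.ofReal_le_ofReal ?_
        have := hA T hT u (hM1.trans hu)
        rw [div_le_iff₀ hrT] at this
        exact this.trans (le_of_eq (by ring))
      have h2 := abs_integral_fejerKernel_sub_cutoff_le hM0 (by positivity) h1
      have h3 : ∀ f : ℝ → ℝ, Continuous f → ∫ b, f b ∂(G.map fun b => T * b) =
          ∫ b, f (T * b) ∂G := fun f hf => integral_map (by fun_prop) hf.aestronglyMeasurable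
      rw [h3 _ hk, h3 (fun b => fejerKernel 1 b * cutoff M b) (hk.mul (continuous_cutoff M))] at h2
      rw [← sub_div, abs_div, abs_of_pos hrT, div_le_iff₀ hrT]
      refine h2.trans ?_
      calc 16 * (A * r T) * M ^ (-(1 / 2) : ℝ) ≤ 16 * ((A + c) * r T) * M ^ (-(1 / 2) : ℝ) := by
            gcongr
            linarith
        _ = 16 * (A + c) * M ^ (-(1 / 2) : ℝ) * r T := by ring
        _ ≤ ε * r T := by gcongr
    · have h1 : ∀ u, M ≤ u → powerMeasure β (Set.Iic u) ≤
          ENNReal.ofReal (1 * u ^ (3 / 2 : ℝ)) := fun u hu => by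
        rw [powerMeasure_Iic hβ (by linarith), one_mul]
        exact ENNReal.ofReal_le_ofReal
          (Real.rpow_le_rpow_of_exponent_le (by linarith) (by linarith))
      have h2 := abs_integral_fejerKernel_sub_cutoff_le hM0 zero_le_one h1
      rw [← mul_sub, abs_mul, abs_of_pos hc]
      calc _ ≤ c * (16 * 1 * M ^ (-(1 / 2) : ℝ)) := by gcongr
        _ ≤ 16 * (A + c) * M ^ (-(1 / 2) : ℝ) := by nlinarith [mul_nonneg hA0 hM]
        _ ≤ ε := hMε
  refine key.congr' ?_
  filter_upwards [eventually_gt_atTop 0] with T hT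
  rw [integral_fejerKernel_eq, mul_div_mul_left _ _ (by positivity)]

/-! ### The constant -/

/-- By nonnegativity, integrability of the slices is enough to pass to Lebesgue integrals and apply
Tonelli; no joint integrability is needed. -/
theorem integral_Ioi_swap {f : ℝ → ℝ → ℝ} (hf : Measurable (Function.uncurry f))
    (h0 : ∀ u, 0 < u → ∀ t, 0 < t → 0 ≤ f u t)
    (h1 : ∀ u, 0 < u → IntegrableOn (f u) (Set.Ioi 0))
    (h2 : ∀ t, 0 < t → IntegrableOn (fun u => f u t) (Set.Ioi 0)) :
    ∫ u in Set.Ioi 0, ∫ t in Set.Ioi 0, f u t = ∫ t in Set.Ioi 0, ∫ u in Set.Ioi 0, f u t := by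
  have hpos : ∀ {p : ℝ → Prop}, (∀ u, 0 < u → p u) → ∀ᵐ u
      ∂(volume.restrict (Set.Ioi (0 : ℝ))), p u :=
    fun {p} h => (ae_restrict_mem measurableSet_Ioi).mono fun u hu => h u hu
  rw [integral_eq_lintegral_of_nonneg_ae (hpos fun u hu => integral_nonneg_of_ae (hpos (h0 u hu)))
      hf.stronglyMeasurable.integral_prod_right.aestronglyMeasurable,
    integral_eq_lintegral_of_nonneg_ae
      (hpos fun t ht => integral_nonneg_of_ae (hpos fun u hu => h0 u hu t ht))
      hf.stronglyMeasurable.integral_prod_left.aestronglyMeasurable]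
  congr 1
  rw [lintegral_congr_ae (hpos fun u hu =>
      ofReal_integral_eq_lintegral_ofReal (h1 u hu) (hpos (h0 u hu))),
    lintegral_congr_ae (hpos fun t ht =>
      ofReal_integral_eq_lintegral_ofReal (h2 t ht) (hpos fun u hu => h0 u hu t ht))]
  exact lintegral_lintegral_swap hf.ennreal_ofReal.aemeasurable

/-- Write 1/(1 + t²) = ∫_0^∞ e^{-s(1+t²)} ds and exchange; the result is Γ(α/2) Γ(1 - α/2)/2,
evaluated by the reflection formula. -/
theorem integral_rpow_div_one_add_sq {α : ℝ} (hα : 0 < α) (hα2 : α < 2) :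
    ∫ t in Set.Ioi (0 : ℝ), t ^ (α - 1) / (1 + t ^ 2) =
      Real.pi / (2 * Real.sin (α * Real.pi / 2)) := by
  have e1 : ∀ t, 0 < t → ∀ s : ℝ, t ^ (α - 1) * Real.exp (-(s * (1 + t ^ 2))) =
      t ^ (α - 1) * Real.exp (-(1 + t ^ 2) * s) := fun t _ s => by
    congr 2; ring
  have i1 : ∀ t, 0 < t → IntegrableOn (fun s => t ^ (α - 1) * Real.exp (-(s * (1 + t ^ 2))))
      (Set.Ioi 0) := fun t ht => by
    simp_rw [e1 t ht]
    exact (exp_neg_integrableOn_Ioi 0 (by positivity)).const_mul _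
  have v1 : ∀ t, 0 < t → ∫ s in Set.Ioi (0 : ℝ), t ^ (α - 1) * Real.exp (-(s * (1 + t ^ 2))) =
      t ^ (α - 1) / (1 + t ^ 2) := fun t ht => by
    simp_rw [e1 t ht]
    rw [integral_const_mul, integral_exp_mul_Ioi (by nlinarith [sq_nonneg t]), mul_zero,
      Real.exp_zero, neg_div_neg_eq, mul_one_div]
  have e2 : ∀ s, 0 < s → ∀ t : ℝ, t ^ (α - 1) * Real.exp (-(s * (1 + t ^ 2))) =
      Real.exp (-s) * (t ^ (α - 1) * Real.exp (-s * t ^ (2 : ℝ))) := fun s _ t => by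
    rw [mul_left_comm, ← Real.exp_add, Real.rpow_two]
    congr 2; ring
  have i2 : ∀ s, 0 < s → IntegrableOn (fun t => t ^ (α - 1) * Real.exp (-(s * (1 + t ^ 2))))
      (Set.Ioi 0) := fun s hs => by
    simp_rw [e2 s hs]
    exact (integrableOn_rpow_mul_exp_neg_mul_rpow (by linarith) two_pos hs).const_mul _
  have v2 : ∀ s, 0 < s → ∫ t in Set.Ioi (0 : ℝ), t ^ (α - 1) * Real.exp (-(s * (1 + t ^ 2))) =
      Real.exp (-s) * s ^ ((1 - α / 2) - 1) * (1 / 2 * Real.Gamma (α / 2)) := fun s hs => by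
    simp_rw [e2 s hs]
    rw [integral_const_mul, integral_rpow_mul_exp_neg_mul_rpow two_pos (by linarith) hs,
      sub_add_cancel, show -α / 2 = 1 - α / 2 - 1 by ring]
    ring
  have h := integral_Ioi_swap (f := fun t s => t ^ (α - 1) * Real.exp (-(s * (1 + t ^ 2))))
    (by unfold Function.uncurry; fun_prop) (fun t ht s hs => by positivity) i1 i2
  rw [setIntegral_congr_fun measurableSet_Ioi v1, setIntegral_congr_fun measurableSet_Ioi v2,
    integral_mul_const, ← Real.Gamma_eq_integral (by linarith)] at h
  rw [h, mul_left_comm, mul_comm (Real.Gamma _), Real.Gamma_mul_Gamma_one_sub,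
    show Real.pi * (α / 2) = α * Real.pi / 2 by ring]
  ring

/-- An explicit antiderivative vanishing at infinity gives the value, and also integrability because
the integrand is nonnegative. -/
theorem one_sub_cos_mul_exp_integral {t : ℝ} (ht : 0 < t) :
    IntegrableOn (fun u => (1 - Real.cos u) * Real.exp (-(t * u))) (Set.Ioi 0) ∧
      ∫ u in Set.Ioi (0 : ℝ), (1 - Real.cos u) * Real.exp (-(t * u)) = 1 / (t * (1 + t ^ 2)) := by
  have hderiv : ∀ u : ℝ, HasDerivAt (fun u => Real.exp (-(t * u)) *
      ((t * Real.cos u - Real.sin u) / (1 + t ^ 2) - 1 / t))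
      ((1 - Real.cos u) * Real.exp (-(t * u))) u := fun u => by
    have h1 : HasDerivAt (fun u : ℝ => -(t * u)) (-t) u := by
      exact ((hasDerivAt_id u).const_mul t).neg.congr_deriv (by simp)
    have h2 : HasDerivAt (fun u => (t * Real.cos u - Real.sin u) / (1 + t ^ 2) - 1 / t)
        ((t * -Real.sin u - Real.cos u) / (1 + t ^ 2)) u :=
      ((((Real.hasDerivAt_cos u).const_mul t).sub (Real.hasDerivAt_sin u)).div_const _).sub_const _
    refine (h1.exp.mul h2).congr_deriv ?_
    field_simp
    ring
  have hlim : Tendsto (fun u => Real.exp (-(t * u)) *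
      ((t * Real.cos u - Real.sin u) / (1 + t ^ 2) - 1 / t)) atTop (𝓝 0) := by
    have h1 : Tendsto (fun u : ℝ => Real.exp (-(t * u))) atTop (𝓝 0) :=
      Real.tendsto_exp_atBot.comp (tendsto_neg_atTop_atBot.comp (tendsto_id.const_mul_atTop ht))
    refine squeeze_zero_norm (a := fun u => Real.exp (-(t * u)) * ((t + 1) / (1 + t ^ 2) + 1 / t))
      (fun u => ?_) (by simpa using h1.mul_const ((t + 1) / (1 + t ^ 2) + 1 / t))
    rw [norm_mul, Real.norm_of_nonneg (Real.exp_pos _).le]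
    refine mul_le_mul_of_nonneg_left ?_ (Real.exp_pos _).le
    refine (norm_sub_le _ _).trans ?_
    rw [norm_div, Real.norm_of_nonneg (show 0 ≤ 1 + t ^ 2 by positivity),
      Real.norm_of_nonneg (show 0 ≤ 1 / t by positivity)]
    gcongr
    refine (norm_sub_le _ _).trans ?_
    rw [norm_mul, Real.norm_of_nonneg ht.le]
    have h2 : ‖Real.cos u‖ ≤ 1 := Real.abs_cos_le_one u
    have h3 : ‖Real.sin u‖ ≤ 1 := Real.abs_sin_le_one u
    nlinarith
  have hnn : ∀ u ∈ Set.Ioi (0 : ℝ), 0 ≤ (1 - Real.cos u) * Real.exp (-(t * u)) := fun u _ =>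
    mul_nonneg (by linarith [Real.cos_le_one u]) (Real.exp_pos _).le
  refine ⟨integrableOn_Ioi_deriv_of_nonneg' (fun u _ => hderiv u) hnn hlim, ?_⟩
  rw [integral_Ioi_of_hasDerivAt_of_nonneg' (fun u _ => hderiv u) hnn hlim]
  simp
  field_simp
  ring

/-- Γ(1 + α) u^{-(1+α)} = ∫_0^∞ t^α e^{-tu} dt, and exchanging the integrals reduces to
`integral_rpow_div_one_add_sq`. -/
theorem integral_one_sub_cos_mul_rpow {α : ℝ} (hα : 0 < α) (hα2 : α < 2) :
    Real.Gamma (1 + α) * ∫ u in Set.Ioi (0 : ℝ), (1 - Real.cos u) * u ^ (-(1 + α)) =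
      Real.pi / (2 * Real.sin (α * Real.pi / 2)) := by
  have e1 : ∀ u : ℝ, ∀ t : ℝ, (1 - Real.cos u) * Real.exp (-(t * u)) * t ^ α =
      (1 - Real.cos u) * (t ^ α * Real.exp (-u * t ^ (1 : ℝ))) := fun u t => by
    rw [Real.rpow_one, show -u * t = -(t * u) by ring]; ring
  have i1 : ∀ u, 0 < u → IntegrableOn (fun t => (1 - Real.cos u) * Real.exp (-(t * u)) * t ^ α)
      (Set.Ioi 0) := fun u hu => by
    simp_rw [e1 u]
    exact (integrableOn_rpow_mul_exp_neg_mul_rpow (by linarith) one_pos hu).const_mul _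
  have v1 : ∀ u ∈ Set.Ioi (0 : ℝ),
      ∫ t in Set.Ioi (0 : ℝ), (1 - Real.cos u) * Real.exp (-(t * u)) * t ^ α =
        Real.Gamma (1 + α) * ((1 - Real.cos u) * u ^ (-(1 + α))) := fun u hu => by
    simp_rw [e1 u]
    rw [integral_const_mul, integral_rpow_mul_exp_neg_mul_rpow one_pos (by linarith) hu]
    simp only [div_one, mul_one, add_comm α]
    ring
  have v2 : ∀ t ∈ Set.Ioi (0 : ℝ),
      ∫ u in Set.Ioi (0 : ℝ), (1 - Real.cos u) * Real.exp (-(t * u)) * t ^ α =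
        t ^ (α - 1) / (1 + t ^ 2) := fun t ht => by
    have ht' : (0 : ℝ) < t := ht
    rw [integral_mul_const, (one_sub_cos_mul_exp_integral ht).2, Real.rpow_sub_one ht'.ne']
    field_simp
  have h := integral_Ioi_swap (f := fun u t => (1 - Real.cos u) * Real.exp (-(t * u)) * t ^ α)
    (by unfold Function.uncurry; fun_prop) (fun u _ t ht => mul_nonneg (mul_nonneg
      (by linarith [Real.cos_le_one u]) (Real.exp_pos _).le) (by positivity)) i1
    fun t ht => (one_sub_cos_mul_exp_integral ht).1.mul_const _
  rw [setIntegral_congr_fun measurableSet_Ioi v1, setIntegral_congr_fun measurableSet_Ioi v2,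
    integral_const_mul, integral_rpow_div_one_add_sq hα hα2] at h
  exact h

theorem C_pos {α : ℝ} (hα : 1 ≤ α) (hα2 : α < 2) : 0 < C α := by
  have h1 : 0 < Real.sin (α * Real.pi / 2) :=
    Real.sin_pos_of_pos_of_lt_pi (by positivity) (by nlinarith [Real.pi_pos])
  have h2 : 0 < Real.Gamma (1 + α) := Real.Gamma_pos_of_pos (by linarith)
  have h3 : 0 < 2 - α := by linarith
  have := Real.pi_pos
  unfold C
  positivity

/-- C(α) is thus the reciprocal of the factor appearing in the Abelian theorem, which is where it
comes from. -/
theorem C_mul_integral_fejerKernel {α : ℝ} (hα : 1 ≤ α) (hα2 : α < 2) :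
    C α * ∫ u, fejerKernel 1 u ∂(powerMeasure (2 - α)) = 1 := by
  have h1 : 0 < Real.sin (α * Real.pi / 2) :=
    Real.sin_pos_of_pos_of_lt_pi (by positivity) (by nlinarith [Real.pi_pos])
  have h2 : 0 < Real.Gamma (1 + α) := Real.Gamma_pos_of_pos (by linarith)
  have h3 : 0 < 2 - α := by linarith
  have hpi := Real.pi_pos
  have h4 : ∫ u, fejerKernel 1 u ∂(powerMeasure (2 - α)) =
      2 * (2 - α) * ∫ u in Set.Ioi (0 : ℝ), (1 - Real.cos u) * u ^ (-(1 + α)) := by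
    rw [integral_powerMeasure h3, ← integral_const_mul]
    refine setIntegral_congr_fun measurableSet_Ioi fun u hu => ?_
    have hu' : (0 : ℝ) < u := hu
    have h5 : u ^ (2 - α - 1) = u ^ (-(1 + α)) * u ^ 2 := by
      rw [← Real.rpow_two, ← Real.rpow_add hu']
      congr 1
      ring
    simp only [fejerKernel_eq hu'.ne', mul_one, h5]
    field_simp
  have h5 := integral_one_sub_cos_mul_rpow (by linarith : 0 < α) hα2
  rw [h4, C]
  calc _ = 2 * Real.sin (α * Real.pi / 2) / Real.pi * (Real.Gamma (1 + α) *
        ∫ u in Set.Ioi (0 : ℝ), (1 - Real.cos u) * u ^ (-(1 + α))) := by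
        field_simp
    _ = 1 := by
        rw [h5]
        field_simp

theorem C_one : C 1 = 1 / Real.pi := by
  rw [C, show (1 : ℝ) + 1 = 2 by norm_num, Real.Gamma_two, one_mul, one_mul, Real.sin_pi_div_two]
  norm_num

/-! ### The Tauberian theorem for the Fejér kernel -/

theorem IsSlowlyVarying.isRegVarying {h : ℝ → ℝ} (hh : IsSlowlyVarying h) (α : ℝ) :
    IsRegVarying (fun T => T ^ (α - 2) * h T) (2 - α) := by
  refine ⟨fun T hT => mul_pos (by positivity) (hh.2.1 T hT), fun s hs => ?_⟩
  have h1 := (hh.2.2 s hs).const_mul (s ^ (α - 2))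
  rw [mul_one, ← neg_sub] at h1
  refine h1.congr' ?_
  filter_upwards [eventually_gt_atTop 0] with T hT
  have h2 := (hh.2.1 T hT).ne'
  have h3 : 0 < T ^ (α - 2) := by positivity
  rw [neg_sub, Real.mul_rpow hs.le hT.le]
  field_simp

theorem tendsto_nhdsGT_zero_iff {f : ℝ → ℝ} {l : Filter ℝ} :
    Tendsto f (𝓝[>] 0) l ↔ Tendsto (fun T => f (1 / T)) atTop l := by
  simp only [one_div]
  refine ⟨fun h => h.comp tendsto_inv_atTop_nhdsGT_zero, fun h => ?_⟩
  simpa [Function.comp_def] using h.comp tendsto_inv_nhdsGT_zero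

/-- Put r(T) = T^{α-2} h(T), of index -(2 - α). The Tauberian direction first gives convergence to
some positive constant, by way of the Gaussian kernel. -/
theorem tendsto_fejerKernel_iff {G : Measure ℝ} [IsFiniteMeasure G] (hG : G (Set.Iio 0) = 0)
    {α : ℝ} (hα : 1 ≤ α) (hα2 : α < 2) {h : ℝ → ℝ} (hh : IsSlowlyVarying h) :
    Tendsto (fun T => (∫ b, fejerKernel T b ∂G) / (T ^ α * h T)) atTop (𝓝 1) ↔
      Tendsto (fun x => G.real (Set.Iic x) / (C α * x ^ (2 - α) * h (1 / x))) (𝓝[>] 0) (𝓝 1) := by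
  have hr := hh.isRegVarying α
  have hC := C_pos hα hα2
  have hκ := C_mul_integral_fejerKernel hα hα2
  have hβ : 0 < 2 - α := by linarith
  have hβ1 : 2 - α ≤ 1 := by linarith
  have e1 : Tendsto (fun T => (∫ b, fejerKernel T b ∂G) / (T ^ α * h T)) atTop (𝓝 1) ↔
      Tendsto (fun T => (∫ b, fejerKernel T b ∂G) / (T ^ 2 * (T ^ (α - 2) * h T))) atTop (𝓝 1) := by
    refine tendsto_congr' ?_
    filter_upwards [eventually_gt_atTop 0] with T hT
    rw [← mul_assoc, ← Real.rpow_two, ← Real.rpow_add hT, add_sub_cancel]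
  have e2 : Tendsto (fun x => G.real (Set.Iic x) / (C α * x ^ (2 - α) * h (1 / x))) (𝓝[>] 0) (𝓝 1) ↔
      Tendsto (fun T => G.real (Set.Iic (1 / T)) / (T ^ (α - 2) * h T)) atTop (𝓝 (C α)) := by
    rw [tendsto_nhdsGT_zero_iff]
    have e3 : ∀ᶠ T in atTop,
        G.real (Set.Iic (1 / T)) / (C α * (1 / T) ^ (2 - α) * h (1 / (1 / T))) =
        (C α)⁻¹ * (G.real (Set.Iic (1 / T)) / (T ^ (α - 2) * h T)) := by
      filter_upwards [eventually_gt_atTop 0] with T hT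
      rw [one_div_one_div, one_div, Real.inv_rpow hT.le, ← Real.rpow_neg hT.le, neg_sub, mul_assoc,
        div_mul_eq_div_div, div_eq_inv_mul _ (C α), mul_div_assoc]
    rw [tendsto_congr' e3]
    refine ⟨fun h1 => ?_, fun h1 => ?_⟩
    · have := h1.const_mul (C α)
      simpa only [mul_inv_cancel_left₀ hC.ne', mul_one] using this
    · have := h1.const_mul (C α)⁻¹
      rwa [inv_mul_cancel₀ hC.ne'] at this
  rw [e1, e2]
  constructor
  · intro hW
    obtain ⟨d, hd, hJ⟩ := tendsto_gauss_of_fejerKernel hr hβ1 hW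
    have hm := gaussMoment_pos hβ
    have hJ' : Tendsto (fun T => (∫ b, gauss (T * b) ∂G) / (T ^ (α - 2) * h T)) atTop
        (𝓝 (d / gaussMoment (2 - α) * gaussMoment (2 - α))) := by
      rwa [div_mul_cancel₀ _ hm.ne']
    have hF := tendsto_distribution_of_gauss hG hr hβ hβ1 (by positivity) hJ'
    -- Running the Abelian theorem on the limit just found and comparing with the hypothesis forces
    -- the constant to be C(α).
    have hW' := tendsto_fejerKernel_of_distribution hG hr hβ hβ1 (by positivity) hF
    have h1 := tendsto_nhds_unique hW hW'
    have h2 : d / gaussMoment (2 - α) = C α := by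
      have h3 : (∫ u, fejerKernel 1 u ∂(powerMeasure (2 - α))) ≠ 0 := fun h0 => by
        rw [h0, mul_zero] at h1
        exact one_ne_zero h1
      exact mul_right_cancel₀ h3 (h1.symm.trans hκ.symm)
    rwa [h2] at hF
  · intro hF
    have := tendsto_fejerKernel_of_distribution hG hr hβ hβ1 hC hF
    rwa [hκ] at this

theorem isSlowlyVarying_const {K : ℝ} (hK : 0 < K) : IsSlowlyVarying fun _ => K :=
  ⟨measurable_const, fun _ _ => hK, fun _ _ => by simp [hK.ne']⟩

/-! ### The asymptotics of the variance -/

section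

variable {ν : Measure ℂ} [IsFiniteMeasure ν]

/-- The case α = 1, h = K of the Tauberian theorem, with C(1) = 1/π. -/
theorem tendsto_fejerKernel_linear_iff {K : ℝ} (hK : 0 < K) :
    Tendsto (fun T => (∫ b, fejerKernel T b ∂(sectorMeasure ν)) / T) atTop (𝓝 K) ↔
      Tendsto (fun x => ν.real (U x) / x) (𝓝[>] 0) (𝓝 (K / Real.pi)) := by
  have h := tendsto_fejerKernel_iff (sectorMeasure_Iio_zero (ν := ν)) le_rfl one_lt_two
    (isSlowlyVarying_const hK)
  simp only [sectorMeasure_Iic, C_one, Real.rpow_one, show (2 : ℝ) - 1 = 1 by norm_num] at h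
  have hpi := Real.pi_pos
  have key : ∀ {f : ℝ → ℝ} {l : Filter ℝ} {c : ℝ}, 0 < c →
      (Tendsto f l (𝓝 c) ↔ Tendsto (fun x => f x / c) l (𝓝 1)) := fun {f l c} hc => by
    refine ⟨fun h1 => ?_, fun h1 => ?_⟩
    · have := h1.div_const c
      rwa [div_self hc.ne'] at this
    · have := h1.mul_const c
      simpa only [div_mul_cancel₀ _ hc.ne', one_mul] using this
  rw [key hK, key (div_pos hK hpi)]
  convert h using 3 with T x
  · rw [div_div]
  · rw [div_div]
    congr 1
    ring

theorem tendsto_variance_div_iff (hν : ∀ᵐ z ∂ν, z.re ≤ 0) {K : ℝ} (hK : 0 < K) :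
    (∃ L : ℝ, ENNReal.ofReal L = varsigmaSq ν + ENNReal.ofReal K ∧
        Tendsto (fun T => (∫ z, varKernel T z ∂ν) / T) atTop (𝓝 L)) ↔
      (varsigmaSq ν < ∞ ∧
        Tendsto (fun x => ν.real (U x) / x) (𝓝[>] 0) (𝓝 (K / Real.pi))) := by
  rw [← tendsto_fejerKernel_linear_iff hK]
  constructor
  · rintro ⟨L, hL, hlim⟩
    have hς := varsigmaSq_lt_top_of_tendsto hν hlim
    refine ⟨hς, ?_⟩
    have h1 : L = (varsigmaSq ν).toReal + K := by
      -- A negative L is excluded because `ENNReal.ofReal` would send it to 0, while the right-hand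
      -- side is at least K > 0.
      have h2 : 0 ≤ L := by
        by_contra! hneg
        rw [ENNReal.ofReal_of_nonpos hneg.le] at hL
        have := (add_eq_zero.1 hL.symm).2
        rw [ENNReal.ofReal_eq_zero] at this
        linarith
      have h3 := congrArg ENNReal.toReal hL
      rwa [ENNReal.toReal_ofReal h2, ENNReal.toReal_add hς.ne ENNReal.ofReal_ne_top,
        ENNReal.toReal_ofReal hK.le] at h3
    have h4 := hlim.sub (tendsto_variance_sub hν hς)
    rw [h1, add_sub_cancel_left] at h4
    simpa using h4
  · rintro ⟨hς, hlim⟩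
    refine ⟨(varsigmaSq ν).toReal + K, ?_, ?_⟩
    · rw [ENNReal.ofReal_add ENNReal.toReal_nonneg hK.le, ENNReal.ofReal_toReal hς.ne]
    · simpa using (tendsto_variance_sub hν hς).add hlim

/-- V/T - W/T stays bounded while V/T → ∞, so V ~ W and either may be used in the asymptotics. -/
theorem tendsto_variance_div_rpow_iff (hν : ∀ᵐ z ∂ν, z.re ≤ 0) (hς : varsigmaSq ν < ∞)
    (hV : Tendsto (fun T => (∫ z, varKernel T z ∂ν) / T) atTop atTop) {α : ℝ} (hα : 1 ≤ α)
    (hα2 : α < 2) {h : ℝ → ℝ} (hh : IsSlowlyVarying h) :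
    Tendsto (fun T => (∫ z, varKernel T z ∂ν) / (T ^ α * h T)) atTop (𝓝 1) ↔
      Tendsto (fun x => ν.real (U x) / (C α * x ^ (2 - α) * h (1 / x))) (𝓝[>] 0) (𝓝 1) := by
  simp only [← sectorMeasure_Iic]
  rw [← tendsto_fejerKernel_iff sectorMeasure_Iio_zero hα hα2 hh]
  set V : ℝ → ℝ := fun T => ∫ z, varKernel T z ∂ν with hVdef
  set W : ℝ → ℝ := fun T => ∫ b, fejerKernel T b ∂(sectorMeasure ν) with hWdef
  have hsub : Tendsto (fun T => V T / T - W T / T) atTop (𝓝 (varsigmaSq ν).toReal) :=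
    tendsto_variance_sub hν hς
  change Tendsto (fun T => V T / (T ^ α * h T)) atTop (𝓝 1) ↔
    Tendsto (fun T => W T / (T ^ α * h T)) atTop (𝓝 1)
  have h1 : Tendsto (fun T => W T / V T) atTop (𝓝 1) := by
    have h2 : Tendsto (fun T => 1 - (V T / T - W T / T) / (V T / T)) atTop (𝓝 (1 - 0)) :=
      (hsub.div_atTop hV).const_sub 1
    rw [sub_zero] at h2
    refine h2.congr' ?_
    filter_upwards [eventually_gt_atTop 0, hV.eventually_gt_atTop 0] with T hT hVT
    have hVT' : 0 < V T := (div_pos_iff_of_pos_right hT).1 hVT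
    field_simp
    ring
  have h2 : Tendsto (fun T => V T / W T) atTop (𝓝 1) := by
    have := h1.inv₀ one_ne_zero
    simpa only [inv_div, inv_one] using this
  have hVpos : ∀ᶠ T in atTop, V T ≠ 0 := by
    filter_upwards [eventually_gt_atTop 0, hV.eventually_gt_atTop 0] with T hT hVT
    exact ((div_pos_iff_of_pos_right hT).1 hVT).ne'
  have hWpos : ∀ᶠ T in atTop, W T ≠ 0 := by
    filter_upwards [h1.eventually (lt_mem_nhds zero_lt_one)] with T hT h0
    rw [h0, zero_div] at hT
    exact lt_irrefl _ hT
  constructor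
  · intro h3
    have := h1.mul h3
    rw [one_mul] at this
    refine this.congr' ?_
    filter_upwards [hVpos] with T hT
    field_simp
  · intro h3
    have := h2.mul h3
    rw [one_mul] at this
    refine this.congr' ?_
    filter_upwards [hWpos] with T hT
    field_simp

end

end NormalMarkov

/-! ### Assembly: from the process to the kernel asymptotics -/

theorem mainTheorem7 {Ω S : Type*} [mΩ : MeasurableSpace Ω] [mS : MeasurableSpace S]
    (P : Measure Ω) [IsProbabilityMeasure P] (π : Measure S)
    (ℱ : Filtration ℝ≥0 mΩ) (ξ : ℝ≥0 → Ω → S)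
    (hprog : IsProgressive ℱ ξ)
    (hπ : ∀ t, MeasurePreserving (ξ t) P π)
    (hMarkov : NormalMarkov.HasMarkovProperty P π ℱ ξ hπ)
    (hcont : ∀ f : Lp ℂ 2 π, Continuous fun t => NormalMarkov.transitionOp P π ξ hπ t f)
    (hnormal : NormalMarkov.IsNormalOperator
      (NormalMarkov.generator (NormalMarkov.transitionOp P π ξ hπ)))
    (g : S → ℝ) (hg : MemLp g 2 π) (hg0 : ∫ x, g x ∂π = 0)
    (ν : Measure ℂ) (hν : ν = NormalMarkov.transitionSpectralMeasure P π ξ hπ g hg)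
    (V : ℝ → ℝ) (hV : V = fun T => variance (NormalMarkov.additiveFunctional ξ g T) P) :
    (∀ K : ℝ, 0 < K →
      ((∃ L : ℝ, ENNReal.ofReal L = NormalMarkov.varsigmaSq ν + ENNReal.ofReal K ∧
          Tendsto (fun T => V T / T) atTop (𝓝 L)) ↔
        (NormalMarkov.varsigmaSq ν < ∞ ∧
          Tendsto (fun x => ν.real (NormalMarkov.U x) / x) (𝓝[>] 0) (𝓝 (K / Real.pi))))) ∧
    ((∃ L : ℝ, Tendsto (fun T => V T / T) atTop (𝓝 L)) → NormalMarkov.varsigmaSq ν < ∞) ∧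
    (NormalMarkov.varsigmaSq ν < ∞ → Tendsto (fun T => V T / T) atTop atTop →
      ∀ α : ℝ, 1 ≤ α → α < 2 → ∀ h : ℝ → ℝ, NormalMarkov.IsSlowlyVarying h →
        (Tendsto (fun T => V T / (T ^ α * h T)) atTop (𝓝 1) ↔
          Tendsto (fun x => ν.real (NormalMarkov.U x) /
            (NormalMarkov.C α * x ^ (2 - α) * h (1 / x))) (𝓝[>] 0) (𝓝 1))) := by
  have : IsProbabilityMeasure π := by
    rw [← (hπ 0).map_eq]
    exact Measure.isProbabilityMeasure_map (hπ 0).measurable.aemeasurable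
  have hsemi := NormalMarkov.isContractionSemigroup_transitionOp hprog hMarkov hcont
  have hfin : IsFiniteMeasure ν := by
    rw [hν]
    exact hsemi.isFiniteMeasure_spectralMeasure _
  have hre : ∀ᵐ z ∂ν, z.re ≤ 0 := by
    rw [hν]
    exact hsemi.ae_re_nonpos hnormal _
  have hVT : ∀ T, 0 ≤ T → V T = ∫ z, NormalMarkov.varKernel T z ∂ν := fun T hT => by
    simp only [hV]
    rw [NormalMarkov.variance_additiveFunctional hg hg0 hprog hMarkov hT,
      ← NormalMarkov.integral_integral_re_exp hre hT]
    simp_rw [hsemi.inner_apply_eq_integral hnormal, Real.coe_toNNReal _ (abs_nonneg _), hν,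
      NormalMarkov.transitionSpectralMeasure]
  have hdiv : ∀ f : ℝ → ℝ, (fun T => V T / f T) =ᶠ[atTop]
      fun T => (∫ z, NormalMarkov.varKernel T z ∂ν) / f T := fun f => by
    filter_upwards [eventually_ge_atTop 0] with T hT
    rw [hVT T hT]
  refine ⟨fun K hK => ?_, ?_, ?_⟩
  · rw [← NormalMarkov.tendsto_variance_div_iff hre hK]
    simp_rw [tendsto_congr' (hdiv fun T => T)]
  · rintro ⟨L, hL⟩
    exact NormalMarkov.varsigmaSq_lt_top_of_tendsto hre (hL.congr' (hdiv fun T => T))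
  · intro hς hVtop α hα hα2 h hh
    rw [tendsto_congr' (hdiv fun T => T ^ α * h T)]
    exact NormalMarkov.tendsto_variance_div_rpow_iff hre hς
      (hVtop.congr' (hdiv fun T => T)) hα hα2 hh
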